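/- A bivariate copula $C$ is the joint distribution function $C(u,v)=P(U\le u,V\le v)$ of two random variables that are uniformly distributed on $[0,1]$. If $C$ is absolutely continuous, with density $c$, its copula entropy is $H(C)=-\int_{[0,1]^2}c\log c\,du\,dv\in[-\infty,0]$. Spearman's rho of $C$ is $\rho_s(C)=12\int_0^1\!\int_0^1 C(u,v)\,du\,dv-3$. For points $p,q$ of the plane let $p\vee q$, $p\wedge q$ be the componentwise maximum and minimum. A function $f$ is TP2 if $f(p)f(q)\le f(p\vee q)f(p\wedge q)$ for all $p,q$, and RR2 if the reverse inequality holds; $\Psi:\mathbb R^2\to\mathbb R$ is super-modular if $\Psi(p)+\Psi(q)\le\Psi(p\vee q)+\Psi(p\wedge q)$ for all $p,q$. For copulas write $C\le_{SM}D$ if $E_C\Psi\le E_D\Psi$ for every super-modular $\Psi$ for which both expectations exist (as finite numbers). A family $(C_\theta)_{\theta\in\Theta}$, $\Theta\subseteq\mathbb R$, is increasing in $\le_{SM}$ if $\theta_1\le\theta_2$ implies $C_{\theta_1}\le_{SM}C_{\theta_2}$, and decreasing if $\theta_1\le\theta_2$ implies $C_{\theta_2}\le_{SM}C_{\theta_1}$.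 The Archimedean copula with generator $\psi$, where $\psi:[0,\infty)\to[0,\infty)$ is strictly convex with $\psi(\infty)=0$, is $C(u,v)=\psi(\psi^{-1}(u)+\psi^{-1}(v))$. A function $\psi$ on $[0,\infty)$ is completely monotone if it is continuous on $[0,\infty)$, smooth on $(0,\infty)$, and $(-1)^n\psi^{(n)}\ge0$ on $(0,\infty)$ for all $n\ge0$. Let $\Theta\subseteq\mathbb R$ and let $(C_\theta)_{\theta\in\Theta}$ be a family of absolutely continuous bivariate copulas that satisfies one of the following conditions. In (c), let $\Theta,\Delta\subseteq\mathbb R$, let $(C_{\theta,\delta})_{\theta\in\Theta,\,\delta\in\Delta}$ be a two-parameter family of absolutely continuous copulas, and let $C_\theta=C_{\theta,\delta}$ for an arbitrary fixed $\delta\in\Delta$. (a) Either every $C_\theta$ has a density that is TP2 on $(0,1)^2$, or every $C_\theta$ has a density that is RR2 on $(0,1)^2$; and the family is increasing, or decreasing, in $\le_{SM}$. (b) Every $C_\theta$ is Archimedean with a completely monotone generator $\phi_\theta$ such that $\phi_\theta(0)=1$, and the family is increasing in $\le_{SM}$. (c) Every $C_{\theta,\delta}$ is Archimedean with a completely monotone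 generator $\eta_{\theta,\delta}$ such that $\eta_{\theta,\delta}(0)=1$, and, for each fixed $\delta$, the family is increasing in $\le_{SM}$ with respect to $\theta$. (d) The $C_\theta$ are the copulas of bivariate elliptical distributions with a common density generator $g$: $C_\theta$ is the copula of a probability density $|\Sigma_\theta|^{-1/2}\,g\big((x-m_\theta)^{T}\Sigma_\theta^{-1}(x-m_\theta)\big)$ on $\mathbb R^2$ with $m_\theta\in\mathbb R^2$, $\Sigma_\theta$ positive definite, and a measurable $g:[0,\infty)\to[0,\infty)$ that does not depend on $\theta$. Then the magnitude of Spearman's rho is a monotone (non-increasing) function of the copula entropy within the family, that is, it is non-decreasing in the negative entropy $-H$: for all $\theta_1,\theta_2\in\Theta$ with $H(C_{\theta_2})>-\infty$, $$H(C_{\theta_1})\le H(C_{\theta_2})\ \Longrightarrow\ |\rho_s(C_{\theta_2})|\le|\rho_s(C_{\theta_1})|.$$ In particular, members of the family with equal finite entropy have the same $|\rho_s|$. (For a family that is TP2 for $\theta\ge0$ and RR2 for $\theta\le0$, condition (a) is applied to $\Theta\cap[0,\infty)$ and to $\Theta\cap(-\infty,0]$ separately.) -/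

import Mathlib

open MeasureTheory Set Filter Topology
open scoped ContDiff

noncomputable section

/-- The closed unit square in the plane. -/
def unitSquare : Set (ℝ × ℝ) := Icc (0 : ℝ) 1 ×ˢ Icc (0 : ℝ) 1

/-- A bivariate copula, given by the joint law of two random variables that are
both uniformly distributed on `[0,1]`. The copula function is `Copula.cdf`. -/
structure Copula where
  law : Measure (ℝ × ℝ)
  fst_uniform : law.map Prod.fst = volume.restrict (Icc (0 : ℝ) 1)
  snd_uniform : law.map Prod.snd = volume.restrict (Icc (0 : ℝ) 1)

namespace Copula

/-- The copula function `C(u,v) = P(U ≤ u, V ≤ v)`. -/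
def cdf (C : Copula) (u v : ℝ) : ℝ := C.law.real (Iic u ×ˢ Iic v)

/-- The copula is absolutely continuous (with respect to Lebesgue measure in the plane). -/
def IsAbsCont (C : Copula) : Prop := C.law ≪ volume

/-- The copula density, as an almost everywhere defined function. -/
def density (C : Copula) (p : ℝ × ℝ) : ℝ := (C.law.rnDeriv volume p).toReal

/-- The copula entropy `H = - ∫ c log c`, an integral over the unit square with values in
`[-∞, 0]`. It is computed as the integral of the positive part of `- c log c`
(which is always finite, `- c log c` being at most `1 / e`) minus that of the negative part. -/
def entropy (C : Copula) : EReal :=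
  ((∫⁻ p in unitSquare, ENNReal.ofReal (Real.negMulLog (C.density p)) : ENNReal) : EReal)
    - ((∫⁻ p in unitSquare, ENNReal.ofReal (-Real.negMulLog (C.density p)) : ENNReal) : EReal)

/-- Spearman's rho of a copula, `12 ∫∫ C(u,v) du dv - 3`. -/
def spearmanRho (C : Copula) : ℝ :=
  12 * (∫ u in (0 : ℝ)..1, ∫ v in (0 : ℝ)..1, C.cdf u v) - 3

/-- `c` is a version of the density of the copula. -/
structure IsDensity (C : Copula) (c : ℝ × ℝ → ℝ) : Prop where
  measurable : Measurable c
  nonneg : ∀ p, 0 ≤ c p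
  law_eq : C.law = (volume.restrict unitSquare).withDensity fun p => ENNReal.ofReal (c p)

end Copula

/-- Total positivity of order two on a set of points of the plane; `⊔` and `⊓` are
the componentwise maximum and minimum. -/
def TP2On (f : ℝ × ℝ → ℝ) (S : Set (ℝ × ℝ)) : Prop :=
  ∀ p ∈ S, ∀ q ∈ S, f p * f q ≤ f (p ⊔ q) * f (p ⊓ q)

/-- Reverse rule of order two on a set of points of the plane. -/
def RR2On (f : ℝ × ℝ → ℝ) (S : Set (ℝ × ℝ)) : Prop :=
  ∀ p ∈ S, ∀ q ∈ S, f (p ⊔ q) * f (p ⊓ q) ≤ f p * f q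

/-- Super-modular functions on the plane. -/
def Supermodular (f : ℝ × ℝ → ℝ) : Prop :=
  ∀ p q, f p + f q ≤ f (p ⊔ q) + f (p ⊓ q)

namespace Copula

/-- The copula has a density that is TP2 on the open unit square. -/
def HasTP2Density (C : Copula) : Prop :=
  ∃ c, C.IsDensity c ∧ TP2On c (Ioo (0 : ℝ) 1 ×ˢ Ioo (0 : ℝ) 1)

/-- The copula has a density that is RR2 on the open unit square. -/
def HasRR2Density (C : Copula) : Prop :=
  ∃ c, C.IsDensity c ∧ RR2On c (Ioo (0 : ℝ) 1 ×ˢ Ioo (0 : ℝ) 1)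

/-- The super-modular order: `E Ψ(X) ≤ E Ψ(X')` for all super-modular `Ψ`
for which both expectations exist. -/
def SMLe (C D : Copula) : Prop :=
  ∀ Ψ : ℝ × ℝ → ℝ, Supermodular Ψ → Integrable Ψ C.law → Integrable Ψ D.law →
    ∫ p, Ψ p ∂C.law ≤ ∫ p, Ψ p ∂D.law

end Copula

/-- The family `C` is increasing in the super-modular order on the parameter set `Θ`. -/
def SMIncreasingOn (C : ℝ → Copula) (Θ : Set ℝ) : Prop :=
  ∀ θ₁ ∈ Θ, ∀ θ₂ ∈ Θ, θ₁ ≤ θ₂ → (C θ₁).SMLe (C θ₂)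

/-- The family `C` is decreasing in the super-modular order on the parameter set `Θ`. -/
def SMDecreasingOn (C : ℝ → Copula) (Θ : Set ℝ) : Prop :=
  ∀ θ₁ ∈ Θ, ∀ θ₂ ∈ Θ, θ₁ ≤ θ₂ → (C θ₂).SMLe (C θ₁)

/-- `C` is the Archimedean copula with generator `ψ : [0,∞) → [0,∞)`:
`ψ` is strictly convex with `ψ(∞) = 0`, and `C(u,v) = ψ(ψ⁻¹(u) + ψ⁻¹(v))`.
(For `u = 0` or `v = 0`, where `ψ⁻¹ = ∞`, every copula function vanishes.) -/
structure IsArchimedean (C : Copula) (ψ : ℝ → ℝ) : Prop where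
  nonneg : ∀ t, 0 ≤ t → 0 ≤ ψ t
  strictConvex : StrictConvexOn ℝ (Ici 0) ψ
  tendsto_zero : Tendsto ψ atTop (𝓝 0)
  cdf_eq : ∀ u ∈ Ioc (0 : ℝ) 1, ∀ v ∈ Ioc (0 : ℝ) 1,
    C.cdf u v = ψ (Function.invFunOn ψ (Ici 0) u + Function.invFunOn ψ (Ici 0) v)

/-- Complete monotonicity on `[0,∞)`: continuous on `[0,∞)`, smooth on `(0,∞)`, and
`(-1)^n f^{(n)} ≥ 0` on `(0,∞)` for all `n`. -/
structure CompletelyMonotone (f : ℝ → ℝ) : Prop where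
  continuousOn : ContinuousOn f (Ici 0)
  contDiffOn : ContDiffOn ℝ ∞ f (Ioi 0)
  alternating : ∀ n : ℕ, ∀ t, 0 < t → 0 ≤ (-1) ^ n * iteratedDeriv n f t

/-- `C` is the copula of the law `μ` on the plane (Sklar):
`F(x,y) = C(F₁(x), F₂(y))`, with `F₁`, `F₂` the marginal distribution functions. -/
def IsCopulaOf (C : Copula) (μ : Measure (ℝ × ℝ)) : Prop :=
  ∀ x y, μ.real (Iic x ×ˢ Iic y) =
    C.cdf (ProbabilityTheory.cdf (μ.map Prod.fst) x) (ProbabilityTheory.cdf (μ.map Prod.snd) y)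

/-- The bivariate elliptical density `|Σ|^{-1/2} g((x-m)ᵀ Σ⁻¹ (x-m))` with density generator `g`,
location `m = (m₁,m₂)` and scatter matrix `Σ = [[s₁², r s₁ s₂], [r s₁ s₂, s₂²]]`. -/
def ellipticalDensity (g : ℝ → ℝ) (m₁ m₂ s₁ s₂ r : ℝ) (p : ℝ × ℝ) : ℝ :=
  (s₁ * s₂ * √(1 - r ^ 2))⁻¹ *
    g ((((p.1 - m₁) / s₁) ^ 2 - 2 * r * ((p.1 - m₁) / s₁) * ((p.2 - m₂) / s₂)
      + ((p.2 - m₂) / s₂) ^ 2) / (1 - r ^ 2))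

/-- The bivariate elliptical law with density `ellipticalDensity g m₁ m₂ s₁ s₂ r`. -/
def ellipticalLaw (g : ℝ → ℝ) (m₁ m₂ s₁ s₂ r : ℝ) : Measure (ℝ × ℝ) :=
  volume.withDensity fun p => ENNReal.ofReal (ellipticalDensity g m₁ m₂ s₁ s₂ r p)

/-- Condition (a): the densities of the family are all TP2, or all RR2, and the family is
increasing, or decreasing, in the super-modular order. -/
def ConditionA (C : ℝ → Copula) (Θ : Set ℝ) : Prop :=
  ((∀ θ ∈ Θ, (C θ).HasTP2Density) ∨ (∀ θ ∈ Θ, (C θ).HasRR2Density)) ∧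
    (SMIncreasingOn C Θ ∨ SMDecreasingOn C Θ)

/-- Condition (b): Archimedean copulas with completely monotone generators `φ_θ`, `φ_θ(0) = 1`,
increasing in the super-modular order. -/
def ConditionB (C : ℝ → Copula) (Θ : Set ℝ) : Prop :=
  (∃ φ : ℝ → ℝ → ℝ, ∀ θ ∈ Θ,
    IsArchimedean (C θ) (φ θ) ∧ CompletelyMonotone (φ θ) ∧ φ θ 0 = 1) ∧
  SMIncreasingOn C Θ

/-- Condition (c): a two-parameter family of Archimedean copulas with completely monotone
generators `η_{θ,δ}`, `η_{θ,δ}(0) = 1`, increasing in the super-modular order with respect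
to `θ` for fixed `δ`. -/
def ConditionC (C : ℝ → ℝ → Copula) (Θ Δ : Set ℝ) : Prop :=
  (∃ η : ℝ → ℝ → ℝ → ℝ, ∀ θ ∈ Θ, ∀ δ ∈ Δ,
    IsArchimedean (C θ δ) (η θ δ) ∧ CompletelyMonotone (η θ δ) ∧ η θ δ 0 = 1) ∧
  ∀ δ ∈ Δ, SMIncreasingOn (fun θ => C θ δ) Θ

/-- Condition (d): the copulas of elliptical laws with a common density generator `g`;
the parameter enters through the correlation `r` of the scatter matrix. (Location and scales
may vary as well; they do not influence the copula.) -/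
def ConditionD (C : ℝ → Copula) (Θ : Set ℝ) : Prop :=
  ∃ g : ℝ → ℝ, Measurable g ∧ (∀ t, 0 ≤ t → 0 ≤ g t) ∧
    ∀ θ ∈ Θ, ∃ m₁ m₂ s₁ s₂ r : ℝ, 0 < s₁ ∧ 0 < s₂ ∧ |r| < 1 ∧
      IsProbabilityMeasure (ellipticalLaw g m₁ m₂ s₁ s₂ r) ∧
      IsCopulaOf (C θ) (ellipticalLaw g m₁ m₂ s₁ s₂ r)

/-- The magnitude of Spearman's rho is a monotone (decreasing) function of the copula entropy
among the members of the family whose entropy is finite; moreover it is at least as large at a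
member with entropy `-∞` as at any member with finite entropy. -/
def SpearmanMonotoneInEntropy (C : ℝ → Copula) (Θ : Set ℝ) : Prop :=
  ∀ θ₁ ∈ Θ, ∀ θ₂ ∈ Θ, (C θ₂).entropy ≠ ⊥ → (C θ₁).entropy ≤ (C θ₂).entropy →
    |(C θ₂).spearmanRho| ≤ |(C θ₁).spearmanRho|

end

/-! ### Basic facts about copulas -/

/-! The negative entropy of a copula is its Kullback-Leibler divergence from the uniform law on the
square (`Copula.IsAbsCont.entropy_eq`), so the claim is that larger divergence goes with larger
`|ρ_s|`.

Conditions (a), (b), (c). The super-modular order implies the pointwise order of copula functions,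
and `ρ_s` is monotone for the latter. If `C` is TP2 with density `c` and `C ≤ D` pointwise, then `D`
has at least the divergence of `C`: the tangent inequality `klFun d - klFun c ≥ log c * (d - c)`
reduces this to `E_D log c ≥ E_C log c`, which holds because `log c` is super-modular. To avoid
regularity questions about `log c`, this is done for the cell averages on an `N × N` grid, where it
is a double summation by parts (`ConcordantArrays.sum_klFun_le`). Zeros of a totally positive array
come in whole quadrants, on which the cumulative sums of both arrays agree, so they do no harm.
Jensen's inequality and Fatou's lemma pass to the limit. Reversing one axis gives the RR2 case.

Monotonicity of the divergence alone leaves open that `C ≤ D` with `C ≠ D` have equal entropy. The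
mixture of `C` and `D` also lies above `C`, so its divergence is at least that of `C`; strict
convexity of `klFun` then forces `C = D` (`Copula.law_eq_of_divergence_le_mix`). Finally TP2 gives
`C(u,v) ≥ uv`, hence `ρ_s ≥ 0`, and RR2 the opposite, which settles the absolute values.

An Archimedean copula with completely monotone generator `φ` is the image under `(φ, φ)` of the
measure with density `φ''(x + y)` on the quadrant. This density is TP2 because completely monotone
functions are log-convex (`SignedDerivs.sq_le`), proved here by an elementary induction instead of
Bernstein's representation.

Condition (d). Every elliptical law with generator `g` is an affine image of one rotation invariant
law. Its divergence from the product of its marginals is `∫ logRatio - log √(1 - r²)`, where the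
integral does not depend on `r` by rotation invariance; an exhaustion by rotation invariant sets
makes this rigorous when the separate logarithms are not integrable. Hence the divergence increases
strictly with `|r|`. A reflection argument shows that the distribution functions increase with `r`,
so `|ρ_s|` increases with `|r|` too. -/

lemma measure_eq_uniform_of_Iic {m : Measure ℝ} [IsProbabilityMeasure m]
    (h : ∀ u ∈ Ioo (0 : ℝ) 1, m (Iic u) = ENNReal.ofReal u) :
    m = volume.restrict (Icc (0 : ℝ) 1) := by
  refine Measure.ext_of_Iic _ _ fun u => ?_
  rw [Measure.restrict_apply measurableSet_Iic]
  rcases le_or_gt u 0 with hu | hu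
  · have h1 : m (Iic u) = 0 := by
      -- The values at and beyond the endpoints are not assumed; they follow by monotonicity from
      -- the open interval.
      have h2 : Tendsto (fun ε : ℝ => ENNReal.ofReal ε) (𝓝[>] 0) (𝓝 0) := by
        have := (ENNReal.continuous_ofReal.tendsto 0).mono_left (nhdsWithin_le_nhds (s := Ioi 0))
        simpa using this
      refine le_antisymm (ge_of_tendsto h2 ?_) zero_le
      filter_upwards [Ioo_mem_nhdsGT (zero_lt_one' ℝ)] with ε hε
      rw [← h ε hε]
      exact measure_mono (Iic_subset_Iic.2 (hu.trans hε.1.le))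
    rw [h1]
    symm
    refine measure_mono_null (t := {0}) (fun x hx => ?_) (by simp)
    exact le_antisymm (hx.1.trans hu) hx.2.1
  rcases lt_or_ge u 1 with hu1 | hu1
  · have : Iic u ∩ Icc (0 : ℝ) 1 = Icc 0 u := by
      ext x; simp only [mem_inter_iff, mem_Iic, mem_Icc]; grind
    rw [h u ⟨hu, hu1⟩, this]; simp
  · have : Iic u ∩ Icc (0 : ℝ) 1 = Icc 0 1 := by
      ext x; simp only [mem_inter_iff, mem_Iic, mem_Icc]; grind
    rw [this]
    have h2 : Tendsto (fun ε : ℝ => ENNReal.ofReal ε) (𝓝[<] 1) (𝓝 1) := by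
      have := (ENNReal.continuous_ofReal.tendsto 1).mono_left (nhdsWithin_le_nhds (s := Iio 1))
      simpa using this
    simp only [Real.volume_Icc, sub_zero, ENNReal.ofReal_one]
    refine le_antisymm prob_le_one (le_of_tendsto h2 ?_)
    filter_upwards [Ioo_mem_nhdsLT (zero_lt_one' ℝ)] with ε hε
    rw [← h ε hε]
    exact measure_mono (Iic_subset_Iic.2 (hε.2.le.trans hu1))

lemma measure_prod_ext_of_Iic {μ ν : Measure (ℝ × ℝ)} [IsProbabilityMeasure μ]
    [IsProbabilityMeasure ν]
    (h : ∀ u v, μ (Iic u ×ˢ Iic v) = ν (Iic u ×ˢ Iic v)) : μ = ν := by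
  have hspan : IsCountablySpanning (range (Iic : ℝ → Set ℝ)) := by
    refine ⟨fun n : ℕ => Iic (n : ℝ), fun n => ⟨_, rfl⟩, ?_⟩
    ext x
    simpa using exists_nat_ge x
  refine ext_of_generate_finite _
    (generateFrom_eq_prod (C := range Iic) (D := range Iic)
      (by rw [BorelSpace.measurable_eq (α := ℝ), borel_eq_generateFrom_Iic])
      (by rw [BorelSpace.measurable_eq (α := ℝ), borel_eq_generateFrom_Iic]) hspan hspan).symm
    (isPiSystem_Iic.prod isPiSystem_Iic) ?_ (by simp)
  rintro _ ⟨_, ⟨u, rfl⟩, _, ⟨v, rfl⟩, rfl⟩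
  exact h u v

namespace Copula

instance isProbabilityMeasure_law (C : Copula) : IsProbabilityMeasure C.law := by
  constructor
  have := congrArg (fun m => m univ) C.fst_uniform
  simpa [Measure.map_apply measurable_fst MeasurableSet.univ] using this

lemma law_fst_preimage (C : Copula) {s : Set ℝ} (hs : MeasurableSet s) :
    C.law (Prod.fst ⁻¹' s) = volume (s ∩ Icc 0 1) := by
  rw [← Measure.map_apply measurable_fst hs, C.fst_uniform, Measure.restrict_apply hs]

lemma law_snd_preimage (C : Copula) {s : Set ℝ} (hs : MeasurableSet s) :
    C.law (Prod.snd ⁻¹' s) = volume (s ∩ Icc 0 1) := by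
  rw [← Measure.map_apply measurable_snd hs, C.snd_uniform, Measure.restrict_apply hs]

lemma law_compl_Ioo_fst (C : Copula) : C.law (Prod.fst ⁻¹' (Ioo 0 1)ᶜ) = 0 := by
  rw [C.law_fst_preimage measurableSet_Ioo.compl]
  refine measure_mono_null (t := {0, 1}) (fun x hx => ?_) ?_
  · simp only [mem_inter_iff, mem_compl_iff, mem_Ioo, mem_Icc, mem_insert_iff,
      mem_singleton_iff] at hx ⊢
    grind
  · exact (Set.toFinite _).measure_zero _

lemma law_compl_Ioo_snd (C : Copula) : C.law (Prod.snd ⁻¹' (Ioo 0 1)ᶜ) = 0 := by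
  rw [C.law_snd_preimage measurableSet_Ioo.compl]
  refine measure_mono_null (t := {0, 1}) (fun x hx => ?_) ?_
  · simp only [mem_inter_iff, mem_compl_iff, mem_Ioo, mem_Icc, mem_insert_iff,
      mem_singleton_iff] at hx ⊢
    grind
  · exact (Set.toFinite _).measure_zero _

lemma ae_mem_Ioo (C : Copula) : ∀ᵐ p ∂C.law, p ∈ Ioo (0 : ℝ) 1 ×ˢ Ioo (0 : ℝ) 1 := by
  have h1 : ∀ᵐ p ∂C.law, p ∉ Prod.fst ⁻¹' (Ioo (0 : ℝ) 1)ᶜ :=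
    measure_eq_zero_iff_ae_notMem.1 C.law_compl_Ioo_fst
  have h2 : ∀ᵐ p ∂C.law, p ∉ Prod.snd ⁻¹' (Ioo (0 : ℝ) 1)ᶜ :=
    measure_eq_zero_iff_ae_notMem.1 C.law_compl_Ioo_snd
  filter_upwards [h1, h2] with p hp1 hp2
  simpa using And.intro (not_not.1 hp1) (not_not.1 hp2)

lemma cdf_mono (C : Copula) {u u' v v' : ℝ} (hu : u ≤ u') (hv : v ≤ v') :
    C.cdf u v ≤ C.cdf u' v' :=
  measureReal_mono (prod_mono (Iic_subset_Iic.2 hu) (Iic_subset_Iic.2 hv))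

lemma law_Iic_fst (C : Copula) {u : ℝ} (hu : u ∈ Icc (0 : ℝ) 1) :
    C.law (Iic u ×ˢ univ) = ENNReal.ofReal u := by
  rw [Set.prod_univ, C.law_fst_preimage measurableSet_Iic]
  have : Iic u ∩ Icc (0 : ℝ) 1 = Icc 0 u := by
    ext x; simp only [mem_inter_iff, mem_Iic, mem_Icc]; grind
  simp [this]

lemma law_Iic_snd (C : Copula) {v : ℝ} (hv : v ∈ Icc (0 : ℝ) 1) :
    C.law (univ ×ˢ Iic v) = ENNReal.ofReal v := by
  rw [Set.univ_prod, C.law_snd_preimage measurableSet_Iic]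
  have : Iic v ∩ Icc (0 : ℝ) 1 = Icc 0 v := by
    ext x; simp only [mem_inter_iff, mem_Iic, mem_Icc]; grind
  simp [this]

/-- No mass sits outside the open square, so sets may be changed freely there. This gives the
boundary values of the copula function and identifies quadrants with unions of grid cells. -/
lemma law_congr (C : Copula) {s t : Set (ℝ × ℝ)}
    (h : ∀ p ∈ Ioo (0 : ℝ) 1 ×ˢ Ioo (0 : ℝ) 1, p ∈ s ↔ p ∈ t) : C.law s = C.law t := by
  refine measure_congr ?_
  filter_upwards [C.ae_mem_Ioo] with p hp
  exact propext (h p hp)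

lemma cdf_one_left (C : Copula) {v : ℝ} (hv : v ∈ Icc (0 : ℝ) 1) : C.cdf 1 v = v := by
  rw [cdf, Measure.real, C.law_congr (t := univ ×ˢ Iic v), C.law_Iic_snd hv,
    ENNReal.toReal_ofReal hv.1]
  intro p hp
  simp [Prod.le_def, hp.1.2.le]

lemma cdf_one_right (C : Copula) {u : ℝ} (hu : u ∈ Icc (0 : ℝ) 1) : C.cdf u 1 = u := by
  rw [cdf, Measure.real, C.law_congr (t := Iic u ×ˢ univ), C.law_Iic_fst hu,
    ENNReal.toReal_ofReal hu.1]
  intro p hp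
  simp [Prod.le_def, hp.2.2.le]

lemma cdf_zero_left (C : Copula) {u v : ℝ} (hu : u ≤ 0) : C.cdf u v = 0 := by
  rw [cdf, Measure.real, C.law_congr (t := ∅)]
  · simp
  intro p hp
  simp [Prod.le_def, hu.trans_lt hp.1.1]

lemma cdf_zero_right (C : Copula) {u v : ℝ} (hv : v ≤ 0) : C.cdf u v = 0 := by
  rw [cdf, Measure.real, C.law_congr (t := ∅)]
  · simp
  intro p hp
  simp [Prod.le_def, hv.trans_lt hp.2.1]

lemma cdf_min_one (C : Copula) (u v : ℝ) : C.cdf u v = C.cdf (min u 1) (min v 1) := by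
  rw [cdf, cdf, Measure.real, Measure.real]
  congr 1
  refine C.law_congr fun p hp => ?_
  simp [Prod.le_def, hp.1.2.le, hp.2.2.le]

/-- A relation between the copula functions on the open square extends to the plane. -/
lemma cdf_le_of_Ioo {C D : Copula}
    (h : ∀ u ∈ Ioo (0 : ℝ) 1, ∀ v ∈ Ioo (0 : ℝ) 1, C.cdf u v ≤ D.cdf u v) (u v : ℝ) :
    C.cdf u v ≤ D.cdf u v := by
  rw [cdf_min_one C, cdf_min_one D]
  rcases le_or_gt u 0 with hu | hu
  · rw [cdf_zero_left _ (min_le_of_left_le hu), cdf_zero_left _ (min_le_of_left_le hu)]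
  rcases le_or_gt v 0 with hv | hv
  · rw [cdf_zero_right _ (min_le_of_left_le hv), cdf_zero_right _ (min_le_of_left_le hv)]
  rcases le_or_gt 1 u with hu1 | hu1
  · have : min v 1 ∈ Icc (0 : ℝ) 1 := ⟨by positivity, by simp⟩
    rw [min_eq_right hu1, cdf_one_left _ this, cdf_one_left _ this]
  rcases le_or_gt 1 v with hv1 | hv1
  · have : min u 1 ∈ Icc (0 : ℝ) 1 := ⟨by positivity, by simp⟩
    rw [min_eq_right hv1, cdf_one_right _ this, cdf_one_right _ this]
  rw [min_eq_left hu1.le, min_eq_left hv1.le]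
  exact h u ⟨hu, hu1⟩ v ⟨hv, hv1⟩

lemma law_eq_of_cdf_Ioo {C D : Copula}
    (h : ∀ u ∈ Ioo (0 : ℝ) 1, ∀ v ∈ Ioo (0 : ℝ) 1, C.cdf u v = D.cdf u v) :
    C.law = D.law := by
  refine measure_prod_ext_of_Iic fun u v => ?_
  rw [← measureReal_eq_measureReal_iff]
  exact le_antisymm (cdf_le_of_Ioo (fun u hu v hv => (h u hu v hv).le) u v)
    (cdf_le_of_Ioo (fun u hu v hv => (h u hu v hv).ge) u v)

/-! ### Spearman's rho under pointwise comparison and under reflection -/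

lemma intervalIntegrable_cdf (C : Copula) (u a b : ℝ) :
    IntervalIntegrable (fun v => C.cdf u v) volume a b :=
  Monotone.intervalIntegrable fun _ _ h => C.cdf_mono le_rfl h

lemma intervalIntegrable_integral_cdf (C : Copula) (a b : ℝ) :
    IntervalIntegrable (fun u => ∫ v in (0 : ℝ)..1, C.cdf u v) volume a b := by
  refine Monotone.intervalIntegrable fun u u' h => ?_
  exact intervalIntegral.integral_mono_on zero_le_one (C.intervalIntegrable_cdf _ _ _)
    (C.intervalIntegrable_cdf _ _ _) fun v _ => C.cdf_mono h le_rfl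

lemma spearmanRho_mono {C D : Copula}
    (h : ∀ u ∈ Ioo (0 : ℝ) 1, ∀ v ∈ Ioo (0 : ℝ) 1, C.cdf u v ≤ D.cdf u v) :
    C.spearmanRho ≤ D.spearmanRho := by
  have : ∫ u in (0 : ℝ)..1, ∫ v in (0 : ℝ)..1, C.cdf u v ≤
      ∫ u in (0 : ℝ)..1, ∫ v in (0 : ℝ)..1, D.cdf u v :=
    intervalIntegral.integral_mono_on_of_le_Ioo zero_le_one (C.intervalIntegrable_integral_cdf _ _)
      (D.intervalIntegrable_integral_cdf _ _) fun u hu =>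
      intervalIntegral.integral_mono_on_of_le_Ioo zero_le_one (C.intervalIntegrable_cdf _ _ _)
        (D.intervalIntegrable_cdf _ _ _) fun v hv => h u hu v hv
  unfold spearmanRho
  linarith

lemma integral_mul_id (u : ℝ) : ∫ v in (0 : ℝ)..1, u * v = u * (1 / 2) := by
  rw [intervalIntegral.integral_const_mul u (fun v => v), integral_id]
  norm_num

lemma integral_integral_mul : ∫ u in (0 : ℝ)..1, ∫ v in (0 : ℝ)..1, u * v = 1 / 4 := by
  simp_rw [integral_mul_id]
  rw [intervalIntegral.integral_mul_const, integral_id]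
  norm_num

lemma spearmanRho_nonneg {C : Copula}
    (h : ∀ u ∈ Ioo (0 : ℝ) 1, ∀ v ∈ Ioo (0 : ℝ) 1, u * v ≤ C.cdf u v) :
    0 ≤ C.spearmanRho := by
  have : ∫ u in (0 : ℝ)..1, ∫ v in (0 : ℝ)..1, u * v ≤
      ∫ u in (0 : ℝ)..1, ∫ v in (0 : ℝ)..1, C.cdf u v :=
    intervalIntegral.integral_mono_on_of_le_Ioo zero_le_one
      (by simp only [integral_mul_id]
          exact Continuous.intervalIntegrable (by fun_prop) _ _)
      (C.intervalIntegrable_integral_cdf _ _) fun u hu =>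
      intervalIntegral.integral_mono_on_of_le_Ioo zero_le_one
        (Continuous.intervalIntegrable (by fun_prop) _ _)
        (C.intervalIntegrable_cdf _ _ _) fun v hv => h u hu v hv
  rw [integral_integral_mul] at this
  unfold spearmanRho
  linarith

lemma spearmanRho_nonpos {C : Copula}
    (h : ∀ u ∈ Ioo (0 : ℝ) 1, ∀ v ∈ Ioo (0 : ℝ) 1, C.cdf u v ≤ u * v) :
    C.spearmanRho ≤ 0 := by
  have : ∫ u in (0 : ℝ)..1, ∫ v in (0 : ℝ)..1, C.cdf u v ≤
      ∫ u in (0 : ℝ)..1, ∫ v in (0 : ℝ)..1, u * v :=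
    intervalIntegral.integral_mono_on_of_le_Ioo zero_le_one
      (C.intervalIntegrable_integral_cdf _ _)
      (by simp only [integral_mul_id]
          exact Continuous.intervalIntegrable (by fun_prop) _ _) fun u hu =>
      intervalIntegral.integral_mono_on_of_le_Ioo zero_le_one (C.intervalIntegrable_cdf _ _ _)
        (Continuous.intervalIntegrable (by fun_prop) _ _) fun v hv => h u hu v hv
  rw [integral_integral_mul] at this
  unfold spearmanRho
  linarith

/-- The integrand is the distribution function of `(1 - U, V)`, whose Spearman's rho is the negative
of that of `C`. Working with the formula avoids constructing the reflected copula. -/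
lemma integral_reflected_cdf (C : Copula) :
    ∫ u in (0 : ℝ)..1, ∫ v in (0 : ℝ)..1, (v - C.cdf (1 - u) v) =
      1 / 2 - ∫ u in (0 : ℝ)..1, ∫ v in (0 : ℝ)..1, C.cdf u v := by
  have h1 : ∀ u, ∫ v in (0 : ℝ)..1, (v - C.cdf (1 - u) v) =
      1 / 2 - ∫ v in (0 : ℝ)..1, C.cdf (1 - u) v := fun u => by
    rw [intervalIntegral.integral_sub (Continuous.intervalIntegrable (by fun_prop) _ _)
      (C.intervalIntegrable_cdf _ _ _), integral_id]
    norm_num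
  simp only [h1]
  have h2 := (C.intervalIntegrable_integral_cdf 1 0).comp_sub_left 1
  simp only [sub_self, sub_zero] at h2
  rw [intervalIntegral.integral_sub intervalIntegrable_const h2,
    intervalIntegral.integral_comp_sub_left (fun u => ∫ v in (0 : ℝ)..1, C.cdf u v)]
  simp

lemma intervalIntegrable_reflected_cdf (C : Copula) (u a b : ℝ) :
    IntervalIntegrable (fun v => v - C.cdf (1 - u) v) volume a b :=
  (Continuous.intervalIntegrable (by fun_prop) _ _).sub (C.intervalIntegrable_cdf _ _ _)

lemma intervalIntegrable_integral_reflected_cdf (C : Copula) (a b : ℝ) :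
    IntervalIntegrable (fun u => ∫ v in (0 : ℝ)..1, (v - C.cdf (1 - u) v)) volume a b := by
  refine Monotone.intervalIntegrable fun u u' h => ?_
  exact intervalIntegral.integral_mono_on zero_le_one (C.intervalIntegrable_reflected_cdf _ _ _)
    (C.intervalIntegrable_reflected_cdf _ _ _) fun v _ =>
      sub_le_sub_left (C.cdf_mono (by linarith) le_rfl) _

lemma neg_spearmanRho_le {C D : Copula}
    (h : ∀ u ∈ Ioo (0 : ℝ) 1, ∀ v ∈ Ioo (0 : ℝ) 1, v - C.cdf (1 - u) v ≤ D.cdf u v) :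
    -C.spearmanRho ≤ D.spearmanRho := by
  have := intervalIntegral.integral_mono_on_of_le_Ioo zero_le_one
    (C.intervalIntegrable_integral_reflected_cdf _ _)
    (D.intervalIntegrable_integral_cdf _ _) fun u hu =>
      intervalIntegral.integral_mono_on_of_le_Ioo zero_le_one
        (C.intervalIntegrable_reflected_cdf _ _ _)
        (D.intervalIntegrable_cdf _ _ _) fun v hv => h u hu v hv
  rw [integral_reflected_cdf] at this
  unfold spearmanRho
  linarith

lemma le_neg_spearmanRho {C D : Copula}
    (h : ∀ u ∈ Ioo (0 : ℝ) 1, ∀ v ∈ Ioo (0 : ℝ) 1, D.cdf u v ≤ v - C.cdf (1 - u) v) :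
    D.spearmanRho ≤ -C.spearmanRho := by
  have := intervalIntegral.integral_mono_on_of_le_Ioo zero_le_one
    (D.intervalIntegrable_integral_cdf _ _)
    (C.intervalIntegrable_integral_reflected_cdf _ _) fun u hu =>
      intervalIntegral.integral_mono_on_of_le_Ioo zero_le_one
        (D.intervalIntegrable_cdf _ _ _)
        (C.intervalIntegrable_reflected_cdf _ _ _) fun v hv => h u hu v hv
  rw [integral_reflected_cdf] at this
  unfold spearmanRho
  linarith

/-- The indicator of a lower left quadrant is super-modular and bounded. This is the only
consequence of the super-modular order that the proof needs. -/
lemma SMLe.cdf_le {C D : Copula} (h : C.SMLe D) (u v : ℝ) : C.cdf u v ≤ D.cdf u v := by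
  have hm : MeasurableSet (Iic u ×ˢ Iic v) := measurableSet_Iic.prod measurableSet_Iic
  have := h ((Iic u ×ˢ Iic v).indicator fun _ => 1) ?_
    ((integrable_const _).indicator hm) ((integrable_const _).indicator hm)
  · simpa [integral_indicator_const, hm, cdf] using this
  · rintro ⟨a, b⟩ ⟨c, d⟩
    simp only [indicator_apply, mem_prod, mem_Iic, Prod.mk_sup_mk, Prod.mk_inf_mk, sup_le_iff,
      inf_le_iff]
    split_ifs <;> norm_num <;> grind

end Copula

/-! ### Entropy as a Kullback-Leibler divergence -/

/-- The uniform law on the unit square. -/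
noncomputable abbrev uniformSquare : Measure (ℝ × ℝ) := volume.restrict unitSquare

lemma measurableSet_unitSquare : MeasurableSet unitSquare :=
  measurableSet_Icc.prod measurableSet_Icc

instance : IsProbabilityMeasure uniformSquare := by
  constructor
  rw [Measure.restrict_apply MeasurableSet.univ, univ_inter, unitSquare, Measure.volume_eq_prod,
    Measure.prod_prod]
  simp

namespace Copula

lemma restrict_unitSquare (C : Copula) : C.law.restrict unitSquare = C.law := by
  refine Measure.restrict_eq_self_of_ae_mem ?_
  filter_upwards [C.ae_mem_Ioo] with p hp
  exact ⟨Ioo_subset_Icc_self hp.1, Ioo_subset_Icc_self hp.2⟩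

lemma IsAbsCont.uniformSquare {C : Copula} (hC : C.IsAbsCont) : C.law ≪ uniformSquare := by
  rw [← C.restrict_unitSquare]
  exact Measure.AbsolutelyContinuous.restrict hC _

lemma IsAbsCont.rnDeriv_eq {C : Copula} (hC : C.IsAbsCont) :
    C.law.rnDeriv _root_.uniformSquare =ᵐ[_root_.uniformSquare] C.law.rnDeriv volume := by
  have h : C.law = _root_.uniformSquare.withDensity (C.law.rnDeriv volume) := by
    rw [← restrict_withDensity measurableSet_unitSquare, Measure.withDensity_rnDeriv_eq _ _ hC,
      C.restrict_unitSquare]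
  conv_lhs => rw [h]
  exact Measure.rnDeriv_withDensity _ (Measure.measurable_rnDeriv _ _)

/-- The Kullback-Leibler divergence from the independence copula. -/
noncomputable def divergence (C : Copula) : ENNReal := InformationTheory.klDiv C.law uniformSquare

lemma IsAbsCont.divergence_eq {C : Copula} (hC : C.IsAbsCont) :
    C.divergence = ∫⁻ p in unitSquare, ENNReal.ofReal (InformationTheory.klFun (C.density p)) := by
  rw [divergence, InformationTheory.klDiv_eq_lintegral_klFun_of_ac hC.uniformSquare]
  refine lintegral_congr_ae ?_
  filter_upwards [hC.rnDeriv_eq] with p hp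
  simp [hp, density]

lemma IsAbsCont.lintegral_density {C : Copula} (hC : C.IsAbsCont) :
    ∫⁻ p in unitSquare, ENNReal.ofReal (C.density p) = 1 := by
  rw [← measure_univ (μ := C.law)]
  conv_rhs => rw [← Measure.withDensity_rnDeriv_eq _ _ hC.uniformSquare]
  rw [withDensity_apply _ MeasurableSet.univ, Measure.restrict_univ]
  refine lintegral_congr_ae ?_
  filter_upwards [hC.rnDeriv_eq, Measure.rnDeriv_ne_top C.law _root_.uniformSquare] with p hp hp'
  rw [density, ← hp, ENNReal.ofReal_toReal hp']

lemma measurable_density (C : Copula) : Measurable C.density :=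
  (Measure.measurable_rnDeriv _ _).ennreal_toReal

/-- Since `klFun c = c log c + 1 - c` and `c` has integral one over a square of area one, the
integrals of `klFun c` and `c log c` agree. The positive part `P` of the entropy integral is finite,
so the subtraction in `EReal` is harmless even when the divergence is infinite. -/
lemma IsAbsCont.entropy_eq {C : Copula} (hC : C.IsAbsCont) :
    C.entropy = -(C.divergence : EReal) := by
  have hmeas := C.measurable_density
  set P := ∫⁻ p in unitSquare, ENNReal.ofReal (Real.negMulLog (C.density p)) with hP
  set N := ∫⁻ p in unitSquare, ENNReal.ofReal (-Real.negMulLog (C.density p)) with hN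
  have hPle : P ≤ 1 := by
    calc P ≤ ∫⁻ p in unitSquare, 1 := by
          refine lintegral_mono fun p => ?_
          have h0 : 0 ≤ C.density p := ENNReal.toReal_nonneg
          have := InformationTheory.klFun_nonneg h0
          rw [InformationTheory.klFun_apply] at this
          rw [← ENNReal.ofReal_one]
          refine ENNReal.ofReal_le_ofReal ?_
          rw [Real.negMulLog]; linarith
      _ = 1 := by simp
  -- The `1` on the left is the integral of the density, the `1` on the right that of the constant
  -- one; then the identity holds between nonnegative integrands pointwise.
  have key : C.divergence + P + 1 = N + 1 := by
    rw [hC.divergence_eq]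
    conv_lhs => rw [← hC.lintegral_density]
    rw [← lintegral_add_right _ (by fun_prop), ← lintegral_add_right _ (by fun_prop)]
    have h1 : (1 : ENNReal) = ∫⁻ p in unitSquare, 1 := by simp
    conv_rhs => rw [h1]
    rw [hN, ← lintegral_add_right _ (by fun_prop)]
    refine lintegral_congr fun p => ?_
    have h0 : 0 ≤ C.density p := ENNReal.toReal_nonneg
    have hk := InformationTheory.klFun_nonneg h0
    rcases le_total 0 (Real.negMulLog (C.density p)) with h | h
    · rw [ENNReal.ofReal_of_nonpos (p := -Real.negMulLog (C.density p)) (by linarith),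
        ← ENNReal.ofReal_add hk h, ← ENNReal.ofReal_add (by positivity) h0, zero_add,
        ← ENNReal.ofReal_one, InformationTheory.klFun_apply, Real.negMulLog]
      congr 1; ring
    · rw [ENNReal.ofReal_of_nonpos h, add_zero, ← ENNReal.ofReal_add hk h0,
        ← ENNReal.ofReal_one, ← ENNReal.ofReal_add (by linarith) zero_le_one,
        InformationTheory.klFun_apply, Real.negMulLog]
      congr 1; ring
  have key2 : C.divergence + P = N := (ENNReal.add_left_inj ENNReal.one_ne_top).1 key
  have hPtop : P ≠ ⊤ := ne_top_of_le_ne_top ENNReal.one_ne_top hPle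
  change (P : EReal) - (N : EReal) = _
  rw [← key2]
  clear_value P
  lift P to NNReal using hPtop
  rcases eq_or_ne C.divergence ⊤ with h | h
  · rw [h]; simp
  · lift C.divergence to NNReal using h with d
    rw [← ENNReal.coe_add]
    change (((P : ℝ) : EReal)) - (((d + P : NNReal) : ℝ) : EReal) = -(((d : ℝ)) : EReal)
    rw [← EReal.coe_sub, ← EReal.coe_neg, NNReal.coe_add]
    exact congrArg _ (by ring)

end Copula

/-! ### Totally positive matrices and the concordance order -/

open Finset in
lemma sum_mul_sub_eq_by_parts (m : ℕ) (f d : ℕ → ℝ) (hd : ∑ j ∈ range (m + 1), d j = 0) :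
    ∑ j ∈ range (m + 1), f j * d j =
      -∑ j ∈ range m, (f (j + 1) - f j) * ∑ l ∈ range (j + 1), d l := by
  have := Finset.sum_range_by_parts f d (m + 1)
  simp only [smul_eq_mul, hd, Nat.add_sub_cancel, mul_zero, zero_sub] at this
  exact this

-- Abel summation in both indices. The boundary terms vanish because the rows and columns of `d` sum
-- to zero, so cumulative sums of `d` are paired with mixed second differences of `f`.
open Finset in
lemma sum_sum_mul_eq_by_parts (m : ℕ) (f d : ℕ → ℕ → ℝ)
    (hrow : ∀ i < m + 1, ∑ j ∈ range (m + 1), d i j = 0)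
    (hcol : ∀ j < m + 1, ∑ i ∈ range (m + 1), d i j = 0) :
    ∑ i ∈ range (m + 1), ∑ j ∈ range (m + 1), f i j * d i j =
      ∑ i ∈ range m, ∑ j ∈ range m, (∑ k ∈ range (i + 1), ∑ l ∈ range (j + 1), d k l) *
        (f i j + f (i + 1) (j + 1) - f i (j + 1) - f (i + 1) j) := by
  have h1 : ∀ i ∈ range (m + 1), ∑ j ∈ range (m + 1), f i j * d i j =
      -∑ j ∈ range m, (f i (j + 1) - f i j) * ∑ l ∈ range (j + 1), d i l := fun i hi =>
    sum_mul_sub_eq_by_parts m (f i) (d i) (hrow i (mem_range.1 hi))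
  rw [sum_congr rfl h1, sum_neg_distrib, sum_comm]
  have h2 : ∀ j ∈ range m, ∑ i ∈ range (m + 1),
      (f i (j + 1) - f i j) * ∑ l ∈ range (j + 1), d i l =
      -∑ i ∈ range m, ((f (i + 1) (j + 1) - f (i + 1) j) - (f i (j + 1) - f i j)) *
        ∑ k ∈ range (i + 1), ∑ l ∈ range (j + 1), d k l := fun j hj => by
    refine sum_mul_sub_eq_by_parts m (fun i => f i (j + 1) - f i j)
      (fun i => ∑ l ∈ range (j + 1), d i l) ?_
    rw [sum_comm]
    refine sum_eq_zero fun l hl => hcol l ?_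
    rw [Finset.mem_range] at hl hj
    omega
  rw [sum_congr rfl h2, sum_neg_distrib, neg_neg, sum_comm]
  refine sum_congr rfl fun i _ => sum_congr rfl fun j _ => ?_
  ring

/-- Two nonnegative `n × n` arrays with the same row sums and the same column sums, the second
one more concordant than the first one. -/
structure ConcordantArrays (n : ℕ) (P Q : ℕ → ℕ → ℝ) : Prop where
  nonneg_left : ∀ i < n, ∀ j < n, 0 ≤ P i j
  nonneg_right : ∀ i < n, ∀ j < n, 0 ≤ Q i j
  row_eq : ∀ i < n, ∑ j ∈ Finset.range n, P i j = ∑ j ∈ Finset.range n, Q i j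
  col_eq : ∀ j < n, ∑ i ∈ Finset.range n, P i j = ∑ i ∈ Finset.range n, Q i j
  row_pos : ∀ i < n, 0 < ∑ j ∈ Finset.range n, P i j
  col_pos : ∀ j < n, 0 < ∑ i ∈ Finset.range n, P i j
  le : ∀ i ≤ n, ∀ j ≤ n, ∑ k ∈ Finset.range i, ∑ l ∈ Finset.range j, P k l ≤
    ∑ k ∈ Finset.range i, ∑ l ∈ Finset.range j, Q k l

namespace ConcordantArrays

variable {n : ℕ} {P Q : ℕ → ℕ → ℝ}

lemma transpose (h : ConcordantArrays n P Q) :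
    ConcordantArrays n (fun i j => P j i) (fun i j => Q j i) where
  nonneg_left i hi j hj := h.nonneg_left j hj i hi
  nonneg_right i hi j hj := h.nonneg_right j hj i hi
  row_eq := h.col_eq
  col_eq := h.row_eq
  row_pos := h.col_pos
  col_pos := h.row_pos
  le i hi j hj := by
    rw [Finset.sum_comm, Finset.sum_comm (f := fun i j => Q j i)]
    exact h.le j hj i hi

/-- Within these rows the partial sums of `P` are already full row sums. The full row sums of `Q`
are the same, so the partial sums of `Q` cannot be larger, while concordance says that they are not
smaller. -/
lemma sum_eq_of_zero (h : ConcordantArrays n P Q) {i j : ℕ} (hi : i < n)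
    (h0 : ∀ k ≤ i, ∀ l, j ≤ l → l < n → P k l = 0) {i' j' : ℕ} (hi' : i' ≤ i + 1)
    (hj' : j ≤ j') (hj'n : j' ≤ n) :
    ∑ k ∈ Finset.range i', ∑ l ∈ Finset.range j', P k l =
      ∑ k ∈ Finset.range i', ∑ l ∈ Finset.range j', Q k l := by
  refine le_antisymm (h.le i' (by omega) j' hj'n) ?_
  have h1 : ∑ k ∈ Finset.range i', ∑ l ∈ Finset.range j', P k l =
      ∑ k ∈ Finset.range i', ∑ l ∈ Finset.range n, P k l := by
    refine Finset.sum_congr rfl fun k hk => ?_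
    refine Finset.sum_subset (Finset.range_mono hj'n) fun l hl hl' => ?_
    simp only [Finset.mem_range] at hk hl hl'
    exact h0 k (by omega) l (by omega) hl
  have h2 : ∑ k ∈ Finset.range i', ∑ l ∈ Finset.range n, P k l =
      ∑ k ∈ Finset.range i', ∑ l ∈ Finset.range n, Q k l := by
    refine Finset.sum_congr rfl fun k hk => h.row_eq k ?_
    simp only [Finset.mem_range] at hk
    omega
  rw [h1, h2]
  refine Finset.sum_le_sum fun k hk => ?_
  refine Finset.sum_le_sum_of_subset_of_nonneg (Finset.range_mono hj'n) fun l hl _ => ?_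
  simp only [Finset.mem_range] at hk hl
  exact h.nonneg_right k (by omega) l hl

/-- A zero of a totally positive array with positive row and column sums is contained in
a quadrant of zeros. -/
lemma zero_quadrant (h : ConcordantArrays n P Q)
    (htp : ∀ i k j l, i < k → k < n → j < l → l < n → P i l * P k j ≤ P i j * P k l)
    {i j : ℕ} (hi : i < n) (hj : j < n) (h0 : P i j = 0) :
    (∀ k ≤ i, ∀ l, j ≤ l → l < n → P k l = 0) ∨
      (∀ k, i ≤ k → k < n → ∀ l ≤ j, P k l = 0) := by
  have nn := h.nonneg_left
  obtain ⟨l₀, hl₀, hpl⟩ : ∃ l₀ < n, 0 < P i l₀ := by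
    by_contra! hc
    exact absurd (h.row_pos i hi) (not_lt.2 (Finset.sum_nonpos fun l hl =>
      hc l (Finset.mem_range.1 hl)))
  obtain ⟨k₀, hk₀, hpk⟩ : ∃ k₀ < n, 0 < P k₀ j := by
    by_contra! hc
    exact absurd (h.col_pos j hj) (not_lt.2 (Finset.sum_nonpos fun k hk =>
      hc k (Finset.mem_range.1 hk)))
  have hlj : l₀ ≠ j := by rintro rfl; exact hpl.ne' h0
  have hki : k₀ ≠ i := by rintro rfl; exact hpk.ne' h0
  -- Tested against the positive entry `P i l₀`, the zero at `(i, j)` spreads along column `j`, on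
  -- one side of row `i`. The positive entry `P k₀ j` must then lie on the other side of that row,
  -- and testing against it spreads the zeros over a quadrant.
  rcases lt_or_gt_of_ne hlj with hlj | hlj
  · left
    -- the column vanishes above row `i`
    have hcol : ∀ k ≤ i, P k j = 0 := by
      intro k hk
      rcases hk.lt_or_eq with hk | rfl
      · have := htp k i l₀ j hk hi hlj hj
        rw [h0, mul_zero] at this
        have h3 := nn k (hk.trans hi) j hj
        by_contra hne
        exact absurd this (not_le.2 (mul_pos (lt_of_le_of_ne h3 (Ne.symm hne)) hpl))
      · exact h0
    have hk₀i : i < k₀ := by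
      by_contra hc
      exact hpk.ne' (hcol k₀ (not_lt.1 hc))
    intro k hk l hl hln
    rcases hl.lt_or_eq with hl | rfl
    · have := htp k k₀ j l (hk.trans_lt hk₀i) hk₀ hl hln
      rw [hcol k hk, zero_mul] at this
      have h3 := nn k (hk.trans_lt hi) l hln
      by_contra hne
      exact absurd this (not_le.2 (mul_pos (lt_of_le_of_ne h3 (Ne.symm hne)) hpk))
    · exact hcol k hk
  · right
    have hcol : ∀ k, i ≤ k → k < n → P k j = 0 := by
      intro k hk hkn
      rcases hk.lt_or_eq with hk | rfl
      · have := htp i k j l₀ hk hkn hlj hl₀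
        rw [h0, zero_mul] at this
        have h3 := nn k hkn j hj
        by_contra hne
        exact absurd this (not_le.2 (mul_pos hpl (lt_of_le_of_ne h3 (Ne.symm hne))))
      · exact h0
    have hk₀i : k₀ < i := by
      by_contra hc
      exact hpk.ne' (hcol k₀ (not_lt.1 hc) hk₀)
    intro k hk hkn l hl
    rcases hl.lt_or_eq with hl | rfl
    · have := htp k₀ k l j (hk₀i.trans_le hk) hkn hl hj
      rw [hcol k hk hkn, mul_zero] at this
      have h3 := nn k hkn l (hl.trans hj)
      by_contra hne
      exact absurd this (not_le.2 (mul_pos hpk (lt_of_le_of_ne h3 (Ne.symm hne))))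
    · exact hcol k hk hkn

/-- The two kinds of zero quadrants are exchanged by transposition. The index ranges cover the four
partial sums at the corners of the cell `(i, j)`. -/
lemma sum_eq_of_corner_zero (h : ConcordantArrays n P Q)
    (htp : ∀ i k j l, i < k → k < n → j < l → l < n → P i l * P k j ≤ P i j * P k l)
    {i j : ℕ} (hi : i < n) (hj : j < n) (h0 : P i j = 0) {i' j' : ℕ}
    (hi' : i ≤ i') (hi'' : i' ≤ i + 1) (hj' : j ≤ j') (hj'' : j' ≤ j + 1) :
    ∑ k ∈ Finset.range i', ∑ l ∈ Finset.range j', P k l =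
      ∑ k ∈ Finset.range i', ∑ l ∈ Finset.range j', Q k l := by
  rcases h.zero_quadrant htp hi hj h0 with hz | hz
  · exact h.sum_eq_of_zero hi hz hi'' hj' (by omega)
  · rw [Finset.sum_comm, Finset.sum_comm (f := fun i j => Q i j)]
    exact h.transpose.sum_eq_of_zero hj (fun l hl k hk hkn => hz k hk hkn l hl) hj'' hi' (by omega)

/-- An entry is the mixed difference of the four partial sums around it. So `Q` vanishes wherever
`log P` has no meaning. -/
lemma right_zero_of_left_zero (h : ConcordantArrays n P Q)
    (htp : ∀ i k j l, i < k → k < n → j < l → l < n → P i l * P k j ≤ P i j * P k l)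
    {i j : ℕ} (hi : i < n) (hj : j < n) (h0 : P i j = 0) : Q i j = 0 := by
  have hc := fun i' j' a b c d =>
    h.sum_eq_of_corner_zero htp hi hj h0 (i' := i') (j' := j') a b c d
  have h1 := hc i j le_rfl (by omega) le_rfl (by omega)
  have h2 := hc i (j + 1) le_rfl (by omega) (by omega) le_rfl
  have h3 := hc (i + 1) j (by omega) le_rfl le_rfl (by omega)
  have h4 := hc (i + 1) (j + 1) (by omega) le_rfl (by omega) le_rfl
  simp only [Finset.sum_range_succ, Finset.sum_add_distrib] at h1 h2 h3 h4
  linarith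

/-- The tangent line inequality for the convex function `klFun`, whose derivative is `log`; it is a
rewriting of `p * klFun (q / p) ≥ 0`. -/
lemma log_mul_sub_le_klFun {p q : ℝ} (hp : 0 < p) (hq : 0 ≤ q) :
    Real.log p * (q - p) ≤ InformationTheory.klFun q - InformationTheory.klFun p := by
  have h := mul_nonneg hp.le (InformationTheory.klFun_nonneg (div_nonneg hq hp.le))
  simp only [InformationTheory.klFun_apply] at h ⊢
  rcases hq.eq_or_lt with rfl | hq
  · simp; nlinarith
  · rw [Real.log_div hq.ne' hp.ne'] at h
    have : p * (q / p * (Real.log q - Real.log p) + 1 - q / p) =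
      q * (Real.log q - Real.log p) + p - q := by field_simp
    rw [this] at h
    linarith

/-- Among arrays with given row and column sums, entropy decreases along the concordance order
starting from a totally positive array. -/
theorem sum_klFun_le (h : ConcordantArrays n P Q)
    (htp : ∀ i k j l, i < k → k < n → j < l → l < n → P i l * P k j ≤ P i j * P k l) :
    ∑ i ∈ Finset.range n, ∑ j ∈ Finset.range n, InformationTheory.klFun (P i j) ≤
      ∑ i ∈ Finset.range n, ∑ j ∈ Finset.range n, InformationTheory.klFun (Q i j) := by
  obtain _ | m := n
  · simp
  have h1 : ∀ i ∈ Finset.range (m + 1), ∀ j ∈ Finset.range (m + 1),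
      Real.log (P i j) * (Q i j - P i j) ≤
        InformationTheory.klFun (Q i j) - InformationTheory.klFun (P i j) := by
    intro i hi j hj
    rw [Finset.mem_range] at hi hj
    rcases (h.nonneg_left i hi j hj).eq_or_lt with h0 | h0
    · rw [← h0, h.right_zero_of_left_zero htp hi hj h0.symm]; simp
    · exact log_mul_sub_le_klFun h0 (h.nonneg_right i hi j hj)
  -- The mean of `log P` does not decrease from `P` to `Q`: after summation by parts, each term is a
  -- cumulative difference `Q - P`, nonnegative by concordance, times a mixed difference of `log P`,
  -- nonnegative by total positivity.
  have h2 : 0 ≤ ∑ i ∈ Finset.range (m + 1), ∑ j ∈ Finset.range (m + 1),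
      Real.log (P i j) * (Q i j - P i j) := by
    rw [sum_sum_mul_eq_by_parts m (fun i j => Real.log (P i j)) (fun i j => Q i j - P i j)
      (fun i hi => by rw [Finset.sum_sub_distrib, h.row_eq i hi, sub_self])
      (fun j hj => by rw [Finset.sum_sub_distrib, h.col_eq j hj, sub_self])]
    refine Finset.sum_nonneg fun i hi => Finset.sum_nonneg fun j hj => ?_
    rw [Finset.mem_range] at hi hj
    have hD : ∑ k ∈ Finset.range (i + 1), ∑ l ∈ Finset.range (j + 1), (Q k l - P k l) =
        ∑ k ∈ Finset.range (i + 1), ∑ l ∈ Finset.range (j + 1), Q k l -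
          ∑ k ∈ Finset.range (i + 1), ∑ l ∈ Finset.range (j + 1), P k l := by
      simp only [Finset.sum_sub_distrib]
    rw [hD]
    -- With a zero in the `2 × 2` block the convention `log 0 = 0` spoils super-modularity, but then
    -- the cumulative difference multiplying the block is zero.
    by_cases hz : ∃ a b, a ≤ 1 ∧ b ≤ 1 ∧ P (i + a) (j + b) = 0
    · obtain ⟨a, b, ha, hb, h0⟩ := hz
      rw [h.sum_eq_of_corner_zero htp (i := i + a) (j := j + b) (by omega) (by omega) h0
        (by omega) (by omega) (by omega) (by omega)]
      simp
    · push Not at hz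
      have hpos : ∀ a b, a ≤ 1 → b ≤ 1 → 0 < P (i + a) (j + b) := fun a b ha hb =>
        lt_of_le_of_ne (h.nonneg_left _ (by omega) _ (by omega)) (hz a b ha hb).symm
      have h00 := hpos 0 0 (by omega) (by omega)
      have h01 := hpos 0 1 (by omega) (by omega)
      have h10 := hpos 1 0 (by omega) (by omega)
      have h11 := hpos 1 1 (by omega) (by omega)
      simp only [add_zero] at h00 h01 h10 h11
      have hl := Real.log_le_log (mul_pos h01 h10)
        (htp i (i + 1) j (j + 1) (by omega) (by omega) (by omega) (by omega))
      rw [Real.log_mul h01.ne' h10.ne', Real.log_mul h00.ne' h11.ne'] at hl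
      exact mul_nonneg (sub_nonneg.2 (h.le _ (by omega) _ (by omega))) (by linarith)
  have h3 := h2.trans (Finset.sum_le_sum fun i hi => Finset.sum_le_sum fun j hj => h1 i hi j hj)
  simp only [Finset.sum_sub_distrib] at h3
  linarith

/-- The reverse rule version of `sum_klFun_le`. -/
theorem sum_klFun_le_of_reverse (h : ConcordantArrays n Q P)
    (hrr : ∀ i k j l, i < k → k < n → j < l → l < n → P i j * P k l ≤ P i l * P k j) :
    ∑ i ∈ Finset.range n, ∑ j ∈ Finset.range n, InformationTheory.klFun (P i j) ≤
      ∑ i ∈ Finset.range n, ∑ j ∈ Finset.range n, InformationTheory.klFun (Q i j) := by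
  have hpart : ∀ (R : ℕ → ℕ → ℝ) (k j : ℕ), j ≤ n →
      ∑ l ∈ Finset.range j, R k (n - 1 - l) =
        ∑ l ∈ Finset.range n, R k l - ∑ l ∈ Finset.range (n - j), R k l := by
    intro R k j hj
    rw [← Finset.sum_range_reflect (R k) n]
    have h1 : ∑ l ∈ Finset.range (n - j), R k l =
        ∑ l ∈ Finset.range (n - j), R k (n - 1 - (j + l)) := by
      rw [← Finset.sum_range_reflect]
      exact Finset.sum_congr rfl fun l hl => by congr 1; omega
    have h2 := Finset.sum_range_add (fun l => R k (n - 1 - l)) j (n - j)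
    rw [Nat.add_sub_cancel' hj] at h2
    rw [h1, h2]; ring
  -- Reversing the order of the columns turns the reverse rule into total positivity and reverses
  -- the concordance order.
  have hc : ConcordantArrays n (fun i j => P i (n - 1 - j)) (fun i j => Q i (n - 1 - j)) := by
    refine ⟨fun i hi j hj => h.nonneg_right i hi _ (by omega), fun i hi j hj => h.nonneg_left i hi _ (by omega),
      fun i hi => ?_, fun j hj => (h.col_eq _ (by omega)).symm, fun i hi => ?_, fun j hj => ?_,
      fun i hi j hj => ?_⟩
    · rw [Finset.sum_range_reflect, Finset.sum_range_reflect]; exact (h.row_eq i hi).symm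
    · rw [Finset.sum_range_reflect, ← h.row_eq i hi]; exact h.row_pos i hi
    · rw [← h.col_eq _ (by omega)]; exact h.col_pos _ (by omega)
    · simp only [hpart _ _ j hj, Finset.sum_sub_distrib]
      have h1 := h.le i hi (n - j) (by omega)
      have h2 : ∑ k ∈ Finset.range i, ∑ l ∈ Finset.range n, Q k l =
          ∑ k ∈ Finset.range i, ∑ l ∈ Finset.range n, P k l :=
        Finset.sum_congr rfl fun k hk => h.row_eq k ((Finset.mem_range.1 hk).trans_le hi)
      linarith
  have := hc.sum_klFun_le fun i k j l hik hk hjl hl => by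
    have := hrr i k (n - 1 - l) (n - 1 - j) hik hk (by omega) (by omega)
    linarith
  have hr : ∀ R : ℕ → ℕ → ℝ, ∑ i ∈ Finset.range n, ∑ j ∈ Finset.range n,
      InformationTheory.klFun (R i (n - 1 - j)) =
      ∑ i ∈ Finset.range n, ∑ j ∈ Finset.range n, InformationTheory.klFun (R i j) := fun R =>
    Finset.sum_congr rfl fun i _ =>
      Finset.sum_range_reflect (fun j => InformationTheory.klFun (R i j)) n
  rwa [hr P, hr Q] at this

end ConcordantArrays

/-! ### Discretization on a grid -/

/-- The cell of the `N × N` grid with lower left corner `(i / N, j / N)`. -/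
def gridCell (N i j : ℕ) : Set (ℝ × ℝ) :=
  Ioc (i / N : ℝ) ((i + 1) / N) ×ˢ Ioc (j / N : ℝ) ((j + 1) / N)

lemma measurableSet_gridCell (N i j : ℕ) : MeasurableSet (gridCell N i j) :=
  measurableSet_Ioc.prod measurableSet_Ioc

lemma volume_gridCell (N i j : ℕ) : volume (gridCell N i j) = ENNReal.ofReal (1 / N ^ 2) := by
  rw [gridCell, Measure.volume_eq_prod, Measure.prod_prod, Real.volume_Ioc, Real.volume_Ioc,
    ← ENNReal.ofReal_mul]
  · congr 1; ring
  · rw [← sub_div]; simp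

lemma sum_measure_prod_Ioc_right (m : Measure (ℝ × ℝ)) {A : Set ℝ} (hA : MeasurableSet A)
    (N j : ℕ) :
    ∑ l ∈ Finset.range j, m (A ×ˢ Ioc (l / N : ℝ) ((l + 1) / N)) = m (A ×ˢ Ioc (0 : ℝ) (j / N)) := by
  induction j with
  | zero => simp
  | succ j ih =>
    rw [Finset.sum_range_succ, ih, ← measure_union _ (hA.prod measurableSet_Ioc), ← prod_union,
      Ioc_union_Ioc_eq_Ioc (by positivity) (by gcongr; simp)]
    · push_cast; rfl
    · refine Set.Disjoint.set_prod_right ?_ _ _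
      exact Set.Ioc_disjoint_Ioc_of_le le_rfl

lemma sum_measure_prod_Ioc_left (m : Measure (ℝ × ℝ)) {B : Set ℝ} (hB : MeasurableSet B)
    (N i : ℕ) :
    ∑ k ∈ Finset.range i, m (Ioc (k / N : ℝ) ((k + 1) / N) ×ˢ B) = m (Ioc (0 : ℝ) (i / N) ×ˢ B) := by
  induction i with
  | zero => simp
  | succ i ih =>
    rw [Finset.sum_range_succ, ih, ← measure_union _ (measurableSet_Ioc.prod hB), ← union_prod,
      Ioc_union_Ioc_eq_Ioc (by positivity) (by gcongr; simp)]
    · push_cast; rfl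
    · refine Set.Disjoint.set_prod_left ?_ _ _
      exact Set.Ioc_disjoint_Ioc_of_le le_rfl

lemma sum_measure_gridCell (m : Measure (ℝ × ℝ)) (N i j : ℕ) :
    ∑ k ∈ Finset.range i, ∑ l ∈ Finset.range j, m (gridCell N k l) =
      m (Ioc (0 : ℝ) (i / N) ×ˢ Ioc (0 : ℝ) (j / N)) := by
  simp only [gridCell, sum_measure_prod_Ioc_right m measurableSet_Ioc,
    sum_measure_prod_Ioc_left m measurableSet_Ioc]

lemma sum_lintegral_gridCell (f : ℝ × ℝ → ENNReal) {N : ℕ} (hN : 0 < N) :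
    ∑ k ∈ Finset.range N, ∑ l ∈ Finset.range N, ∫⁻ p in gridCell N k l, f p =
      ∫⁻ p in unitSquare, f p := by
  have h := sum_measure_gridCell (volume.withDensity f) N N N
  have hN' : (N : ℝ) ≠ 0 := by positivity
  rw [div_self hN', withDensity_apply _ (measurableSet_Ioc.prod measurableSet_Ioc)] at h
  simp only [withDensity_apply _ (measurableSet_gridCell N _ _)] at h
  rw [h]
  refine setLIntegral_congr ?_
  exact Measure.set_prod_ae_eq Ioc_ae_eq_Icc Ioc_ae_eq_Icc

namespace Copula

/-- The mean density of a copula on the cells of the `N × N` grid. -/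
noncomputable def gridDensity (C : Copula) (N i j : ℕ) : ℝ := N ^ 2 * C.law.real (gridCell N i j)

lemma gridDensity_nonneg (C : Copula) (N i j : ℕ) : 0 ≤ C.gridDensity N i j := by
  unfold gridDensity; positivity

lemma sum_gridDensity (C : Copula) (N i j : ℕ) :
    ∑ k ∈ Finset.range i, ∑ l ∈ Finset.range j, C.gridDensity N k l =
      N ^ 2 * C.cdf (i / N) (j / N) := by
  simp only [gridDensity, ← Finset.mul_sum]
  congr 1
  have h := congrArg ENNReal.toReal (sum_measure_gridCell C.law N i j)
  rw [ENNReal.toReal_sum (fun _ _ => ENNReal.sum_ne_top.2 fun _ _ => measure_ne_top _ _)] at h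
  simp only [ENNReal.toReal_sum (fun _ _ => measure_ne_top C.law _)] at h
  refine h.trans ?_
  rw [cdf, Measure.real]
  congr 1
  refine C.law_congr fun p hp => ?_
  simp [Prod.le_def, hp.1.1, hp.2.1]

lemma sum_gridDensity_row (C : Copula) {N i : ℕ} (hi : i < N) :
    ∑ j ∈ Finset.range N, C.gridDensity N i j = N := by
  have hN : (0 : ℝ) < N := by exact_mod_cast (Nat.zero_le i).trans_lt hi
  have h : ∀ i ≤ N, ∑ k ∈ Finset.range i, ∑ l ∈ Finset.range N, C.gridDensity N k l = N * i := by
    intro i hi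
    have hi' : (i : ℝ) ≤ N := by exact_mod_cast hi
    rw [sum_gridDensity, div_self hN.ne', cdf_one_right _ ⟨by positivity, by
      rw [div_le_one hN]; exact hi'⟩]
    field_simp
  have h1 := h (i + 1) hi
  rw [Finset.sum_range_succ, h i hi.le] at h1
  push_cast at h1
  linarith

lemma sum_gridDensity_col (C : Copula) {N j : ℕ} (hj : j < N) :
    ∑ i ∈ Finset.range N, C.gridDensity N i j = N := by
  have hN : (0 : ℝ) < N := by exact_mod_cast (Nat.zero_le j).trans_lt hj
  have h : ∀ j ≤ N, ∑ l ∈ Finset.range j, ∑ k ∈ Finset.range N, C.gridDensity N k l = N * j := by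
    intro j hj
    have hj' : (j : ℝ) ≤ N := by exact_mod_cast hj
    rw [Finset.sum_comm, sum_gridDensity, div_self hN.ne', cdf_one_left _ ⟨by positivity, by
      rw [div_le_one hN]; exact hj'⟩]
    field_simp
  have h1 := h (j + 1) hj
  rw [Finset.sum_range_succ, h j hj.le] at h1
  push_cast at h1
  linarith

lemma concordantArrays_gridDensity {C D : Copula} (h : ∀ u v, C.cdf u v ≤ D.cdf u v) (N : ℕ) :
    ConcordantArrays N (C.gridDensity N) (D.gridDensity N) where
  nonneg_left i _ j _ := C.gridDensity_nonneg N i j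
  nonneg_right i _ j _ := D.gridDensity_nonneg N i j
  row_eq i hi := by rw [C.sum_gridDensity_row hi, D.sum_gridDensity_row hi]
  col_eq j hj := by rw [C.sum_gridDensity_col hj, D.sum_gridDensity_col hj]
  row_pos i hi := by
    rw [C.sum_gridDensity_row hi]; exact_mod_cast (Nat.zero_le i).trans_lt hi
  col_pos j hj := by
    rw [C.sum_gridDensity_col hj]; exact_mod_cast (Nat.zero_le j).trans_lt hj
  le i _ j _ := by
    rw [sum_gridDensity, sum_gridDensity]
    exact mul_le_mul_of_nonneg_left (h _ _) (by positivity)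

/-! ### Jensen's inequality and Lebesgue differentiation on the grids -/

lemma IsAbsCont.setIntegral_density {C : Copula} (hC : C.IsAbsCont) (s : Set (ℝ × ℝ)) :
    ∫ p in s, C.density p = C.law.real s :=
  Measure.setIntegral_toReal_rnDeriv hC s

lemma IsAbsCont.setAverage_gridCell {C : Copula} (hC : C.IsAbsCont) {N : ℕ} (i j : ℕ) :
    ⨍ p in gridCell N i j, C.density p = C.gridDensity N i j := by
  rw [setAverage_eq, hC.setIntegral_density, Measure.real, volume_gridCell,
    ENNReal.toReal_ofReal (by positivity), gridDensity, smul_eq_mul]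
  simp

lemma IsAbsCont.klFun_gridDensity_le {C : Copula} (hC : C.IsAbsCont) {N : ℕ} (hN : 0 < N)
    (i j : ℕ) :
    ENNReal.ofReal (1 / N ^ 2 * InformationTheory.klFun (C.gridDensity N i j)) ≤
      ∫⁻ p in gridCell N i j, ENNReal.ofReal (InformationTheory.klFun (C.density p)) := by
  by_cases htop : ∫⁻ p in gridCell N i j,
      ENNReal.ofReal (InformationTheory.klFun (C.density p)) = ⊤
  · rw [htop]; exact le_top
  have hd0 : ∀ p, 0 ≤ C.density p := fun p => ENNReal.toReal_nonneg
  have hmeas : Measurable (fun p => InformationTheory.klFun (C.density p)) :=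
    InformationTheory.measurable_klFun.comp C.measurable_density
  have hint : IntegrableOn (fun p => InformationTheory.klFun (C.density p)) (gridCell N i j) := by
    refine ⟨hmeas.aestronglyMeasurable, ?_⟩
    rw [hasFiniteIntegral_iff_ofReal (ae_of_all _ fun p => InformationTheory.klFun_nonneg (hd0 p))]
    exact lt_top_iff_ne_top.2 htop
  have hint' : Integrable C.density := Measure.integrable_toReal_rnDeriv
  have hpos : (0 : ℝ) < 1 / N ^ 2 := by positivity
  have key := InformationTheory.convexOn_klFun.map_set_average_le
    InformationTheory.continuous_klFun.continuousOn isClosed_Ici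
    (by rw [volume_gridCell]; simpa using hN.ne') (by rw [volume_gridCell]; simp)
    (ae_of_all _ fun p => hd0 p) hint'.integrableOn hint
  rw [hC.setAverage_gridCell, setAverage_eq, Measure.real, volume_gridCell,
    ENNReal.toReal_ofReal (by positivity), smul_eq_mul] at key
  rw [← ofReal_integral_eq_lintegral_ofReal hint
    (ae_of_all _ fun p => InformationTheory.klFun_nonneg (hd0 p))]
  refine ENNReal.ofReal_le_ofReal ?_
  calc _ ≤ 1 / (N : ℝ) ^ 2 * ((1 / (N : ℝ) ^ 2)⁻¹ * _) := mul_le_mul_of_nonneg_left key hpos.le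
    _ = _ := by rw [← mul_assoc, mul_inv_cancel₀ hpos.ne', one_mul]

/-- Averaging over cells does not increase the divergence, by Jensen's inequality on each cell. The
complementary bound is `IsAbsCont.divergence_le_liminf`. -/
lemma IsAbsCont.sum_klFun_gridDensity_le {C : Copula} (hC : C.IsAbsCont) {N : ℕ} (hN : 0 < N) :
    ENNReal.ofReal (1 / N ^ 2 * ∑ i ∈ Finset.range N, ∑ j ∈ Finset.range N,
      InformationTheory.klFun (C.gridDensity N i j)) ≤ C.divergence := by
  have hk : ∀ i j, 0 ≤ 1 / (N : ℝ) ^ 2 * InformationTheory.klFun (C.gridDensity N i j) :=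
    fun i j => mul_nonneg (by positivity)
      (InformationTheory.klFun_nonneg (C.gridDensity_nonneg N i j))
  simp only [Finset.mul_sum]
  rw [ENNReal.ofReal_sum_of_nonneg fun i _ => Finset.sum_nonneg fun j _ => hk i j,
    hC.divergence_eq, ← sum_lintegral_gridCell _ hN]
  refine Finset.sum_le_sum fun i _ => ?_
  rw [ENNReal.ofReal_sum_of_nonneg fun j _ => hk i j]
  exact Finset.sum_le_sum fun j _ => hC.klFun_gridDensity_le hN i j

/-- The step function with the values `gridDensity` on the grid cells. -/
noncomputable def gridStep (C : Copula) (N : ℕ) (p : ℝ × ℝ) : ℝ :=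
  C.gridDensity N (⌈N * p.1⌉₊ - 1) (⌈N * p.2⌉₊ - 1)

lemma measurable_gridStep (C : Copula) (N : ℕ) : Measurable (C.gridStep N) := by
  have h : Measurable (fun q : ℕ × ℕ => C.gridDensity N (q.1 - 1) (q.2 - 1)) :=
    measurable_of_countable _
  have h1 : Measurable (fun p : ℝ × ℝ => ⌈N * p.1⌉₊) :=
    Nat.measurable_ceil.comp (measurable_fst.const_mul _)
  have h2 : Measurable (fun p : ℝ × ℝ => ⌈N * p.2⌉₊) :=
    Nat.measurable_ceil.comp (measurable_snd.const_mul _)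
  have h3 := h.comp (h1.prodMk h2)
  simp only [Function.comp_def] at h3
  unfold gridStep
  exact h3

/-- The cells are open on the left and closed on the right, whence the ceiling; it is at least one
here, so the truncated subtraction is genuine. -/
lemma ceil_sub_one_of_mem {N i : ℕ} (hN : 0 < N) {x : ℝ}
    (hx : x ∈ Ioc (i / N : ℝ) ((i + 1) / N)) : ⌈N * x⌉₊ - 1 = i := by
  have hN' : (0 : ℝ) < N := by exact_mod_cast hN
  have h1 : (i : ℝ) < N * x := by rw [mul_comm]; exact (div_lt_iff₀ hN').1 hx.1
  have h2 : N * x ≤ i + 1 := by rw [mul_comm]; exact (le_div_iff₀ hN').1 hx.2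
  have : ⌈N * x⌉₊ = i + 1 := by
    refine le_antisymm (Nat.ceil_le.2 (by push_cast; exact h2)) ?_
    exact Nat.succ_le_of_lt (Nat.lt_ceil.2 h1)
  omega

lemma gridStep_of_mem (C : Copula) {N i j : ℕ} (hN : 0 < N) {p : ℝ × ℝ}
    (hp : p ∈ gridCell N i j) : C.gridStep N p = C.gridDensity N i j := by
  rw [gridStep, ceil_sub_one_of_mem hN hp.1, ceil_sub_one_of_mem hN hp.2]

lemma mem_gridCell_ceil {N : ℕ} (hN : 0 < N) {p : ℝ × ℝ}
    (hp : p ∈ Ioo (0 : ℝ) 1 ×ˢ Ioo (0 : ℝ) 1) :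
    p ∈ gridCell N (⌈N * p.1⌉₊ - 1) (⌈N * p.2⌉₊ - 1) := by
  have hN' : (0 : ℝ) < N := by exact_mod_cast hN
  have key : ∀ x : ℝ, 0 < x → x ∈ Ioc (((⌈N * x⌉₊ - 1 : ℕ) : ℝ) / N)
      ((((⌈N * x⌉₊ - 1 : ℕ) : ℝ) + 1) / N) := by
    intro x hx
    have h1 : 0 < ⌈N * x⌉₊ := Nat.ceil_pos.2 (by positivity)
    have h2 : ((⌈N * x⌉₊ - 1 : ℕ) : ℝ) = (⌈N * x⌉₊ : ℝ) - 1 := by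
      rw [Nat.cast_sub h1]; simp
    rw [h2]
    constructor
    · rw [div_lt_iff₀ hN']
      have := Nat.ceil_lt_add_one (a := N * x) (by positivity)
      linarith
    · rw [le_div_iff₀ hN', sub_add_cancel]
      have := Nat.le_ceil (N * x)
      linarith
  exact ⟨key _ hp.1.1, key _ hp.2.1⟩

lemma lintegral_klFun_gridStep (C : Copula) {N : ℕ} (hN : 0 < N) :
    ∫⁻ p in unitSquare, ENNReal.ofReal (InformationTheory.klFun (C.gridStep N p)) =
      ENNReal.ofReal (1 / N ^ 2 * ∑ i ∈ Finset.range N, ∑ j ∈ Finset.range N,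
        InformationTheory.klFun (C.gridDensity N i j)) := by
  have hk : ∀ i j, 0 ≤ 1 / (N : ℝ) ^ 2 * InformationTheory.klFun (C.gridDensity N i j) :=
    fun i j => mul_nonneg (by positivity)
      (InformationTheory.klFun_nonneg (C.gridDensity_nonneg N i j))
  rw [← sum_lintegral_gridCell _ hN]
  simp only [Finset.mul_sum]
  rw [ENNReal.ofReal_sum_of_nonneg fun i _ => Finset.sum_nonneg fun j _ => hk i j]
  refine Finset.sum_congr rfl fun i _ => ?_
  rw [ENNReal.ofReal_sum_of_nonneg fun j _ => hk i j]
  refine Finset.sum_congr rfl fun j _ => ?_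
  rw [setLIntegral_congr_fun (measurableSet_gridCell N i j)
    (g := fun _ => ENNReal.ofReal (InformationTheory.klFun (C.gridDensity N i j)))
    fun p hp => by simp only [C.gridStep_of_mem hN hp]]
  rw [setLIntegral_const, volume_gridCell, mul_comm, ENNReal.ofReal_mul (by positivity)]

/-- The metric of `ℝ × ℝ` is the maximum metric, so a square cell is a ball up to its boundary and
differentiation along balls applies to the grids. -/
lemma gridCell_ae_eq_closedBall {N : ℕ} (hN : 0 < N) (i j : ℕ) :
    gridCell N i j =ᵐ[volume] Metric.closedBall
      (((2 * i + 1) / (2 * N), (2 * j + 1) / (2 * N)) : ℝ × ℝ) (1 / (2 * N)) := by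
  have hN' : (0 : ℝ) < N := by exact_mod_cast hN
  have key : ∀ i : ℕ, Metric.closedBall ((2 * i + 1) / (2 * N) : ℝ) (1 / (2 * N)) =
      Icc (i / N : ℝ) ((i + 1) / N) := by
    intro i
    rw [Real.closedBall_eq_Icc]
    congr 1 <;> field_simp <;> ring
  rw [← closedBall_prod_same, key, key]
  exact Measure.set_prod_ae_eq Ioc_ae_eq_Icc Ioc_ae_eq_Icc

lemma gridCell_subset_closedBall {N : ℕ} (hN : 0 < N) (i j : ℕ) :
    gridCell N i j ⊆ Metric.closedBall
      (((2 * i + 1) / (2 * N), (2 * j + 1) / (2 * N)) : ℝ × ℝ) (1 / (2 * N)) := by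
  have hN' : (0 : ℝ) < N := by exact_mod_cast hN
  have key : ∀ i : ℕ, Ioc (i / N : ℝ) ((i + 1) / N) ⊆
      Metric.closedBall ((2 * i + 1) / (2 * N) : ℝ) (1 / (2 * N)) := by
    intro i
    rw [Real.closedBall_eq_Icc]
    refine Ioc_subset_Icc_self.trans (Icc_subset_Icc ?_ ?_) <;>
      refine le_of_eq ?_ <;> field_simp <;> ring
  rw [← closedBall_prod_same]
  exact prod_mono (key i) (key j)

lemma IsAbsCont.tendsto_gridStep {C : Copula} (hC : C.IsAbsCont) :
    ∀ᵐ p ∂(volume.restrict unitSquare),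
      Tendsto (fun n : ℕ => C.gridStep (n + 1) p) atTop (𝓝 (C.density p)) := by
  have hint : Integrable C.density := Measure.integrable_toReal_rnDeriv
  -- The balls need not be centred at the point. The factor `1` requires the point to lie in the
  -- ball itself, as it does in the one spanned by its cell.
  have h0 := IsUnifLocDoublingMeasure.ae_tendsto_average (volume : Measure (ℝ × ℝ))
    hint.locallyIntegrable 1
  have h1 : ∀ᵐ p ∂(volume.restrict unitSquare), p ∈ Ioo (0 : ℝ) 1 ×ˢ Ioo (0 : ℝ) 1 := by
    have : unitSquare =ᵐ[volume] Ioo (0 : ℝ) 1 ×ˢ Ioo (0 : ℝ) 1 :=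
      Measure.set_prod_ae_eq Ioo_ae_eq_Icc.symm Ioo_ae_eq_Icc.symm
    rw [Measure.restrict_congr_set this]
    exact ae_restrict_mem (measurableSet_Ioo.prod measurableSet_Ioo)
  filter_upwards [ae_restrict_of_ae h0, h1] with p hp hp1
  have h := hp (l := atTop)
    (fun n : ℕ => (((2 * ((⌈((n + 1 : ℕ) : ℝ) * p.1⌉₊ - 1 : ℕ) : ℝ) + 1) / (2 * (n + 1 : ℕ)),
      (2 * ((⌈((n + 1 : ℕ) : ℝ) * p.2⌉₊ - 1 : ℕ) : ℝ) + 1) / (2 * (n + 1 : ℕ))) : ℝ × ℝ))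
    (fun n : ℕ => 1 / (2 * (n + 1 : ℕ))) ?_ ?_
  · refine h.congr fun n => ?_
    rw [gridStep, ← hC.setAverage_gridCell]
    exact (setAverage_congr (gridCell_ae_eq_closedBall n.succ_pos _ _)).symm
  · refine tendsto_nhdsWithin_iff.2 ⟨?_, Eventually.of_forall fun n => by
      simp only [mem_Ioi]; positivity⟩
    have := (tendsto_one_div_add_atTop_nhds_zero_nat (𝕜 := ℝ)).const_mul (1 / 2)
    rw [mul_zero] at this
    refine this.congr fun n => ?_
    push_cast
    field_simp
  · refine Eventually.of_forall fun n => ?_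
    rw [one_mul]
    exact gridCell_subset_closedBall n.succ_pos _ _ (mem_gridCell_ceil n.succ_pos hp1)

/-- Fatou's lemma for the step functions, which converge to the density almost everywhere. The index
`n + 1` excludes the empty grid. -/
lemma IsAbsCont.divergence_le_liminf {C : Copula} (hC : C.IsAbsCont) :
    C.divergence ≤ liminf (fun n : ℕ => ENNReal.ofReal (1 / (n + 1 : ℕ) ^ 2 *
      ∑ i ∈ Finset.range (n + 1), ∑ j ∈ Finset.range (n + 1),
        InformationTheory.klFun (C.gridDensity (n + 1) i j))) atTop := by
  simp only [← lintegral_klFun_gridStep C (Nat.succ_pos _)]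
  refine le_trans (le_of_eq ?_) (lintegral_liminf_le fun n =>
    (InformationTheory.measurable_klFun.comp (C.measurable_gridStep _)).ennreal_ofReal)
  rw [hC.divergence_eq]
  refine lintegral_congr_ae ?_
  filter_upwards [hC.tendsto_gridStep] with p hp
  refine (Tendsto.liminf_eq ?_).symm
  exact (ENNReal.continuous_ofReal.tendsto _).comp
    ((InformationTheory.continuous_klFun.tendsto _).comp hp)

lemma IsAbsCont.divergence_le_of_gridDensity {C D : Copula} (hC : C.IsAbsCont) (hD : D.IsAbsCont)
    (h : ∀ N, ∑ i ∈ Finset.range N, ∑ j ∈ Finset.range N,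
      InformationTheory.klFun (C.gridDensity N i j) ≤
        ∑ i ∈ Finset.range N, ∑ j ∈ Finset.range N,
          InformationTheory.klFun (D.gridDensity N i j)) :
    C.divergence ≤ D.divergence := by
  refine hC.divergence_le_liminf.trans (liminf_le_of_frequently_le' (Frequently.of_forall
    fun n => ?_))
  refine le_trans (ENNReal.ofReal_le_ofReal ?_) (hD.sum_klFun_gridDensity_le n.succ_pos)
  exact mul_le_mul_of_nonneg_left (h _) (by positivity)

end Copula

/-! ### Total positivity of measures -/

/-- Total positivity of order two of a measure, tested on pairs of separated rectangles. -/
def TP2Measure (m : Measure (ℝ × ℝ)) : Prop :=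
  ∀ I I' J J' : Set ℝ, MeasurableSet I → MeasurableSet I' → MeasurableSet J → MeasurableSet J' →
    (∀ x ∈ I, ∀ x' ∈ I', x < x') → (∀ y ∈ J, ∀ y' ∈ J', y < y') →
      m (I ×ˢ J') * m (I' ×ˢ J) ≤ m (I ×ˢ J) * m (I' ×ˢ J')

/-- The reverse rule of order two for a measure, tested on pairs of separated rectangles. -/
def RR2Measure (m : Measure (ℝ × ℝ)) : Prop :=
  ∀ I I' J J' : Set ℝ, MeasurableSet I → MeasurableSet I' → MeasurableSet J → MeasurableSet J' →
    (∀ x ∈ I, ∀ x' ∈ I', x < x') → (∀ y ∈ J, ∀ y' ∈ J', y < y') →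
      m (I ×ˢ J) * m (I' ×ˢ J') ≤ m (I ×ˢ J') * m (I' ×ˢ J)

lemma Ioc_div_separated {N i k : ℕ} (hik : i < k) :
    ∀ x ∈ Ioc (i / N : ℝ) ((i + 1) / N), ∀ x' ∈ Ioc (k / N : ℝ) ((k + 1) / N), x < x' := by
  intro x hx x' hx'
  refine hx.2.trans_lt (lt_of_le_of_lt ?_ hx'.1)
  gcongr
  exact_mod_cast hik

namespace Copula

lemma gridDensity_tp2 {C : Copula} (hC : TP2Measure C.law) (N : ℕ) {i k j l : ℕ}
    (hik : i < k) (hjl : j < l) :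
    C.gridDensity N i l * C.gridDensity N k j ≤ C.gridDensity N i j * C.gridDensity N k l := by
  have h := ENNReal.toReal_mono (by finiteness) (hC _ _ _ _ measurableSet_Ioc measurableSet_Ioc
    measurableSet_Ioc measurableSet_Ioc (Ioc_div_separated (N := N) hik)
    (Ioc_div_separated (N := N) hjl))
  rw [ENNReal.toReal_mul, ENNReal.toReal_mul] at h
  have h2 := mul_le_mul_of_nonneg_left h (by positivity : (0 : ℝ) ≤ N ^ 2 * N ^ 2)
  unfold gridDensity
  linarith! only [h2]

lemma gridDensity_rr2 {C : Copula} (hC : RR2Measure C.law) (N : ℕ) {i k j l : ℕ}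
    (hik : i < k) (hjl : j < l) :
    C.gridDensity N i j * C.gridDensity N k l ≤ C.gridDensity N i l * C.gridDensity N k j := by
  have h := ENNReal.toReal_mono (by finiteness) (hC _ _ _ _ measurableSet_Ioc measurableSet_Ioc
    measurableSet_Ioc measurableSet_Ioc (Ioc_div_separated (N := N) hik)
    (Ioc_div_separated (N := N) hjl))
  rw [ENNReal.toReal_mul, ENNReal.toReal_mul] at h
  have h2 := mul_le_mul_of_nonneg_left h (by positivity : (0 : ℝ) ≤ N ^ 2 * N ^ 2)
  unfold gridDensity
  linarith! only [h2]

theorem divergence_le_of_tp2 {C D : Copula} (hC : C.IsAbsCont) (hD : D.IsAbsCont)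
    (htp : TP2Measure C.law) (h : ∀ u v, C.cdf u v ≤ D.cdf u v) :
    C.divergence ≤ D.divergence :=
  hC.divergence_le_of_gridDensity hD fun N => (concordantArrays_gridDensity h N).sum_klFun_le
    fun _ _ _ _ hik _ hjl _ => gridDensity_tp2 htp N hik hjl

theorem divergence_le_of_rr2 {C D : Copula} (hC : C.IsAbsCont) (hD : D.IsAbsCont)
    (hrr : RR2Measure C.law) (h : ∀ u v, D.cdf u v ≤ C.cdf u v) :
    C.divergence ≤ D.divergence :=
  hC.divergence_le_of_gridDensity hD fun N =>
    (concordantArrays_gridDensity h N).sum_klFun_le_of_reverse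
      fun _ _ _ _ hik _ hjl _ => gridDensity_rr2 hrr N hik hjl

end Copula

/-! ### Total positivity of densities and of measures -/

/-- Together with `lintegral_mul_lintegral_straight` this writes both sides of the rectangle
inequality as fourfold integrals over the same variables, so that the pointwise inequality for
densities can be integrated. -/
lemma lintegral_mul_lintegral_swap {f : ℝ × ℝ → ENNReal} (hf : Measurable f)
    (α α' β β' : Measure ℝ) [SFinite α] [SFinite α'] [SFinite β] [SFinite β'] :
    (∫⁻ x, ∫⁻ y', f (x, y') ∂β' ∂α) * (∫⁻ x', ∫⁻ y, f (x', y) ∂β ∂α') =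
      ∫⁻ x, ∫⁻ x', ∫⁻ y, ∫⁻ y', f (x, y') * f (x', y) ∂β' ∂β ∂α' ∂α := by
  have hβ : Measurable fun x => ∫⁻ y, f (x, y) ∂β := hf.lintegral_prod_right'
  have hβ' : Measurable fun x => ∫⁻ y', f (x, y') ∂β' := hf.lintegral_prod_right'
  rw [← lintegral_mul_const _ hβ']
  refine lintegral_congr fun x => ?_
  rw [← lintegral_const_mul _ hβ]
  refine lintegral_congr fun x' => ?_
  rw [← lintegral_const_mul _ (by fun_prop)]
  refine lintegral_congr fun y => ?_
  rw [lintegral_mul_const _ (by fun_prop)]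

lemma lintegral_mul_lintegral_straight {f : ℝ × ℝ → ENNReal} (hf : Measurable f)
    (α α' β β' : Measure ℝ) [SFinite α] [SFinite α'] [SFinite β] [SFinite β'] :
    (∫⁻ x, ∫⁻ y, f (x, y) ∂β ∂α) * (∫⁻ x', ∫⁻ y', f (x', y') ∂β' ∂α') =
      ∫⁻ x, ∫⁻ x', ∫⁻ y, ∫⁻ y', f (x, y) * f (x', y') ∂β' ∂β ∂α' ∂α := by
  have hβ : Measurable fun x => ∫⁻ y, f (x, y) ∂β := hf.lintegral_prod_right'
  have hβ' : Measurable fun x => ∫⁻ y', f (x, y') ∂β' := hf.lintegral_prod_right'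
  rw [← lintegral_mul_const _ hβ]
  refine lintegral_congr fun x => ?_
  rw [← lintegral_const_mul _ hβ']
  refine lintegral_congr fun x' => ?_
  rw [← lintegral_mul_const _ (by fun_prop)]
  refine lintegral_congr fun y => ?_
  rw [lintegral_const_mul _ (by fun_prop)]

lemma withDensity_restrict_prod_apply {f : ℝ × ℝ → ENNReal} (hf : Measurable f) {S T I J : Set ℝ}
    (hI : MeasurableSet I) (hJ : MeasurableSet J) :
    ((volume.restrict (S ×ˢ T)).withDensity f) (I ×ˢ J) =
      ∫⁻ x in I ∩ S, ∫⁻ y in J ∩ T, f (x, y) := by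
  rw [withDensity_apply _ (hI.prod hJ), Measure.restrict_restrict (hI.prod hJ), prod_inter_prod,
    Measure.volume_eq_prod, ← Measure.prod_restrict, lintegral_prod _ hf.aemeasurable]

lemma tp2Measure_withDensity {f : ℝ × ℝ → ENNReal} (hf : Measurable f) {S T : Set ℝ}
    (hS : MeasurableSet S) (hT : MeasurableSet T)
    (h : ∀ x ∈ S, ∀ x' ∈ S, ∀ y ∈ T, ∀ y' ∈ T, x < x' → y < y' →
      f (x, y') * f (x', y) ≤ f (x, y) * f (x', y')) :
    TP2Measure ((volume.restrict (S ×ˢ T)).withDensity f) := by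
  intro I I' J J' hI hI' hJ hJ' hII hJJ
  simp only [withDensity_restrict_prod_apply hf, hI, hI', hJ, hJ']
  rw [lintegral_mul_lintegral_swap hf, lintegral_mul_lintegral_straight hf]
  refine setLIntegral_mono' (hI.inter hS) fun x hx => ?_
  refine setLIntegral_mono' (hI'.inter hS) fun x' hx' => ?_
  refine setLIntegral_mono' (hJ.inter hT) fun y hy => ?_
  refine setLIntegral_mono' (hJ'.inter hT) fun y' hy' => ?_
  exact h x hx.2 x' hx'.2 y hy.2 y' hy'.2 (hII x hx.1 x' hx'.1) (hJJ y hy.1 y' hy'.1)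

lemma rr2Measure_withDensity {f : ℝ × ℝ → ENNReal} (hf : Measurable f) {S T : Set ℝ}
    (hS : MeasurableSet S) (hT : MeasurableSet T)
    (h : ∀ x ∈ S, ∀ x' ∈ S, ∀ y ∈ T, ∀ y' ∈ T, x < x' → y < y' →
      f (x, y) * f (x', y') ≤ f (x, y') * f (x', y)) :
    RR2Measure ((volume.restrict (S ×ˢ T)).withDensity f) := by
  intro I I' J J' hI hI' hJ hJ' hII hJJ
  simp only [withDensity_restrict_prod_apply hf, hI, hI', hJ, hJ']
  rw [lintegral_mul_lintegral_straight hf, lintegral_mul_lintegral_swap hf]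
  refine setLIntegral_mono' (hI.inter hS) fun x hx => ?_
  refine setLIntegral_mono' (hI'.inter hS) fun x' hx' => ?_
  refine setLIntegral_mono' (hJ.inter hT) fun y hy => ?_
  refine setLIntegral_mono' (hJ'.inter hT) fun y' hy' => ?_
  exact h x hx.2 x' hx'.2 y hy.2 y' hy'.2 (hII x hx.1 x' hx'.1) (hJJ y hy.1 y' hy'.1)

namespace Copula

lemma IsDensity.law_eq_Ioo {C : Copula} {c : ℝ × ℝ → ℝ} (h : C.IsDensity c) :
    C.law = (volume.restrict (Ioo (0 : ℝ) 1 ×ˢ Ioo (0 : ℝ) 1)).withDensity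
      fun p => ENNReal.ofReal (c p) := by
  have : unitSquare =ᵐ[volume] Ioo (0 : ℝ) 1 ×ˢ Ioo (0 : ℝ) 1 :=
    Measure.set_prod_ae_eq Ioo_ae_eq_Icc.symm Ioo_ae_eq_Icc.symm
  rw [← Measure.restrict_congr_set this]
  exact h.law_eq

lemma HasTP2Density.tp2Measure {C : Copula} (h : C.HasTP2Density) : TP2Measure C.law := by
  obtain ⟨c, hc, htp⟩ := h
  rw [hc.law_eq_Ioo]
  refine tp2Measure_withDensity hc.measurable.ennreal_ofReal measurableSet_Ioo measurableSet_Ioo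
    fun x hx x' hx' y hy y' hy' hxx hyy => ?_
  have := htp (x, y') ⟨hx, hy'⟩ (x', y) ⟨hx', hy⟩
  simp only [Prod.mk_sup_mk, Prod.mk_inf_mk, sup_eq_right.2 hxx.le, inf_eq_left.2 hxx.le,
    sup_eq_left.2 hyy.le, inf_eq_right.2 hyy.le] at this
  rw [← ENNReal.ofReal_mul (hc.nonneg _), ← ENNReal.ofReal_mul (hc.nonneg _)]
  exact ENNReal.ofReal_le_ofReal (by linarith)

lemma HasRR2Density.rr2Measure {C : Copula} (h : C.HasRR2Density) : RR2Measure C.law := by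
  obtain ⟨c, hc, htp⟩ := h
  rw [hc.law_eq_Ioo]
  refine rr2Measure_withDensity hc.measurable.ennreal_ofReal measurableSet_Ioo measurableSet_Ioo
    fun x hx x' hx' y hy y' hy' hxx hyy => ?_
  have := htp (x, y') ⟨hx, hy'⟩ (x', y) ⟨hx', hy⟩
  simp only [Prod.mk_sup_mk, Prod.mk_inf_mk, sup_eq_right.2 hxx.le, inf_eq_left.2 hxx.le,
    sup_eq_left.2 hyy.le, inf_eq_right.2 hyy.le] at this
  rw [← ENNReal.ofReal_mul (hc.nonneg _), ← ENNReal.ofReal_mul (hc.nonneg _)]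
  exact ENNReal.ofReal_le_ofReal (by linarith)

/-! ### Quadrant dependence -/

lemma real_Iic_add_Ioi_right (C : Copula) {s : Set ℝ} (hs : MeasurableSet s) (v : ℝ) :
    C.law.real (s ×ˢ Iic v) + C.law.real (s ×ˢ Ioi v) = C.law.real (s ×ˢ univ) := by
  rw [← measureReal_union _ (hs.prod measurableSet_Ioi), ← prod_union, Iic_union_Ioi]
  exact Set.Disjoint.set_prod_right (Set.Iic_disjoint_Ioi le_rfl) _ _

lemma real_Iic_add_Ioi_left (C : Copula) {s : Set ℝ} (hs : MeasurableSet s) (u : ℝ) :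
    C.law.real (Iic u ×ˢ s) + C.law.real (Ioi u ×ˢ s) = C.law.real (univ ×ˢ s) := by
  rw [← measureReal_union _ (measurableSet_Ioi.prod hs), ← union_prod, Iic_union_Ioi]
  exact Set.Disjoint.set_prod_left (Set.Iic_disjoint_Ioi le_rfl) _ _

lemma quadrant_identities (C : Copula) {u v : ℝ} (hu : u ∈ Ioo (0 : ℝ) 1)
    (hv : v ∈ Ioo (0 : ℝ) 1) :
    C.law.real (Iic u ×ˢ Ioi v) = u - C.cdf u v ∧ C.law.real (Ioi u ×ˢ Iic v) = v - C.cdf u v ∧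
      C.law.real (Ioi u ×ˢ Ioi v) = 1 - u - v + C.cdf u v := by
  have h1 := C.real_Iic_add_Ioi_right (measurableSet_Iic (a := u)) v
  have h2 := C.real_Iic_add_Ioi_left (measurableSet_Iic (a := v)) u
  have h3 := C.real_Iic_add_Ioi_left MeasurableSet.univ u
  have h4 := C.real_Iic_add_Ioi_right (measurableSet_Ioi (a := u)) v
  have h5 : C.law.real (Iic u ×ˢ univ) = u := by
    rw [Measure.real, C.law_Iic_fst (Ioo_subset_Icc_self hu), ENNReal.toReal_ofReal hu.1.le]
  have h6 : C.law.real (univ ×ˢ Iic v) = v := by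
    rw [Measure.real, C.law_Iic_snd (Ioo_subset_Icc_self hv), ENNReal.toReal_ofReal hv.1.le]
  have h7 : C.law.real (univ ×ˢ univ) = 1 := by
    rw [univ_prod_univ]; exact probReal_univ
  rw [cdf]
  refine ⟨?_, ?_, ?_⟩ <;> linarith

/-- With `c = C(u,v)`, total positivity of the four quadrants at `(u,v)` reads `(u - c)(v - c) ≤ c
(1 - u - v + c)`, which simplifies to `uv ≤ c`. -/
lemma mul_le_cdf_of_tp2 {C : Copula} (hC : TP2Measure C.law) {u v : ℝ} (hu : u ∈ Ioo (0 : ℝ) 1)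
    (hv : v ∈ Ioo (0 : ℝ) 1) : u * v ≤ C.cdf u v := by
  have h := ENNReal.toReal_mono (by finiteness) (hC (Iic u) (Ioi u) (Iic v) (Ioi v)
    measurableSet_Iic measurableSet_Ioi measurableSet_Iic measurableSet_Ioi
    (fun x hx x' hx' => lt_of_le_of_lt hx hx') (fun x hx x' hx' => lt_of_le_of_lt hx hx'))
  rw [ENNReal.toReal_mul, ENNReal.toReal_mul] at h
  obtain ⟨h1, h2, h3⟩ := C.quadrant_identities hu hv
  change C.law.real _ * C.law.real _ ≤ C.cdf u v * C.law.real _ at h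
  rw [h1, h2, h3] at h
  linarith

lemma cdf_le_mul_of_rr2 {C : Copula} (hC : RR2Measure C.law) {u v : ℝ} (hu : u ∈ Ioo (0 : ℝ) 1)
    (hv : v ∈ Ioo (0 : ℝ) 1) : C.cdf u v ≤ u * v := by
  have h := ENNReal.toReal_mono (by finiteness) (hC (Iic u) (Ioi u) (Iic v) (Ioi v)
    measurableSet_Iic measurableSet_Ioi measurableSet_Iic measurableSet_Ioi
    (fun x hx x' hx' => lt_of_le_of_lt hx hx') (fun x hx x' hx' => lt_of_le_of_lt hx hx'))
  rw [ENNReal.toReal_mul, ENNReal.toReal_mul] at h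
  obtain ⟨h1, h2, h3⟩ := C.quadrant_identities hu hv
  change C.cdf u v * C.law.real _ ≤ C.law.real _ * C.law.real _ at h
  rw [h1, h2, h3] at h
  linarith

/-! ### Mixtures and the equality case -/

/-- The mixture of two copulas with equal weights. -/
noncomputable def mix (C D : Copula) : Copula where
  law := (2⁻¹ : NNReal) • C.law + (2⁻¹ : NNReal) • D.law
  fst_uniform := by
    rw [Measure.map_add _ _ measurable_fst, Measure.map_smul, Measure.map_smul, C.fst_uniform,
      D.fst_uniform, ← add_smul, ← two_mul, mul_inv_cancel₀ two_ne_zero, one_smul]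
  snd_uniform := by
    rw [Measure.map_add _ _ measurable_snd, Measure.map_smul, Measure.map_smul, C.snd_uniform,
      D.snd_uniform, ← add_smul, ← two_mul, mul_inv_cancel₀ two_ne_zero, one_smul]

lemma cdf_mix (C D : Copula) (u v : ℝ) : (C.mix D).cdf u v = (C.cdf u v + D.cdf u v) / 2 := by
  simp only [cdf, mix]
  rw [measureReal_add_apply, measureReal_nnreal_smul_apply, measureReal_nnreal_smul_apply]
  push_cast
  ring

lemma IsAbsCont.mix {C D : Copula} (hC : C.IsAbsCont) (hD : D.IsAbsCont) :
    (C.mix D).IsAbsCont :=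
  Measure.AbsolutelyContinuous.add_left (hC.smul_left _) (hD.smul_left _)

lemma density_mix (C D : Copula) :
    (C.mix D).density =ᵐ[volume] fun p => (C.density p + D.density p) / 2 := by
  have h := Measure.rnDeriv_add' ((2⁻¹ : NNReal) • C.law) ((2⁻¹ : NNReal) • D.law)
    (volume : Measure (ℝ × ℝ))
  filter_upwards [h, Measure.rnDeriv_smul_left C.law (volume : Measure (ℝ × ℝ)) (2⁻¹ : NNReal),
    Measure.rnDeriv_smul_left D.law (volume : Measure (ℝ × ℝ)) (2⁻¹ : NNReal),
    Measure.rnDeriv_ne_top C.law (volume : Measure (ℝ × ℝ)),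
    Measure.rnDeriv_ne_top D.law (volume : Measure (ℝ × ℝ))] with p h1 h2 h3 h4 h5
  simp only [density, Copula.mix]
  rw [h1, Pi.add_apply, h2, h3, Pi.smul_apply, Pi.smul_apply, ENNReal.toReal_add
    (by rw [ENNReal.smul_def]; exact ENNReal.mul_ne_top ENNReal.coe_ne_top h4)
    (by rw [ENNReal.smul_def]; exact ENNReal.mul_ne_top ENNReal.coe_ne_top h5)]
  simp [ENNReal.smul_def]
  ring

lemma density_nonneg (C : Copula) (p : ℝ × ℝ) : 0 ≤ C.density p := ENNReal.toReal_nonneg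

lemma IsAbsCont.law_eq_withDensity {C : Copula} (hC : C.IsAbsCont) :
    C.law = _root_.uniformSquare.withDensity fun p => ENNReal.ofReal (C.density p) := by
  conv_lhs => rw [← Measure.withDensity_rnDeriv_eq _ _ hC.uniformSquare]
  refine withDensity_congr_ae ?_
  filter_upwards [hC.rnDeriv_eq, Measure.rnDeriv_ne_top C.law _root_.uniformSquare] with p hp hp'
  rw [density, ← hp, ENNReal.ofReal_toReal hp']

lemma IsAbsCont.integrable_klFun {C : Copula} (hC : C.IsAbsCont) (h : C.divergence ≠ ⊤) :
    IntegrableOn (fun p => InformationTheory.klFun (C.density p)) unitSquare := by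
  refine ⟨(InformationTheory.measurable_klFun.comp C.measurable_density).aestronglyMeasurable, ?_⟩
  rw [hasFiniteIntegral_iff_ofReal
    (ae_of_all _ fun p => InformationTheory.klFun_nonneg (C.density_nonneg p)),
    ← hC.divergence_eq]
  exact lt_top_iff_ne_top.2 h

lemma IsAbsCont.divergence_eq_ofReal {C : Copula} (hC : C.IsAbsCont) (h : C.divergence ≠ ⊤) :
    C.divergence =
      ENNReal.ofReal (∫ p in unitSquare, InformationTheory.klFun (C.density p)) := by
  rw [hC.divergence_eq, ofReal_integral_eq_lintegral_ofReal (hC.integrable_klFun h)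
    (ae_of_all _ fun p => InformationTheory.klFun_nonneg (C.density_nonneg p))]

lemma klFun_midpoint_le {a b : ℝ} (ha : 0 ≤ a) (hb : 0 ≤ b) :
    InformationTheory.klFun ((a + b) / 2) ≤
      (InformationTheory.klFun a + InformationTheory.klFun b) / 2 := by
  have := InformationTheory.convexOn_klFun.2 (mem_Ici.2 ha) (mem_Ici.2 hb)
    (by norm_num : (0 : ℝ) ≤ 1 / 2) (by norm_num : (0 : ℝ) ≤ 1 / 2) (by norm_num)
  simp only [smul_eq_mul] at this
  rw [show (a + b) / 2 = 1 / 2 * a + 1 / 2 * b by ring]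
  linarith

lemma klFun_midpoint_lt {a b : ℝ} (ha : 0 ≤ a) (hb : 0 ≤ b) (hab : a ≠ b) :
    InformationTheory.klFun ((a + b) / 2) <
      (InformationTheory.klFun a + InformationTheory.klFun b) / 2 := by
  have := InformationTheory.strictConvexOn_klFun.2 (mem_Ici.2 ha) (mem_Ici.2 hb) hab
    (by norm_num : (0 : ℝ) < 1 / 2) (by norm_num : (0 : ℝ) < 1 / 2) (by norm_num)
  simp only [smul_eq_mul] at this
  rw [show (a + b) / 2 = 1 / 2 * a + 1 / 2 * b by ring]
  linarith

/-- By strict convexity, two copulas agree if their mixture does not have a smaller divergence. -/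
theorem law_eq_of_divergence_le_mix {C D : Copula} (hC : C.IsAbsCont) (hD : D.IsAbsCont)
    (h1 : C.divergence ≤ (C.mix D).divergence) (h2 : D.divergence ≤ C.divergence)
    (htop : C.divergence ≠ ⊤) : C.law = D.law := by
  have hDtop := ne_top_of_le_ne_top htop h2
  have hCi := hC.integrable_klFun htop
  have hDi := hD.integrable_klFun hDtop
  have hMae : ∀ᵐ p ∂(volume.restrict unitSquare),
      (C.mix D).density p = (C.density p + D.density p) / 2 := ae_restrict_of_ae (C.density_mix D)
  have hMi : IntegrableOn
      (fun p => InformationTheory.klFun ((C.density p + D.density p) / 2)) unitSquare := by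
    refine Integrable.mono' ((hCi.add hDi).div_const 2)
      (InformationTheory.measurable_klFun.comp
        ((C.measurable_density.add D.measurable_density).div_const 2)).aestronglyMeasurable
      (ae_of_all _ fun p => ?_)
    have hc := C.density_nonneg p
    have hd := D.density_nonneg p
    rw [Real.norm_of_nonneg (InformationTheory.klFun_nonneg (by positivity))]
    exact klFun_midpoint_le hc hd
  have hMdiv : (C.mix D).divergence = ENNReal.ofReal
      (∫ p in unitSquare, InformationTheory.klFun ((C.density p + D.density p) / 2)) := by
    rw [(hC.mix hD).divergence_eq, ofReal_integral_eq_lintegral_ofReal hMi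
      (ae_of_all _ fun p => InformationTheory.klFun_nonneg (by
        have hc := C.density_nonneg p
        have hd := D.density_nonneg p
        positivity))]
    refine lintegral_congr_ae ?_
    filter_upwards [hMae] with p hp
    rw [hp]
  rw [hMdiv, hC.divergence_eq_ofReal htop, ENNReal.ofReal_le_ofReal_iff (integral_nonneg fun p => by
    have hc := C.density_nonneg p
    have hd := D.density_nonneg p
    exact InformationTheory.klFun_nonneg (by positivity))] at h1
  rw [hD.divergence_eq_ofReal hDtop, hC.divergence_eq_ofReal htop, ENNReal.ofReal_le_ofReal_iff
    (integral_nonneg fun p => InformationTheory.klFun_nonneg (C.density_nonneg p))] at h2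
  -- The midpoint convexity gap is nonnegative. Its integral is at most zero by `h1` and `h2`, so it
  -- vanishes almost everywhere, and by strict convexity the densities agree.
  set G : ℝ × ℝ → ℝ := fun p =>
    (InformationTheory.klFun (C.density p) + InformationTheory.klFun (D.density p)) / 2 -
      InformationTheory.klFun ((C.density p + D.density p) / 2) with hG
  have hGi : IntegrableOn G unitSquare := ((hCi.add hDi).div_const 2).sub hMi
  have hG0 : ∀ p, 0 ≤ G p := fun p =>
    sub_nonneg.2 (klFun_midpoint_le (C.density_nonneg p) (D.density_nonneg p))
  have hGint : ∫ p in unitSquare, G p = 0 := by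
    refine le_antisymm ?_ (integral_nonneg hG0)
    have e1 : ∫ p in unitSquare, G p = (∫ p in unitSquare,
        (InformationTheory.klFun (C.density p) + InformationTheory.klFun (D.density p)) / 2) -
        ∫ p in unitSquare, InformationTheory.klFun ((C.density p + D.density p) / 2) :=
      integral_sub ((hCi.add hDi).div_const 2) hMi
    rw [e1, integral_div, integral_add hCi hDi]
    linarith
  have hG' := (integral_eq_zero_iff_of_nonneg hG0 hGi).1 hGint
  rw [hC.law_eq_withDensity, hD.law_eq_withDensity]
  refine withDensity_congr_ae ?_
  filter_upwards [hG'] with p hp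
  by_contra hne
  have hne' : C.density p ≠ D.density p := fun h => hne (by simp only [h])
  have := klFun_midpoint_lt (C.density_nonneg p) (D.density_nonneg p) hne'
  simp only [hG, Pi.zero_apply] at hp
  linarith

/-! ### From entropy to Spearman's rho for ordered copulas -/

lemma spearmanRho_eq_of_law_eq {C D : Copula} (h : C.law = D.law) :
    C.spearmanRho = D.spearmanRho := by
  simp only [spearmanRho, cdf, h]

lemma divergence_of_entropy {C D : Copula} (hC : C.IsAbsCont) (hD : D.IsAbsCont)
    (hbot : D.entropy ≠ ⊥) (hle : C.entropy ≤ D.entropy) :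
    D.divergence ≠ ⊤ ∧ D.divergence ≤ C.divergence := by
  rw [hD.entropy_eq] at hbot hle
  rw [hC.entropy_eq, EReal.neg_le_neg_iff] at hle
  refine ⟨fun h => hbot (by rw [h]; rfl), ?_⟩
  exact_mod_cast hle

/-- If `D` lies below `C`, monotonicity and nonnegativity of `ρ_s` suffice. If `D` lies above `C`,
so does the mixture, and neither has smaller divergence than `C`; as `D` has no larger one, the
equality case gives `C = D`. -/
theorem abs_spearmanRho_le_of_tp2 {C D : Copula} (hC : C.IsAbsCont) (hD : D.IsAbsCont)
    (hCtp : TP2Measure C.law) (hDtp : TP2Measure D.law)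
    (h : (∀ u v, C.cdf u v ≤ D.cdf u v) ∨ (∀ u v, D.cdf u v ≤ C.cdf u v))
    (hbot : D.entropy ≠ ⊥) (hle : C.entropy ≤ D.entropy) :
    |D.spearmanRho| ≤ |C.spearmanRho| := by
  obtain ⟨htop, hdiv⟩ := divergence_of_entropy hC hD hbot hle
  rcases h with h | h
  · have h1 := divergence_le_of_tp2 hC hD hCtp h
    have h2 := divergence_le_of_tp2 hC (hC.mix hD) hCtp fun u v => by
      rw [cdf_mix]; linarith [h u v]
    rw [spearmanRho_eq_of_law_eq
      (law_eq_of_divergence_le_mix hC hD h2 hdiv (ne_top_of_le_ne_top htop h1))]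
  · rw [abs_of_nonneg (spearmanRho_nonneg fun u hu v hv => mul_le_cdf_of_tp2 hCtp hu hv),
      abs_of_nonneg (spearmanRho_nonneg fun u hu v hv => mul_le_cdf_of_tp2 hDtp hu hv)]
    exact spearmanRho_mono fun u _ v _ => h u v

theorem abs_spearmanRho_le_of_rr2 {C D : Copula} (hC : C.IsAbsCont) (hD : D.IsAbsCont)
    (hCrr : RR2Measure C.law) (hDrr : RR2Measure D.law)
    (h : (∀ u v, C.cdf u v ≤ D.cdf u v) ∨ (∀ u v, D.cdf u v ≤ C.cdf u v))
    (hbot : D.entropy ≠ ⊥) (hle : C.entropy ≤ D.entropy) :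
    |D.spearmanRho| ≤ |C.spearmanRho| := by
  obtain ⟨htop, hdiv⟩ := divergence_of_entropy hC hD hbot hle
  rcases h with h | h
  · rw [abs_of_nonpos (spearmanRho_nonpos fun u hu v hv => cdf_le_mul_of_rr2 hCrr hu hv),
      abs_of_nonpos (spearmanRho_nonpos fun u hu v hv => cdf_le_mul_of_rr2 hDrr hu hv)]
    exact neg_le_neg (spearmanRho_mono fun u _ v _ => h u v)
  · have h1 := divergence_le_of_rr2 hC hD hCrr h
    have h2 := divergence_le_of_rr2 hC (hC.mix hD) hCrr fun u v => by
      rw [cdf_mix]; linarith [h u v]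
    rw [spearmanRho_eq_of_law_eq
      (law_eq_of_divergence_le_mix hC hD h2 hdiv (ne_top_of_le_ne_top htop h1))]

end Copula

/-! ### Families satisfying condition (a) -/

lemma SMIncreasingOn.comparable {C : ℝ → Copula} {Θ : Set ℝ} (h : SMIncreasingOn C Θ) {θ₁ θ₂ : ℝ}
    (h₁ : θ₁ ∈ Θ) (h₂ : θ₂ ∈ Θ) : (∀ u v, (C θ₁).cdf u v ≤ (C θ₂).cdf u v) ∨
      (∀ u v, (C θ₂).cdf u v ≤ (C θ₁).cdf u v) :=
  (le_total θ₁ θ₂).imp (fun hle => (h _ h₁ _ h₂ hle).cdf_le) (fun hle => (h _ h₂ _ h₁ hle).cdf_le)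

lemma SMDecreasingOn.comparable {C : ℝ → Copula} {Θ : Set ℝ} (h : SMDecreasingOn C Θ) {θ₁ θ₂ : ℝ}
    (h₁ : θ₁ ∈ Θ) (h₂ : θ₂ ∈ Θ) : (∀ u v, (C θ₁).cdf u v ≤ (C θ₂).cdf u v) ∨
      (∀ u v, (C θ₂).cdf u v ≤ (C θ₁).cdf u v) :=
  (le_total θ₂ θ₁).imp (fun hle => (h _ h₂ _ h₁ hle).cdf_le) (fun hle => (h _ h₁ _ h₂ hle).cdf_le)

theorem spearmanMonotone_of_conditionA {C : ℝ → Copula} {Θ : Set ℝ}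
    (hC : ∀ θ ∈ Θ, (C θ).IsAbsCont) (h : ConditionA C Θ) : SpearmanMonotoneInEntropy C Θ := by
  intro θ₁ h₁ θ₂ h₂ hbot hle
  have hcmp : (∀ u v, (C θ₁).cdf u v ≤ (C θ₂).cdf u v) ∨
      (∀ u v, (C θ₂).cdf u v ≤ (C θ₁).cdf u v) :=
    h.2.elim (fun h => h.comparable h₁ h₂) (fun h => h.comparable h₁ h₂)
  rcases h.1 with htp | hrr
  · exact Copula.abs_spearmanRho_le_of_tp2 (hC _ h₁) (hC _ h₂) (htp _ h₁).tp2Measure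
      (htp _ h₂).tp2Measure hcmp hbot hle
  · exact Copula.abs_spearmanRho_le_of_rr2 (hC _ h₁) (hC _ h₂) (hrr _ h₁).rr2Measure
      (hrr _ h₂).rr2Measure hcmp hbot hle

/-! ### Log-convexity of completely monotone functions -/

lemma le_of_hasDerivAt_nonpos {f f' : ℝ → ℝ} {a b : ℝ} (hab : a ≤ b)
    (hf : ∀ t ∈ Icc a b, HasDerivAt f (f' t) t) (hf' : ∀ t ∈ Icc a b, f' t ≤ 0) : f b ≤ f a := by
  refine antitoneOn_of_deriv_nonpos (convex_Icc a b)
    (fun t ht => (hf t ht).continuousAt.continuousWithinAt)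
    (fun t ht => (hf t (interior_subset ht)).differentiableAt.differentiableWithinAt)
    (fun t ht => ?_) (left_mem_Icc.2 hab) (right_mem_Icc.2 hab) hab
  rw [(hf t (interior_subset ht)).deriv]
  exact hf' t (interior_subset ht)

/-- The signed derivatives `G n = (-1)^n f^{(n)}` of a completely monotone function on `(0,∞)`. -/
structure SignedDerivs (G : ℕ → ℝ → ℝ) : Prop where
  hasDerivAt : ∀ n t, 0 < t → HasDerivAt (G n) (-G (n + 1) t) t
  nonneg : ∀ n t, 0 < t → 0 ≤ G n t

namespace SignedDerivs

variable {G : ℕ → ℝ → ℝ}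

lemma shift (h : SignedDerivs G) (k : ℕ) : SignedDerivs fun n => G (n + k) where
  hasDerivAt n t ht := by
    have := h.hasDerivAt (n + k) t ht
    rwa [show n + k + 1 = n + 1 + k by ring] at this
  nonneg n t ht := h.nonneg (n + k) t ht

lemma antitone (h : SignedDerivs G) (n : ℕ) {s t : ℝ} (hs : 0 < s) (hst : s ≤ t) :
    G n t ≤ G n s :=
  le_of_hasDerivAt_nonpos hst (fun x hx => h.hasDerivAt n x (hs.trans_le hx.1))
    fun x hx => neg_nonpos.2 (h.nonneg _ x (hs.trans_le hx.1))

/-- A nonnegative function cannot decrease at a rate as slow as `1 / (A + k t)`. -/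
lemma not_forall_inv_le {g g' : ℝ → ℝ} {a A k : ℝ} (hA : 0 < A) (hk : 0 < k)
    (hg : ∀ t, a ≤ t → HasDerivAt g (-g' t) t) (hg0 : ∀ t, a ≤ t → 0 ≤ g t)
    (h : ∀ t, a ≤ t → 1 / (A + k * (t - a)) ≤ g' t) : False := by
  -- Integrating the lower bound on `g'` gives `g x ≤ g a + (log A - log (A + k (x - a))) / k`. The
  -- point `x` is chosen so that the last logarithm exceeds `k * g a + log A`, which makes `g x`
  -- negative.
  set x := a + Real.exp (k * (g a + 1 / k * Real.log A)) / k with hx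
  have hax : a ≤ x := le_add_of_nonneg_right (by positivity)
  have hpos : ∀ t, a ≤ t → 0 < A + k * (t - a) := fun t ht => by
    have := mul_nonneg hk.le (sub_nonneg.2 ht); linarith
  have hw := le_of_hasDerivAt_nonpos
    (f := fun t => g t + 1 / k * Real.log (A + k * (t - a)))
    (f' := fun t => -g' t + 1 / k * (k / (A + k * (t - a)))) hax
    (fun t ht => by
      refine (hg t ht.1).add (HasDerivAt.const_mul _ (HasDerivAt.log ?_ (hpos t ht.1).ne'))
      simpa using (((hasDerivAt_id t).sub_const a).const_mul k).const_add A)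
    (fun t ht => by
      have h1 := h t ht.1
      have h2 : 1 / k * (k / (A + k * (t - a))) = 1 / (A + k * (t - a)) := by field_simp
      rw [h2]; linarith)
  have h0 := hg0 x hax
  simp only [sub_self, mul_zero, add_zero] at hw
  have h3 : A + k * (x - a) = A + Real.exp (k * (g a + 1 / k * Real.log A)) := by
    rw [hx]; field_simp; ring
  rw [h3] at hw
  have h4 : k * (g a + 1 / k * Real.log A) <
      Real.log (A + Real.exp (k * (g a + 1 / k * Real.log A))) := by
    conv_lhs => rw [← Real.log_exp (k * (g a + 1 / k * Real.log A))]
    exact Real.log_lt_log (Real.exp_pos _) (by linarith)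
  have h5 : g a + 1 / k * Real.log A <
      1 / k * Real.log (A + Real.exp (k * (g a + 1 / k * Real.log A))) := by
    have := mul_lt_mul_of_pos_left h4 (one_div_pos.2 hk)
    rwa [← mul_assoc (1 / k) k, one_div_mul_cancel hk.ne', one_mul] at this
  linarith

/-- Write `f = G 0`, so `f' = -G 1` and `f'' = G 2`. The constant `m / (m + 1)` is improved by
induction: the inequality for `-f'` makes `f - l f'² / f''` nonincreasing with the next constant
`l`. If this function were negative somewhere, it would stay below some `-c`, so that `f'' / f'² ≤ l
/ c`. Then `-f'` would decay no faster than `1 / t`, and `f` could not stay nonnegative. -/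
lemma mul_sq_le_of_pos (m : ℕ) : ∀ G : ℕ → ℝ → ℝ, SignedDerivs G → (∀ n t, 0 < t → 0 < G n t) →
    ∀ t, 0 < t → (m : ℝ) / (m + 1) * G 1 t ^ 2 ≤ G 0 t * G 2 t := by
  induction m with
  | zero =>
    intro G h hpos t ht
    have := mul_pos (hpos 0 t ht) (hpos 2 t ht)
    simpa using this.le
  | succ m ih =>
    intro G h hpos x₀ hx₀
    have ih' : ∀ t, 0 < t → (m : ℝ) / (m + 1) * G 2 t ^ 2 ≤ G 1 t * G 3 t :=
      ih _ (h.shift 1) fun n t ht => hpos _ t ht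
    push_cast
    -- This value solves `2 l - l m / (m + 1) = 1`, so that the remaining terms in the derivative
    -- below cancel.
    set l : ℝ := ((m : ℝ) + 1) / (m + 1 + 1) with hl
    have hl0 : 0 < l := by positivity
    by_contra hlt
    push Not at hlt
    set c := l * G 1 x₀ ^ 2 / G 2 x₀ - G 0 x₀ with hc
    have hc0 : 0 < c := by
      rw [hc, sub_pos, lt_div_iff₀ (hpos 2 _ hx₀)]; exact hlt
    -- `G 0 - l (G 1)² / G 2` decreases, hence remains negative
    have hdec : ∀ x, x₀ ≤ x → c ≤ l * G 1 x ^ 2 / G 2 x := by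
      intro x hx
      have := le_of_hasDerivAt_nonpos (f := fun t => G 0 t - l * G 1 t ^ 2 / G 2 t)
        (f' := fun t => -G 1 t - (l * (2 * G 1 t * (-G 2 t)) * G 2 t -
          l * G 1 t ^ 2 * (-G 3 t)) / G 2 t ^ 2) hx
        (fun t ht => by
          have ht0 := hx₀.trans_le ht.1
          have h1 := (h.hasDerivAt 1 t ht0).pow 2
          simp only [Nat.cast_ofNat, Nat.add_one_sub_one, pow_one] at h1
          exact (h.hasDerivAt 0 t ht0).sub ((h1.const_mul l).div (h.hasDerivAt 2 t ht0)
            (hpos 2 t ht0).ne'))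
        (fun t ht => by
          have ht0 := hx₀.trans_le ht.1
          have h1 := hpos 1 t ht0
          have h2 := hpos 2 t ht0
          have h3 := ih' t ht0
          have key : l * ((m : ℝ) + 1 + 1) / (m + 1) = 1 := by rw [hl]; field_simp
          have e : -G 1 t - (l * (2 * G 1 t * (-G 2 t)) * G 2 t -
              l * G 1 t ^ 2 * (-G 3 t)) / G 2 t ^ 2 =
              -(l * G 1 t / G 2 t ^ 2) * (G 1 t * G 3 t - (m : ℝ) / (m + 1) * G 2 t ^ 2) +
              G 1 t * (l * ((m : ℝ) + 1 + 1) / (m + 1) - 1) := by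
            field_simp
            ring
          rw [e, key, sub_self, mul_zero, add_zero, neg_mul]
          exact neg_nonpos.2 (mul_nonneg (by positivity) (sub_nonneg.2 h3)))
      have h0 := hpos 0 x (hx₀.trans_le hx)
      linarith
    -- The derivative of `1 / G 1` is `G 2 / (G 1)²`, which `hdec` bounds by `l / c`.
    set k := l / c with hk
    have hk0 : 0 < k := by positivity
    have hbound : ∀ x, x₀ ≤ x → 1 / (1 / G 1 x₀ + k * (x - x₀)) ≤ G 1 x := by
      intro x hx
      have hx0 := hx₀.trans_le hx
      have := le_of_hasDerivAt_nonpos (f := fun t => (G 1 t)⁻¹ - k * (t - x₀))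
        (f' := fun t => -(-G 2 t) / G 1 t ^ 2 - k) hx
        (fun t ht => by
          have ht0 := hx₀.trans_le ht.1
          refine ((h.hasDerivAt 1 t ht0).inv (hpos 1 t ht0).ne').sub ?_
          simpa using ((hasDerivAt_id t).sub_const x₀).const_mul k)
        (fun t ht => by
          have ht0 := hx₀.trans_le ht.1
          have h1 := hpos 1 t ht0
          have h2 := hpos 2 t ht0
          have h3 := hdec t ht.1
          rw [le_div_iff₀ h2] at h3
          rw [neg_neg, sub_nonpos, hk, div_le_div_iff₀ (by positivity) hc0]
          linarith)
      simp only [sub_self, mul_zero, sub_zero] at this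
      rw [one_div, one_div]
      refine inv_le_of_inv_le₀ (hpos 1 x hx0) ?_
      linarith
    exact not_forall_inv_le (one_div_pos.2 (hpos 1 _ hx₀)) hk0
      (fun t ht => h.hasDerivAt 0 t (hx₀.trans_le ht)) (fun t ht => h.nonneg 0 t (hx₀.trans_le ht))
      hbound

lemma sq_le_of_pos (h : SignedDerivs G) (hpos : ∀ n t, 0 < t → 0 < G n t) {t : ℝ} (ht : 0 < t) :
    G 1 t ^ 2 ≤ G 0 t * G 2 t := by
  have := (tendsto_natCast_div_add_atTop (1 : ℝ)).mul_const (G 1 t ^ 2)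
  rw [one_mul] at this
  exact le_of_tendsto this (Eventually.of_forall fun m => mul_sq_le_of_pos m G h hpos t ht)

/-- Completely monotone functions are log-convex. -/
theorem sq_le (h : SignedDerivs G) {t : ℝ} (ht : 0 < t) : G 1 t ^ 2 ≤ G 0 t * G 2 t := by
  -- All signed derivatives of `exp (-t)` equal `exp (-t)`; adding a small multiple makes every `G
  -- n` strictly positive.
  have key : ∀ ε > 0, (G 1 t + ε * Real.exp (-t)) ^ 2 ≤
      (G 0 t + ε * Real.exp (-t)) * (G 2 t + ε * Real.exp (-t)) := by
    intro ε hε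
    have hpos : ∀ n s, 0 < s → 0 < G n s + ε * Real.exp (-s) := fun n s hs =>
      add_pos_of_nonneg_of_pos (h.nonneg n s hs) (by positivity)
    refine sq_le_of_pos (G := fun n s => G n s + ε * Real.exp (-s))
      ⟨fun n s hs => ?_, fun n s hs => (hpos n s hs).le⟩ hpos ht
    have h1 := ((hasDerivAt_neg s).exp).const_mul ε
    convert! (h.hasDerivAt n s hs).add h1 using 1
    ring
  have h1 : Tendsto (fun ε : ℝ => (G 1 t + ε * Real.exp (-t)) ^ 2) (𝓝[>] 0) (𝓝 (G 1 t ^ 2)) := by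
    refine tendsto_nhdsWithin_of_tendsto_nhds ?_
    have : Continuous (fun ε : ℝ => (G 1 t + ε * Real.exp (-t)) ^ 2) := by fun_prop
    simpa using this.tendsto 0
  have h2 : Tendsto (fun ε : ℝ => (G 0 t + ε * Real.exp (-t)) * (G 2 t + ε * Real.exp (-t)))
      (𝓝[>] 0) (𝓝 (G 0 t * G 2 t)) := by
    refine tendsto_nhdsWithin_of_tendsto_nhds ?_
    have : Continuous
      (fun ε : ℝ => (G 0 t + ε * Real.exp (-t)) * (G 2 t + ε * Real.exp (-t))) := by fun_prop
    simpa using this.tendsto 0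
  exact le_of_tendsto_of_tendsto h1 h2 (eventually_nhdsWithin_of_forall key)

lemma convexOn_log (h : SignedDerivs G) (hpos : ∀ t, 0 < t → 0 < G 0 t) :
    ConvexOn ℝ (Ioi 0) fun t => Real.log (G 0 t) := by
  have hd : ∀ t, 0 < t → HasDerivAt (fun t => Real.log (G 0 t)) (-G 1 t / G 0 t) t := fun t ht =>
    (h.hasDerivAt 0 t ht).log (hpos t ht).ne'
  refine convexOn_of_hasDerivWithinAt2_nonneg (convex_Ioi 0)
    (f' := fun t => -G 1 t / G 0 t)
    (f'' := fun t => (-(-G 2 t) * G 0 t - -G 1 t * -G 1 t) / G 0 t ^ 2)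
    (fun t ht => (hd t ht).continuousAt.continuousWithinAt) ?_ ?_ ?_
  · intro t ht
    rw [interior_Ioi] at ht
    exact (hd t ht).hasDerivWithinAt
  · intro t ht
    rw [interior_Ioi] at ht
    exact ((h.hasDerivAt 1 t ht).neg.div (h.hasDerivAt 0 t ht) (hpos t ht).ne').hasDerivWithinAt
  · intro t ht
    rw [interior_Ioi] at ht
    have := h.sq_le ht
    exact div_nonneg (by linarith) (by positivity)

lemma _root_.ConvexOn.add_le_add_of_mem {f : ℝ → ℝ} {s : Set ℝ} (hf : ConvexOn ℝ s f) {a d p q : ℝ}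
    (ha : a ∈ s) (hd : d ∈ s) (had : a < d) (hap : a ≤ p) (hpd : p ≤ d) (hpq : p + q = a + d) :
    f p + f q ≤ f a + f d := by
  set l := (p - a) / (d - a) with hl
  have hda : 0 < d - a := sub_pos.2 had
  have hl0 : 0 ≤ l := div_nonneg (sub_nonneg.2 hap) hda.le
  have hl1 : l ≤ 1 := (div_le_one hda).2 (by linarith)
  have hlm : l * (d - a) = p - a := div_mul_cancel₀ _ hda.ne'
  have h1 := hf.2 ha hd (sub_nonneg.2 hl1) hl0 (by ring)
  have h2 := hf.2 ha hd hl0 (sub_nonneg.2 hl1) (by ring)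
  simp only [smul_eq_mul] at h1 h2
  rw [show (1 - l) * a + l * d = p by linarith] at h1
  rw [show l * a + (1 - l) * d = q by linarith] at h2
  linarith

/-- The points `x + y'` and `x' + y` lie between `x + y` and `x' + y'` and have the same sum, so
log-convexity of `G 0` makes `(x, y) ↦ G 0 (x + y)` totally positive. -/
lemma mul_le_mul_of_lt (h : SignedDerivs G) (hpos : ∀ t, 0 < t → 0 < G 0 t) {x x' y y' : ℝ}
    (hx : 0 < x) (hy : 0 < y) (hxx : x < x') (hyy : y < y') :
    G 0 (x + y') * G 0 (x' + y) ≤ G 0 (x + y) * G 0 (x' + y') := by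
  have h1 := hpos (x + y') (by linarith)
  have h2 := hpos (x' + y) (by linarith)
  have h3 := hpos (x + y) (by linarith)
  have h4 := hpos (x' + y') (by linarith)
  rw [← Real.log_le_log_iff (mul_pos h1 h2) (mul_pos h3 h4), Real.log_mul h1.ne' h2.ne',
    Real.log_mul h3.ne' h4.ne']
  exact (h.convexOn_log hpos).add_le_add_of_mem (mem_Ioi.2 (by linarith)) (mem_Ioi.2 (by linarith))
    (by linarith) (by linarith) (by linarith) (by ring)

end SignedDerivs

/-! ### Archimedean copulas with completely monotone generators -/

namespace CompletelyMonotone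

variable {φ : ℝ → ℝ}

lemma signedDerivs (h : CompletelyMonotone φ) :
    SignedDerivs fun n t => (-1) ^ n * iteratedDeriv n φ t where
  nonneg n t ht := h.alternating n t ht
  hasDerivAt n t ht := by
    have h1 : DifferentiableOn ℝ (iteratedDeriv n φ) (Ioi 0) :=
      (h.contDiffOn.differentiableOn_iteratedDerivWithin (m := n) (by exact_mod_cast WithTop.coe_lt_top _)
        isOpen_Ioi.uniqueDiffOn).congr fun x hx =>
          (iteratedDerivWithin_of_isOpen isOpen_Ioi hx).symm
    have h2 := ((h1 t ht).differentiableAt (Ioi_mem_nhds ht)).hasDerivAt.const_mul ((-1 : ℝ) ^ n)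
    rw [← iteratedDeriv_succ] at h2
    convert! h2 using 1
    ring

lemma hasDerivAt (h : CompletelyMonotone φ) {t : ℝ} (ht : 0 < t) :
    HasDerivAt φ (-((-1) ^ 1 * iteratedDeriv 1 φ t)) t := by
  have := h.signedDerivs.hasDerivAt 0 t ht
  simpa using this

lemma antitoneOn (h : CompletelyMonotone φ) : AntitoneOn φ (Ici 0) := by
  refine antitoneOn_of_deriv_nonpos (convex_Ici 0) h.continuousOn ?_ ?_
  · intro t ht
    rw [interior_Ici] at ht
    exact (h.hasDerivAt ht).differentiableAt.differentiableWithinAt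
  · intro t ht
    rw [interior_Ici] at ht
    rw [(h.hasDerivAt ht).deriv]
    exact neg_nonpos.2 (h.alternating 1 t ht)

lemma strictAntiOn (h : CompletelyMonotone φ) (hc : StrictConvexOn ℝ (Ici 0) φ) :
    StrictAntiOn φ (Ici 0) := by
  intro s hs t ht hst
  refine lt_of_le_of_ne (h.antitoneOn hs ht hst.le) fun heq => ?_
  have h1 := hc.2 hs ht hst.ne (by norm_num : (0 : ℝ) < 1 / 2) (by norm_num : (0 : ℝ) < 1 / 2)
    (by norm_num)
  simp only [smul_eq_mul, heq] at h1
  have hs0 : 0 ≤ s := hs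
  have h2 := h.antitoneOn (mem_Ici.2 (by linarith : (0 : ℝ) ≤ 1 / 2 * s + 1 / 2 * t)) ht
    (by linarith)
  linarith

/-- The second derivative is nonnegative and antitone, so a zero would persist to the right. There
`φ` would be affine, against strict convexity. -/
lemma second_deriv_pos (h : CompletelyMonotone φ) (hc : StrictConvexOn ℝ (Ici 0) φ) {t : ℝ}
    (ht : 0 < t) : 0 < (-1) ^ 2 * iteratedDeriv 2 φ t := by
  refine lt_of_le_of_ne (h.alternating 2 t ht) fun h0 => ?_
  set G : ℕ → ℝ → ℝ := fun n t => (-1) ^ n * iteratedDeriv n φ t with hG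
  have hGs : SignedDerivs G := h.signedDerivs
  have h2 : ∀ s, t ≤ s → G 2 s = 0 := fun s hs =>
    le_antisymm ((hGs.antitone 2 ht hs).trans h0.symm.le) (hGs.nonneg 2 s (ht.trans_le hs))
  have h1 : ∀ s, t ≤ s → G 1 s = G 1 t := by
    intro s hs
    refine le_antisymm (hGs.antitone 1 ht hs) ?_
    have := le_of_hasDerivAt_nonpos (f := fun s => -G 1 s) (f' := fun s => -(-G 2 s)) hs
      (fun x hx => (hGs.hasDerivAt 1 x (ht.trans_le hx.1)).neg)
      (fun x hx => by rw [h2 x hx.1]; simp)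
    simpa using this
  have hlin : ∀ s, t ≤ s → φ s = φ t - G 1 t * (s - t) := by
    intro s hs
    have hd : ∀ x ∈ Icc t s, HasDerivAt (fun x => φ x + G 1 t * (x - t)) (-G 1 x + G 1 t) x := by
      intro x hx
      refine (h.hasDerivAt (ht.trans_le hx.1)).add ?_
      simpa using ((hasDerivAt_id x).sub_const t).const_mul (G 1 t)
    have e1 := le_of_hasDerivAt_nonpos hs hd fun x hx => by rw [h1 x hx.1]; simp
    have e2 := le_of_hasDerivAt_nonpos hs (fun x hx => (hd x hx).neg)
      fun x hx => by rw [h1 x hx.1]; simp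
    simp only [sub_self, mul_zero, add_zero, Pi.neg_apply] at e1 e2
    linarith
  have := hc.2 (mem_Ici.2 ht.le) (mem_Ici.2 (by linarith : (0 : ℝ) ≤ t + 2)) (by linarith)
    (by norm_num : (0 : ℝ) < 1 / 2) (by norm_num : (0 : ℝ) < 1 / 2) (by norm_num)
  simp only [smul_eq_mul] at this
  rw [hlin (t + 2) (by linarith), hlin _ (by linarith)] at this
  linarith

/-- As `-φ'` is antitone, `-φ'(t) ≤ φ(t - 1) - φ(t)`. -/
lemma tendsto_deriv (h : CompletelyMonotone φ) (h0 : Tendsto φ atTop (𝓝 0)) :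
    Tendsto (fun t => (-1) ^ 1 * iteratedDeriv 1 φ t) atTop (𝓝 0) := by
  set G : ℕ → ℝ → ℝ := fun n t => (-1) ^ n * iteratedDeriv n φ t with hG
  have hGs : SignedDerivs G := h.signedDerivs
  have hlim : Tendsto (fun t => φ (t - 1) - φ t) atTop (𝓝 0) := by
    have := (h0.comp (tendsto_atTop_add_const_right atTop (-1 : ℝ) tendsto_id)).sub h0
    simpa [sub_eq_add_neg, Function.comp_def] using this
  refine squeeze_zero' ?_ ?_ hlim
  · filter_upwards [eventually_gt_atTop 0] with t ht using hGs.nonneg 1 t ht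
  · filter_upwards [eventually_gt_atTop 1] with t ht
    have := le_of_hasDerivAt_nonpos (f := fun x => φ x + G 1 t * x)
      (f' := fun x => -G 1 x + G 1 t) (a := t - 1) (b := t) (by linarith)
      (fun x hx => by
        refine (h.hasDerivAt (by linarith [hx.1])).add ?_
        simpa using (hasDerivAt_id x).const_mul (G 1 t))
      (fun x hx => by
        have := hGs.antitone 1 (by linarith [hx.1] : 0 < x) hx.2
        linarith)
    change G 1 t ≤ _
    linarith

end CompletelyMonotone

/-! ### The quadrant measure of a generator -/

lemma lintegral_Ioi_ofReal_of_hasDerivAt {g k : ℝ → ℝ} {a : ℝ}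
    (hcont : ContinuousWithinAt g (Ici a) a) (hd : ∀ x ∈ Ioi a, HasDerivAt g (-k x) x)
    (hk : ∀ x ∈ Ioi a, 0 ≤ k x) (hg : Tendsto g atTop (𝓝 0)) :
    ∫⁻ x in Ioi a, ENNReal.ofReal (k x) = ENNReal.ofReal (g a) := by
  have hd' : ∀ x ∈ Ioi a, HasDerivAt (fun x => -g x) (k x) x := fun x hx => by
    have := (hd x hx).fun_neg
    rwa [neg_neg] at this
  have hg' : Tendsto (fun x => -g x) atTop (𝓝 0) := by simpa using hg.neg
  rw [← ofReal_integral_eq_lintegral_ofReal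
    (integrableOn_Ioi_deriv_of_nonneg hcont.neg hd' hk hg')
    ((ae_restrict_iff' measurableSet_Ioi).2 (ae_of_all _ hk)),
    integral_Ioi_of_hasDerivAt_of_nonneg hcont.neg hd' hk hg']
  simp

/-- The measure on the open quadrant with density `φ''(x + y)`. -/
noncomputable def generatorMeasure (φ : ℝ → ℝ) : Measure (ℝ × ℝ) :=
  (volume.restrict (Ioi (0 : ℝ) ×ˢ Ioi (0 : ℝ))).withDensity
    fun p => ENNReal.ofReal ((-1) ^ 2 * iteratedDeriv 2 φ (p.1 + p.2))

lemma measurable_iteratedDeriv_two (φ : ℝ → ℝ) : Measurable (iteratedDeriv 2 φ) := by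
  rw [iteratedDeriv_succ]
  exact measurable_deriv _

lemma measurable_generatorDensity (φ : ℝ → ℝ) : Measurable fun p : ℝ × ℝ =>
    ENNReal.ofReal ((-1) ^ 2 * iteratedDeriv 2 φ (p.1 + p.2)) :=
  (((measurable_iteratedDeriv_two φ).comp (measurable_fst.add measurable_snd)).const_mul
    _).ennreal_ofReal

lemma tp2Measure_generatorMeasure {φ : ℝ → ℝ} (h : CompletelyMonotone φ)
    (hc : StrictConvexOn ℝ (Ici 0) φ) : TP2Measure (generatorMeasure φ) := by
  refine tp2Measure_withDensity (measurable_generatorDensity φ) measurableSet_Ioi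
    measurableSet_Ioi fun x hx x' hx' y hy y' hy' hxx hyy => ?_
  have hpos := fun t (ht : 0 < t) => h.second_deriv_pos hc ht
  have key := (h.signedDerivs.shift 2).mul_le_mul_of_lt (fun t ht => hpos t ht) hx hy hxx hyy
  have hx : 0 < x := hx
  have hy : 0 < y := hy
  rw [← ENNReal.ofReal_mul (hpos _ (by linarith)).le, ← ENNReal.ofReal_mul (hpos _ (by linarith)).le]
  exact ENNReal.ofReal_le_ofReal key

/-- Two integrations of `φ''(s + t)`, with vanishing boundary terms at infinity. Prescribing the
sets only up to null sets of the half line covers both preimages under the generator and the whole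
line. -/
lemma generatorMeasure_apply {φ : ℝ → ℝ} (h : CompletelyMonotone φ)
    (h0 : Tendsto φ atTop (𝓝 0)) {x y : ℝ} (hx : 0 ≤ x) (hy : 0 ≤ y) {I J : Set ℝ}
    (hI : MeasurableSet I) (hJ : MeasurableSet J)
    (hIx : (I ∩ Ioi 0 : Set ℝ) =ᵐ[volume] Ioi x) (hJy : (J ∩ Ioi 0 : Set ℝ) =ᵐ[volume] Ioi y) :
    generatorMeasure φ (I ×ˢ J) = ENNReal.ofReal (φ (x + y)) := by
  have hGs := h.signedDerivs
  rw [generatorMeasure, withDensity_restrict_prod_apply (measurable_generatorDensity φ) hI hJ,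
    setLIntegral_congr hIx]
  simp only [setLIntegral_congr hJy]
  have inner : ∀ s ∈ Ioi x, ∫⁻ t in Ioi y, ENNReal.ofReal ((-1) ^ 2 * iteratedDeriv 2 φ (s + t)) =
      ENNReal.ofReal ((-1) ^ 1 * iteratedDeriv 1 φ (s + y)) := by
    intro s hs
    have hs0 : 0 < s := hx.trans_lt hs
    have hd : ∀ t, y ≤ t → HasDerivAt (fun t => (-1) ^ 1 * iteratedDeriv 1 φ (s + t))
        (-((-1) ^ 2 * iteratedDeriv 2 φ (s + t))) t := fun t ht =>
      (hGs.hasDerivAt 1 (s + t) (by linarith)).comp_const_add s t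
    refine lintegral_Ioi_ofReal_of_hasDerivAt (hd y le_rfl).continuousAt.continuousWithinAt
      (fun t ht => hd t (le_of_lt ht)) (fun t ht => ?_) ?_
    · have : y < t := ht
      exact h.alternating 2 (s + t) (by linarith)
    · exact (h.tendsto_deriv h0).comp (tendsto_atTop_add_const_left atTop s tendsto_id)
  rw [setLIntegral_congr_fun measurableSet_Ioi inner]
  refine lintegral_Ioi_ofReal_of_hasDerivAt (g := fun s => φ (s + y)) ?_ (fun s hs => ?_)
    (fun s hs => ?_) ?_
  · refine ContinuousWithinAt.comp (t := Ici 0)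
      (h.continuousOn (x + y) (mem_Ici.2 (add_nonneg hx hy))) (by fun_prop) fun s hs => ?_
    have : x ≤ s := hs
    exact mem_Ici.2 (by linarith)
  · have : x < s := hs
    exact (h.hasDerivAt (by linarith : 0 < s + y)).comp_add_const s y
  · have : x < s := hs
    exact h.alternating 1 (s + y) (by linarith)
  · exact h0.comp (tendsto_atTop_add_const_right atTop y tendsto_id)

namespace IsArchimedean

variable {C : Copula} {φ : ℝ → ℝ}

lemma exists_preimage (hφ : CompletelyMonotone φ) (h : IsArchimedean C φ) (h1 : φ 0 = 1) {u : ℝ}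
    (hu : u ∈ Ioo (0 : ℝ) 1) : ∃ x, 0 < x ∧ φ x = u ∧ Function.invFunOn φ (Ici 0) u = x := by
  have hex : ∃ x ∈ Ici (0 : ℝ), φ x = u := by
    obtain ⟨b, hb0, hb⟩ := ((eventually_ge_atTop (0 : ℝ)).and
      (h.tendsto_zero.eventually_lt_const hu.1)).exists
    have := intermediate_value_Icc' hb0
      (hφ.continuousOn.mono (Icc_subset_Ici_self : Icc 0 b ⊆ Ici (0 : ℝ)))
    obtain ⟨x, hx, hxu⟩ := this ⟨hb.le, by rw [h1]; exact hu.2.le⟩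
    exact ⟨x, hx.1, hxu⟩
  have hmem := Function.invFunOn_mem hex
  have heq := Function.invFunOn_eq hex
  refine ⟨_, lt_of_le_of_ne hmem fun h0 => ?_, heq, rfl⟩
  rw [← h0, h1] at heq
  exact hu.2.ne heq.symm

lemma preimage_Iic_ae_eq (hφ : CompletelyMonotone φ) (h : IsArchimedean C φ) {x : ℝ} (hx : 0 < x) :
    ((fun t => φ (max t 0)) ⁻¹' Iic (φ x) ∩ Ioi 0 : Set ℝ) =ᵐ[volume] Ioi x := by
  have : ((fun t => φ (max t 0)) ⁻¹' Iic (φ x) ∩ Ioi 0 : Set ℝ) = Ici x := by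
    ext t
    simp only [mem_inter_iff, mem_preimage, mem_Iic, mem_Ioi, mem_Ici]
    constructor
    · rintro ⟨h2, h3⟩
      rw [max_eq_left h3.le] at h2
      exact ((hφ.strictAntiOn h.strictConvex).le_iff_ge (mem_Ici.2 h3.le) (mem_Ici.2 hx.le)).1 h2
    · intro h2
      have h3 := hx.trans_le h2
      rw [max_eq_left h3.le]
      exact ⟨hφ.antitoneOn (mem_Ici.2 hx.le) (mem_Ici.2 h3.le) h2, h3⟩
  rw [this]
  exact Ioi_ae_eq_Ici.symm

/-- An Archimedean copula with a completely monotone generator is totally positive. -/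
theorem tp2Measure (hφ : CompletelyMonotone φ) (h : IsArchimedean C φ) (h1 : φ 0 = 1) :
    TP2Measure C.law := by
  -- Nothing is known about `φ` on negative arguments. The truncation makes it continuous on the
  -- line and does not matter for `generatorMeasure`, which lives on the open quadrant.
  set f : ℝ → ℝ := fun t => φ (max t 0) with hf
  have hfm : Measurable f := by
    refine Continuous.measurable ?_
    exact hφ.continuousOn.comp_continuous (by fun_prop) fun t => le_max_right t 0
  have hff : Measurable (Prod.map f f) := hfm.prodMap hfm
  have happly : ∀ {I J : Set ℝ}, MeasurableSet I → MeasurableSet J →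
      ((generatorMeasure φ).map (Prod.map f f)) (I ×ˢ J) =
        generatorMeasure φ ((f ⁻¹' I) ×ˢ (f ⁻¹' J)) := fun hI hJ => by
    rw [Measure.map_apply hff (hI.prod hJ)]
    rfl
  have huniv : (univ ∩ Ioi 0 : Set ℝ) =ᵐ[volume] Ioi 0 := by rw [univ_inter]; exact ae_eq_rfl
  have hprob : IsProbabilityMeasure ((generatorMeasure φ).map (Prod.map f f)) := by
    constructor
    rw [← univ_prod_univ, happly MeasurableSet.univ MeasurableSet.univ, preimage_univ,
      generatorMeasure_apply hφ h.tendsto_zero le_rfl le_rfl MeasurableSet.univ MeasurableSet.univ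
        huniv huniv]
    simp [h1]
  let D : Copula :=
    { law := (generatorMeasure φ).map (Prod.map f f)
      fst_uniform := by
        have := Measure.isProbabilityMeasure_map (μ := (generatorMeasure φ).map (Prod.map f f))
          measurable_fst.aemeasurable
        refine measure_eq_uniform_of_Iic fun u hu => ?_
        obtain ⟨x, hx, rfl, -⟩ := exists_preimage hφ h h1 hu
        rw [Measure.map_apply measurable_fst measurableSet_Iic, ← Set.prod_univ,
          happly measurableSet_Iic MeasurableSet.univ, preimage_univ,
          generatorMeasure_apply hφ h.tendsto_zero hx.le le_rfl (hfm measurableSet_Iic)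
            MeasurableSet.univ (preimage_Iic_ae_eq hφ h hx) huniv, add_zero]
      snd_uniform := by
        have := Measure.isProbabilityMeasure_map (μ := (generatorMeasure φ).map (Prod.map f f))
          measurable_snd.aemeasurable
        refine measure_eq_uniform_of_Iic fun u hu => ?_
        obtain ⟨x, hx, rfl, -⟩ := exists_preimage hφ h h1 hu
        rw [Measure.map_apply measurable_snd measurableSet_Iic, ← Set.univ_prod,
          happly MeasurableSet.univ measurableSet_Iic, preimage_univ,
          generatorMeasure_apply hφ h.tendsto_zero le_rfl hx.le MeasurableSet.univ
            (hfm measurableSet_Iic) huniv (preimage_Iic_ae_eq hφ h hx), zero_add] }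
  have hlaw : C.law = D.law := by
    refine Copula.law_eq_of_cdf_Ioo fun u hu v hv => ?_
    rw [h.cdf_eq u (Ioo_subset_Ioc_self hu) v (Ioo_subset_Ioc_self hv)]
    obtain ⟨x, hx, rfl, hxinv⟩ := exists_preimage hφ h h1 hu
    obtain ⟨y, hy, rfl, hyinv⟩ := exists_preimage hφ h h1 hv
    rw [hxinv, hyinv, Copula.cdf, Measure.real]
    change _ = (((generatorMeasure φ).map (Prod.map f f)) _).toReal
    rw [happly measurableSet_Iic measurableSet_Iic,
      generatorMeasure_apply hφ h.tendsto_zero hx.le hy.le (hfm measurableSet_Iic)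
        (hfm measurableSet_Iic) (preimage_Iic_ae_eq hφ h hx) (preimage_Iic_ae_eq hφ h hy),
      ENNReal.toReal_ofReal (h.nonneg _ (by positivity))]
  -- As `φ` is antitone, preimages of separated sets are separated in the opposite order. Both axes
  -- are reversed, so total positivity is preserved.
  have hsep : ∀ {I I' : Set ℝ}, (∀ x ∈ I, ∀ x' ∈ I', x < x') →
      ∀ t ∈ f ⁻¹' I', ∀ t' ∈ f ⁻¹' I, t < t' := by
    intro I I' hII t ht t' ht'
    by_contra hlt
    have := hφ.antitoneOn (mem_Ici.2 (le_max_right t' 0)) (mem_Ici.2 (le_max_right t 0))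
      (max_le_max_right 0 (not_lt.1 hlt))
    exact absurd (hII _ ht' _ ht) (not_lt.2 this)
  rw [hlaw]
  intro I I' J J' hI hI' hJ hJ' hII hJJ
  change ((generatorMeasure φ).map (Prod.map f f)) _ * ((generatorMeasure φ).map (Prod.map f f)) _ ≤
    ((generatorMeasure φ).map (Prod.map f f)) _ * ((generatorMeasure φ).map (Prod.map f f)) _
  rw [happly hI hJ', happly hI' hJ, happly hI hJ, happly hI' hJ', mul_comm,
    mul_comm (generatorMeasure φ ((f ⁻¹' I) ×ˢ (f ⁻¹' J)))]
  exact tp2Measure_generatorMeasure hφ h.strictConvex _ _ _ _ (hfm hI') (hfm hI) (hfm hJ')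
    (hfm hJ) (hsep hII) (hsep hJJ)

end IsArchimedean

/-! ### Families satisfying conditions (b) and (c) -/

theorem spearmanMonotone_of_conditionB {C : ℝ → Copula} {Θ : Set ℝ}
    (hC : ∀ θ ∈ Θ, (C θ).IsAbsCont) (h : ConditionB C Θ) : SpearmanMonotoneInEntropy C Θ := by
  intro θ₁ h₁ θ₂ h₂ hbot hle
  obtain ⟨⟨φ, hφ⟩, hinc⟩ := h
  obtain ⟨a₁, b₁, c₁⟩ := hφ θ₁ h₁
  obtain ⟨a₂, b₂, c₂⟩ := hφ θ₂ h₂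
  exact Copula.abs_spearmanRho_le_of_tp2 (hC _ h₁) (hC _ h₂) (a₁.tp2Measure b₁ c₁)
    (a₂.tp2Measure b₂ c₂) (hinc.comparable h₁ h₂) hbot hle

theorem spearmanMonotone_of_conditionC {C : ℝ → ℝ → Copula} {Θ Δ : Set ℝ}
    (hC : ∀ θ ∈ Θ, ∀ δ ∈ Δ, (C θ δ).IsAbsCont) (h : ConditionC C Θ Δ) {δ : ℝ} (hδ : δ ∈ Δ) :
    SpearmanMonotoneInEntropy (fun θ => C θ δ) Θ := by
  obtain ⟨⟨η, hη⟩, hinc⟩ := h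
  exact spearmanMonotone_of_conditionB (fun θ hθ => hC θ hθ δ hδ)
    ⟨⟨fun θ => η θ δ, fun θ hθ => hη θ hθ δ hδ⟩, hinc δ hδ⟩

/-! ### Distribution functions of absolutely continuous laws on the line -/

section ContinuousCdf

open ProbabilityTheory

variable {H : Measure ℝ} [IsProbabilityMeasure H]

lemma continuous_cdf (hH : H ≪ volume) : Continuous (cdf H) := by
  refine continuous_iff_continuousAt.2 fun x => ?_
  rw [(cdf H).mono.continuousAt_iff_leftLim_eq_rightLim, (cdf H).rightLim_eq]
  have h1 : H {x} = 0 := hH (by simp)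
  rw [← measure_cdf H, StieltjesFunction.measure_singleton, ENNReal.ofReal_eq_zero] at h1
  exact le_antisymm ((cdf H).mono.leftLim_le le_rfl) (by linarith)

/-- The distribution function may have flat pieces; `x` is the right end of the one through `q`. It
is finite because the value there is below one, and attained by continuity. -/
lemma exists_preimage_Iic_cdf (hH : H ≪ volume) {q : ℝ} (hq : cdf H q < 1) :
    ∃ x, cdf H x = cdf H q ∧ cdf H ⁻¹' Iic (cdf H q) = Iic x := by
  set S := cdf H ⁻¹' Iic (cdf H q) with hS
  have hqS : q ∈ S := mem_preimage.2 (mem_Iic.2 le_rfl)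
  have hbdd : BddAbove S := by
    obtain ⟨b, hb⟩ := ((tendsto_cdf_atTop H).eventually_const_lt hq).exists
    refine ⟨b, fun x hx => ?_⟩
    by_contra hlt
    have h1 : cdf H x ≤ cdf H q := hx
    linarith [(cdf H).mono (not_le.1 hlt).le]
  have hclosed : IsClosed S := isClosed_Iic.preimage (continuous_cdf hH)
  have hmem : sSup S ∈ S := hclosed.csSup_mem ⟨q, hqS⟩ hbdd
  refine ⟨sSup S, le_antisymm hmem ((cdf H).mono (le_csSup hbdd hqS)), ?_⟩
  ext x
  exact ⟨fun hx => le_csSup hbdd hx, fun hx => ((cdf H).mono hx).trans hmem⟩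

lemma exists_cdf_eq (hH : H ≪ volume) {u : ℝ} (hu : u ∈ Ioo (0 : ℝ) 1) :
    ∃ x, cdf H x = u ∧ cdf H ⁻¹' Iic u = Iic x := by
  obtain ⟨a, ha⟩ := ((tendsto_cdf_atBot H).eventually_lt_const hu.1).exists
  obtain ⟨b, hb⟩ := ((tendsto_cdf_atTop H).eventually_const_lt hu.2).exists
  obtain ⟨q, rfl⟩ := mem_range_of_exists_le_of_exists_ge (continuous_cdf hH) ⟨a, ha.le⟩ ⟨b, hb.le⟩
  exact exists_preimage_Iic_cdf hH hu.2

lemma map_cdf_eq_uniform (hH : H ≪ volume) : H.map (cdf H) = volume.restrict (Icc (0 : ℝ) 1) := by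
  have hm : Measurable (cdf H) := (cdf H).mono.measurable
  have := Measure.isProbabilityMeasure_map (μ := H) hm.aemeasurable
  refine measure_eq_uniform_of_Iic fun u hu => ?_
  obtain ⟨x, hx, hpre⟩ := exists_cdf_eq hH hu
  rw [Measure.map_apply hm measurableSet_Iic, hpre, ← ofReal_cdf, hx]

/-- The distribution function has a measurable left inverse almost everywhere. -/
lemma exists_leftInverse_cdf (hH : H ≪ volume) :
    ∃ Γ : ℝ → ℝ, Measurable Γ ∧ ∀ᵐ x ∂H, Γ (cdf H x) = x := by
  have hm : Measurable (cdf H) := (cdf H).mono.measurable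
  -- `T q` is the part of a flat piece to the right of `q`, hence null. Two points with the same
  -- value are separated by a rational, so off these countably many null sets the distribution
  -- function is injective, and an injective measurable map on a standard Borel space is a
  -- measurable embedding.
  set T : ℚ → Set ℝ := fun q => Ioi (q : ℝ) ∩ cdf H ⁻¹' Iic (cdf H q) with hT
  have hTm : ∀ q, MeasurableSet (T q) := fun q => measurableSet_Ioi.inter (hm measurableSet_Iic)
  have hT0 : ∀ q, H (T q) = 0 := by
    intro q
    rcases (cdf_le_one H q).lt_or_eq with h1 | h1
    · obtain ⟨x, hx, hpre⟩ := exists_preimage_Iic_cdf hH h1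
      have : T q = Ioc (q : ℝ) x := by rw [hT]; simp only [hpre, Ioi_inter_Iic]
      rw [this, ← measure_cdf H, StieltjesFunction.measure_Ioc, hx, sub_self, ENNReal.ofReal_zero]
    · refine measure_mono_null inter_subset_left ?_
      rw [← measure_cdf H, StieltjesFunction.measure_Ioi _ (tendsto_cdf_atTop H), h1, sub_self,
        ENNReal.ofReal_zero]
  set S : Set ℝ := (⋃ q, T q)ᶜ with hS
  have hSm : MeasurableSet S := (MeasurableSet.iUnion hTm).compl
  have hinj : ∀ x ∈ S, ∀ y ∈ S, x < y → cdf H x ≠ cdf H y := by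
    intro x _ y hy hxy heq
    obtain ⟨q, hq1, hq2⟩ := exists_rat_btwn hxy
    refine hy (mem_iUnion.2 ⟨q, hq2, ?_⟩)
    rw [mem_preimage, mem_Iic, ← heq]
    exact (cdf H).mono hq1.le
  have := hSm.standardBorel
  have hemb : MeasurableEmbedding (fun x : S => cdf H x) := by
    refine (hm.comp measurable_subtype_coe).measurableEmbedding fun x y hxy => Subtype.ext ?_
    rcases lt_trichotomy (x : ℝ) y with h | h | h
    · exact absurd hxy (hinj x x.2 y y.2 h)
    · exact h
    · exact absurd hxy.symm (hinj y y.2 x x.2 h)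
  obtain ⟨Γ, hΓ, hΓS⟩ := hemb.exists_measurable_extend measurable_subtype_coe fun _ => ⟨0⟩
  refine ⟨Γ, hΓ, ?_⟩
  have hSae : ∀ᵐ x ∂H, x ∈ S := by
    rw [hS]
    simp only [mem_compl_iff]
    exact measure_eq_zero_iff_ae_notMem.1 (measure_iUnion_null hT0)
  filter_upwards [hSae] with x hx
  exact congrFun hΓS ⟨x, hx⟩

end ContinuousCdf

/-! ### Elliptical laws as images of a radial law -/

/-- The rotation invariant law on the plane with density generator `g`. -/
noncomputable def radialLaw (g : ℝ → ℝ) : Measure (ℝ × ℝ) :=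
  volume.withDensity fun p => ENNReal.ofReal (g (p.1 ^ 2 + p.2 ^ 2))

/-- The linear map of the plane with matrix `[[a, b], [c, d]]`. -/
def planeMap (a b c d : ℝ) (p : ℝ × ℝ) : ℝ × ℝ := (a * p.1 + b * p.2, c * p.1 + d * p.2)

lemma measurable_planeMap (a b c d : ℝ) : Measurable (planeMap a b c d) := by
  unfold planeMap; fun_prop

lemma map_planeMap_volume {a b c d : ℝ} (h : a * d - b * c ≠ 0) :
    (volume : Measure (ℝ × ℝ)).map (planeMap a b c d) =
      ENNReal.ofReal |(a * d - b * c)⁻¹| • volume := by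
  set f := Matrix.toLin (Module.Basis.finTwoProd ℝ) (Module.Basis.finTwoProd ℝ) !![a, b; c, d]
    with hf
  have hdet : LinearMap.det f = a * d - b * c := by
    rw [hf, LinearMap.det_toLin, Matrix.det_fin_two_of]
  have hfun : (f : ℝ × ℝ → ℝ × ℝ) = planeMap a b c d := by
    funext p
    rw [hf, Matrix.toLin_finTwoProd_apply]
    rfl
  rw [← hfun, Measure.map_linearMap_addHaar_eq_smul_addHaar _ (by rw [hdet]; exact h), hdet]

lemma map_withDensity_comp {α β : Type*} [MeasurableSpace α] [MeasurableSpace β] {μ : Measure α}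
    {T : α → β} (hT : Measurable T) {f : β → ENNReal} (hf : Measurable f) :
    (μ.withDensity (f ∘ T)).map T = (μ.map T).withDensity f := by
  ext s hs
  rw [Measure.map_apply hT hs, withDensity_apply _ (hT hs), withDensity_apply _ hs,
    setLIntegral_map hs hf hT]
  rfl

section Radial

variable {g : ℝ → ℝ}

lemma measurable_radialDensity (hg : Measurable g) :
    Measurable fun p : ℝ × ℝ => ENNReal.ofReal (g (p.1 ^ 2 + p.2 ^ 2)) :=
  (hg.comp (by fun_prop)).ennreal_ofReal

lemma measurable_ellipticalDensity (hg : Measurable g) (m₁ m₂ s₁ s₂ r : ℝ) :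
    Measurable fun p => ENNReal.ofReal (ellipticalDensity g m₁ m₂ s₁ s₂ r p) := by
  unfold ellipticalDensity
  exact ((hg.comp (by fun_prop)).const_mul _).ennreal_ofReal

/-- Orthogonal maps preserve radial laws. -/
lemma map_planeMap_radialLaw (hg : Measurable g) {a b c d : ℝ} (h₁ : a ^ 2 + c ^ 2 = 1) (h₂ : b ^ 2 + d ^ 2 = 1)
    (h₃ : a * b + c * d = 0) : (radialLaw g).map (planeMap a b c d) = radialLaw g := by
  have hdet : (a * d - b * c) ^ 2 = 1 := by
    have : (a * d - b * c) ^ 2 = (a ^ 2 + c ^ 2) * (b ^ 2 + d ^ 2) - (a * b + c * d) ^ 2 := by ring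
    rw [this, h₁, h₂, h₃]; norm_num
  have hne : a * d - b * c ≠ 0 := fun h => by rw [h] at hdet; norm_num at hdet
  have habs : |(a * d - b * c)⁻¹| = 1 := by
    rcases mul_self_eq_one_iff.1 ((sq _).symm.trans hdet) with h | h <;> rw [h] <;> norm_num
  have hcomp : (fun p : ℝ × ℝ => ENNReal.ofReal (g (p.1 ^ 2 + p.2 ^ 2))) =
      (fun p : ℝ × ℝ => ENNReal.ofReal (g (p.1 ^ 2 + p.2 ^ 2))) ∘ planeMap a b c d := by
    funext p
    simp only [Function.comp_apply, planeMap]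
    congr 2
    linear_combination -p.1 ^ 2 * h₁ - p.2 ^ 2 * h₂ - 2 * p.1 * p.2 * h₃
  conv_lhs => rw [radialLaw, hcomp]
  rw [map_withDensity_comp (measurable_planeMap a b c d) (measurable_radialDensity hg),
    map_planeMap_volume hne, habs, ENNReal.ofReal_one, one_smul, radialLaw]

/-- An elliptical law is an affine image of the radial law with the same generator. -/
lemma ellipticalLaw_eq_map (hg : Measurable g) (m₁ m₂ : ℝ) {s₁ s₂ r : ℝ} (hs₁ : 0 < s₁) (hs₂ : 0 < s₂) (hr : |r| < 1) :
    ellipticalLaw g m₁ m₂ s₁ s₂ r =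
      (radialLaw g).map fun p => (m₁ + s₁ * p.1, m₂ + s₂ * (r * p.1 + √(1 - r ^ 2) * p.2)) := by
  have hq2 : 0 < 1 - r ^ 2 := by
    have := (sq_lt_one_iff_abs_lt_one r).2 hr
    linarith
  set q := √(1 - r ^ 2) with hq
  have hq0 : 0 < q := Real.sqrt_pos.2 hq2
  have hqq : q ^ 2 = 1 - r ^ 2 := Real.sq_sqrt hq2.le
  have hc : 0 < s₁ * s₂ * q := by positivity
  set T : ℝ × ℝ → ℝ × ℝ := fun p => (m₁ + s₁ * p.1, m₂ + s₂ * (r * p.1 + q * p.2)) with hT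
  have hTm : Measurable T := by rw [hT]; fun_prop
  have hTvol : (volume : Measure (ℝ × ℝ)).map T = ENNReal.ofReal (s₁ * s₂ * q)⁻¹ • volume := by
    have h1 : T = (fun p => ((m₁, m₂) : ℝ × ℝ) + p) ∘ planeMap s₁ 0 (s₂ * r) (s₂ * q) := by
      funext p
      simp only [hT, planeMap, Function.comp_apply, Prod.mk_add_mk]
      congr 1 <;> ring
    have hdet : s₁ * (s₂ * q) - 0 * (s₂ * r) = s₁ * s₂ * q := by ring
    rw [h1, ← Measure.map_map (measurable_const_add _) (measurable_planeMap _ _ _ _),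
      map_planeMap_volume (by rw [hdet]; exact hc.ne'), hdet, abs_of_pos (inv_pos.2 hc),
      Measure.map_smul, map_add_left_eq_self]
  have hcomp : (fun p : ℝ × ℝ => ENNReal.ofReal (g (p.1 ^ 2 + p.2 ^ 2))) =
      (fun p => ENNReal.ofReal (s₁ * s₂ * q) *
        ENNReal.ofReal (ellipticalDensity g m₁ m₂ s₁ s₂ r p)) ∘ T := by
    funext p
    simp only [Function.comp_apply]
    rw [← ENNReal.ofReal_mul hc.le, ellipticalDensity, ← hq, ← mul_assoc, mul_inv_cancel₀ hc.ne',
      one_mul]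
    congr 2
    have e1 : ((T p).1 - m₁) / s₁ = p.1 := by simp only [hT]; field_simp; ring
    have e2 : ((T p).2 - m₂) / s₂ = r * p.1 + q * p.2 := by simp only [hT]; field_simp; ring
    rw [e1, e2, eq_div_iff hq2.ne']
    linear_combination (-p.2 ^ 2) * hqq
  rw [radialLaw, hcomp, map_withDensity_comp hTm
    ((measurable_ellipticalDensity hg m₁ m₂ s₁ s₂ r).const_mul _), hTvol,
    withDensity_smul_measure, ← withDensity_smul _
      ((measurable_ellipticalDensity hg m₁ m₂ s₁ s₂ r).const_mul _), ellipticalLaw]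
  congr 1
  funext p
  rw [Pi.smul_apply, smul_eq_mul, ← mul_assoc, ← ENNReal.ofReal_mul (inv_pos.2 hc).le,
    inv_mul_cancel₀ hc.ne', ENNReal.ofReal_one, one_mul]

lemma isProbabilityMeasure_radialLaw (hg : Measurable g) {m₁ m₂ s₁ s₂ r : ℝ} (hs₁ : 0 < s₁) (hs₂ : 0 < s₂)
    (hr : |r| < 1) (h : IsProbabilityMeasure (ellipticalLaw g m₁ m₂ s₁ s₂ r)) :
    IsProbabilityMeasure (radialLaw g) := by
  rw [ellipticalLaw_eq_map hg m₁ m₂ hs₁ hs₂ hr] at h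
  refine ⟨?_⟩
  have := h.measure_univ
  rwa [Measure.map_apply (by fun_prop) MeasurableSet.univ, preimage_univ] at this

end Radial

/-- The second coordinate of the standardized elliptical law with correlation parameter `r`. -/
noncomputable def correlated (r : ℝ) (p : ℝ × ℝ) : ℝ := r * p.1 + √(1 - r ^ 2) * p.2

@[fun_prop]
lemma measurable_correlated (r : ℝ) : Measurable (correlated r) := by
  unfold correlated; fun_prop

/-- The common marginal law of the standardized elliptical laws with generator `g`. -/
noncomputable def radialMarginal (g : ℝ → ℝ) : Measure ℝ := (radialLaw g).map Prod.fst

lemma radialMarginal_absolutelyContinuous (g : ℝ → ℝ) : radialMarginal g ≪ volume :=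
  ((withDensity_absolutelyContinuous _ _).map measurable_fst).trans
    Measure.quasiMeasurePreserving_fst.absolutelyContinuous

lemma sq_add_sqrt_sq {r : ℝ} (hr : |r| < 1) : r ^ 2 + √(1 - r ^ 2) ^ 2 = 1 := by
  rw [Real.sq_sqrt (by have := (sq_lt_one_iff_abs_lt_one r).2 hr; linarith)]
  ring

section RadialMarginals

variable {g : ℝ → ℝ}

/-- This reflection exchanges the first coordinate `p.1` and `correlated r p`; therefore both have
the same law. -/
lemma map_reflection_radialLaw (hg : Measurable g) {r : ℝ} (hr : |r| < 1) :
    (radialLaw g).map (planeMap r √(1 - r ^ 2) √(1 - r ^ 2) (-r)) = radialLaw g := by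
  have := sq_add_sqrt_sq hr
  exact map_planeMap_radialLaw hg this (by linarith) (by ring)

lemma map_correlated_radialLaw (hg : Measurable g) {r : ℝ} (hr : |r| < 1) :
    (radialLaw g).map (correlated r) = radialMarginal g := by
  conv_rhs => rw [radialMarginal, ← map_reflection_radialLaw hg hr,
    Measure.map_map measurable_fst (measurable_planeMap _ _ _ _)]
  rfl

variable [IsProbabilityMeasure (radialLaw g)]

instance : IsProbabilityMeasure (radialMarginal g) :=
  Measure.isProbabilityMeasure_map measurable_fst.aemeasurable

lemma cdf_radialMarginal_neg (hg : Measurable g) (x : ℝ) :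
    ProbabilityTheory.cdf (radialMarginal g) (-x) =
      1 - ProbabilityTheory.cdf (radialMarginal g) x := by
  have h1 : (radialMarginal g).map (fun y => -y) = radialMarginal g := by
    conv_rhs => rw [radialMarginal, ← map_planeMap_radialLaw hg (a := -1) (b := 0) (c := 0) (d := 1)
      (by norm_num) (by norm_num) (by norm_num),
      Measure.map_map measurable_fst (measurable_planeMap _ _ _ _)]
    rw [radialMarginal, Measure.map_map measurable_neg measurable_fst]
    congr 1
    funext p
    simp [planeMap]
  have h2 : radialMarginal g (Iic (-x)) = radialMarginal g (Ioi x) := by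
    conv_lhs => rw [← h1, Measure.map_apply measurable_neg measurableSet_Iic]
    have : (fun y : ℝ => -y) ⁻¹' Iic (-x) = Ici x := by ext y; simp
    rw [this]
    exact measure_congr ((radialMarginal_absolutelyContinuous g).ae_eq Ioi_ae_eq_Ici.symm)
  rw [ProbabilityTheory.cdf_eq_real, ProbabilityTheory.cdf_eq_real, measureReal_def, h2,
    ← measureReal_def, ← compl_Iic, probReal_compl_eq_one_sub measurableSet_Iic]

/-- The joint distribution function of the standardized elliptical law. -/
lemma IsCopulaOf.cdf_eq (hg : Measurable g) {C : Copula} {m₁ m₂ s₁ s₂ r : ℝ} (hs₁ : 0 < s₁) (hs₂ : 0 < s₂)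
    (hr : |r| < 1) (h : IsCopulaOf C (ellipticalLaw g m₁ m₂ s₁ s₂ r)) (x y : ℝ) :
    C.cdf (ProbabilityTheory.cdf (radialMarginal g) x)
      (ProbabilityTheory.cdf (radialMarginal g) y) =
      (radialLaw g).real {p | p.1 ≤ x ∧ correlated r p ≤ y} := by
  have hc := h (m₁ + s₁ * x) (m₂ + s₂ * y)
  rw [ellipticalLaw_eq_map hg m₁ m₂ hs₁ hs₂ hr] at hc
  set T : ℝ × ℝ → ℝ × ℝ := fun p => (m₁ + s₁ * p.1, m₂ + s₂ * (r * p.1 + √(1 - r ^ 2) * p.2))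
    with hT
  have hTm : Measurable T := by rw [hT]; fun_prop
  have h1 : ((radialLaw g).map T).map Prod.fst =
      (radialMarginal g).map fun x => m₁ + s₁ * x := by
    rw [radialMarginal, Measure.map_map measurable_fst hTm,
      Measure.map_map (by fun_prop) measurable_fst]
    rfl
  have h2 : ((radialLaw g).map T).map Prod.snd =
      (radialMarginal g).map fun y => m₂ + s₂ * y := by
    rw [← map_correlated_radialLaw hg hr, Measure.map_map measurable_snd hTm,
      Measure.map_map (by fun_prop) (measurable_correlated r)]
    rfl
  have haff : ∀ (m s : ℝ), 0 < s → ∀ x, ProbabilityTheory.cdf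
      ((radialMarginal g).map fun x => m + s * x) (m + s * x) =
      ProbabilityTheory.cdf (radialMarginal g) x := by
    intro m s hs x
    have hm : Measurable fun x => m + s * x := by fun_prop
    have := Measure.isProbabilityMeasure_map (μ := radialMarginal g) hm.aemeasurable
    rw [ProbabilityTheory.cdf_eq_real, ProbabilityTheory.cdf_eq_real,
      map_measureReal_apply hm measurableSet_Iic]
    congr 1
    ext y
    simp [hs]
  rw [h1, h2, haff _ _ hs₁, haff _ _ hs₂, map_measureReal_apply hTm
    (measurableSet_Iic.prod measurableSet_Iic)] at hc
  rw [← hc]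
  congr 1
  ext p
  simp [hT, Prod.le_def, hs₁, hs₂, correlated]

/-- The elliptical distribution functions increase with the correlation parameter. -/
lemma real_correlated_mono (hg : Measurable g) {r₁ r₂ : ℝ} (hr₁ : |r₁| < 1) (hr₂ : |r₂| < 1) (h : r₁ ≤ r₂) (x y : ℝ) :
    (radialLaw g).real {p | p.1 ≤ x ∧ correlated r₁ p ≤ y} ≤
      (radialLaw g).real {p | p.1 ≤ x ∧ correlated r₂ p ≤ y} := by
  rcases h.eq_or_lt with rfl | hlt
  · exact le_rfl
  have e₁ := sq_add_sqrt_sq hr₁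
  have e₂ := sq_add_sqrt_sq hr₂
  set q₁ := √(1 - r₁ ^ 2) with hq₁
  set q₂ := √(1 - r₂ ^ 2) with hq₂
  -- With `rᵢ = cos θᵢ` and `qᵢ = sin θᵢ` these are the cosine and sine of `θ₁ + θ₂`. The matrix
  -- `[[a, b], [b, -a]]` is the reflection exchanging the unit vectors `nᵢ = (rᵢ, qᵢ)`, hence the
  -- two correlated coordinates.
  set a := r₁ * r₂ - q₁ * q₂ with ha
  set b := r₁ * q₂ + q₁ * r₂ with hb
  have hab : a ^ 2 + b ^ 2 = 1 := by
    have : a ^ 2 + b ^ 2 = (r₁ ^ 2 + q₁ ^ 2) * (r₂ ^ 2 + q₂ ^ 2) := by rw [ha, hb]; ring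
    rw [this, e₁, e₂, one_mul]
  have hσ : (radialLaw g).map (planeMap a b b (-a)) = radialLaw g :=
    map_planeMap_radialLaw hg hab (by linarith) (by ring)
  have hc₁ : ∀ p, correlated r₁ (planeMap a b b (-a) p) = correlated r₂ p := by
    intro p
    simp only [correlated, planeMap, ← hq₁, ← hq₂, ha, hb]
    linear_combination (r₂ * p.1 + q₂ * p.2) * e₁
  have hc₂ : ∀ p, correlated r₂ (planeMap a b b (-a) p) = correlated r₁ p := by
    intro p
    simp only [correlated, planeMap, ← hq₁, ← hq₂, ha, hb]
    linear_combination (r₁ * p.1 + q₁ * p.2) * e₂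
  have hN : 0 < (r₁ - r₂) ^ 2 + (q₁ - q₂) ^ 2 := by
    have : 0 < (r₁ - r₂) ^ 2 := by have : r₁ - r₂ ≠ 0 := by linarith
                                   positivity
    positivity
  -- the reflection moves points of `{n₂ ≤ y < n₁}` to the right
  have hmove : ∀ p, correlated r₂ p ≤ y → y < correlated r₁ p →
      p.1 ≤ (planeMap a b b (-a) p).1 := by
    intro p h2 h1
    have h3 : 0 < (r₁ - r₂) * p.1 + (q₁ - q₂) * p.2 := by
      simp only [correlated, ← hq₁, ← hq₂] at h1 h2
      linarith
    -- The formula `p - σ p = 2 ⟨n, p⟩ n / |n|²` for the reflection `σ` with normal `n = n₁ - n₂`,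
    -- read in the first coordinate.
    have key : ((r₁ - r₂) ^ 2 + (q₁ - q₂) ^ 2) * (p.1 - (a * p.1 + b * p.2)) =
        2 * ((r₁ - r₂) * p.1 + (q₁ - q₂) * p.2) * (r₁ - r₂) := by
      rw [ha, hb]
      grind
    have h4 : ((r₁ - r₂) ^ 2 + (q₁ - q₂) ^ 2) * (p.1 - (a * p.1 + b * p.2)) ≤ 0 := by
      rw [key]
      exact mul_nonpos_of_nonneg_of_nonpos (by positivity) (by linarith)
    have h5 : p.1 - (a * p.1 + b * p.2) ≤ 0 := by
      by_contra hc
      exact absurd h4 (not_le.2 (mul_pos hN (not_le.1 hc)))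
    simp only [planeMap]
    linarith
  have hm₁ : MeasurableSet {p : ℝ × ℝ | correlated r₁ p ≤ y} :=
    measurableSet_le (measurable_correlated _) measurable_const
  have hm₂ : MeasurableSet {p : ℝ × ℝ | correlated r₂ p ≤ y} :=
    measurableSet_le (measurable_correlated _) measurable_const
  have hmx : MeasurableSet {p : ℝ × ℝ | p.1 ≤ x} := measurableSet_le measurable_fst measurable_const
  have d₁ := measureReal_inter_add_sdiff (μ := radialLaw g)
    (s := {p : ℝ × ℝ | p.1 ≤ x ∧ correlated r₁ p ≤ y}) hm₂
  have d₂ := measureReal_inter_add_sdiff (μ := radialLaw g)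
    (s := {p : ℝ × ℝ | p.1 ≤ x ∧ correlated r₂ p ≤ y}) hm₁
  have hsame : {p : ℝ × ℝ | p.1 ≤ x ∧ correlated r₁ p ≤ y} ∩ {p | correlated r₂ p ≤ y} =
      {p : ℝ × ℝ | p.1 ≤ x ∧ correlated r₂ p ≤ y} ∩ {p | correlated r₁ p ≤ y} := by
    ext p
    simp only [mem_inter_iff, mem_ofPred_eq]
    tauto
  have hdiff : (radialLaw g).real
      ({p : ℝ × ℝ | p.1 ≤ x ∧ correlated r₁ p ≤ y} \ {p | correlated r₂ p ≤ y}) ≤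
      (radialLaw g).real
        ({p : ℝ × ℝ | p.1 ≤ x ∧ correlated r₂ p ≤ y} \ {p | correlated r₁ p ≤ y}) := by
    -- The two regions differ only where exactly one of the correlated coordinates is at most `y`.
    -- The reflection exchanges these parts, and `hmove` gives the inclusion needed for the
    -- constraint on the first coordinate.
    have hm : MeasurableSet
        ({p : ℝ × ℝ | p.1 ≤ x ∧ correlated r₁ p ≤ y} \ {p | correlated r₂ p ≤ y}) :=
      MeasurableSet.diff (hmx.inter hm₁) hm₂
    conv_lhs => rw [← hσ, map_measureReal_apply (measurable_planeMap _ _ _ _) hm]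
    refine measureReal_mono fun p hp => ?_
    simp only [mem_preimage, Set.mem_sdiff, mem_ofPred_eq, hc₁, hc₂, not_le] at hp ⊢
    exact ⟨⟨(hmove p hp.1.2 hp.2).trans hp.1.1, hp.1.2⟩, hp.2⟩
  rw [← d₁, ← d₂, hsame]
  linarith

/-- Changing the sign of the first coordinate turns correlation `r` into `-r` and the lower half
plane in that coordinate into an upper one; its boundary line is null. -/
lemma real_correlated_neg (hg : Measurable g) {r : ℝ} (hr : |r| < 1) (x y : ℝ) :
    (radialLaw g).real {p | p.1 ≤ x ∧ correlated (-r) p ≤ y} =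
      ProbabilityTheory.cdf (radialMarginal g) y -
        (radialLaw g).real {p | p.1 ≤ -x ∧ correlated r p ≤ y} := by
  have hflip : (radialLaw g).map (planeMap (-1) 0 0 1) = radialLaw g :=
    map_planeMap_radialLaw hg (by norm_num) (by norm_num) (by norm_num)
  have hmy : ∀ r, MeasurableSet {p : ℝ × ℝ | correlated r p ≤ y} := fun r =>
    measurableSet_le (measurable_correlated _) measurable_const
  have hmx : ∀ x, MeasurableSet {p : ℝ × ℝ | p.1 ≤ x} := fun x =>
    measurableSet_le measurable_fst measurable_const
  have h1 : (radialLaw g).real {p | p.1 ≤ x ∧ correlated (-r) p ≤ y} =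
      (radialLaw g).real ({p | correlated r p ≤ y} \ {p | p.1 < -x}) := by
    have hm : MeasurableSet {p : ℝ × ℝ | p.1 ≤ x ∧ correlated (-r) p ≤ y} :=
      (hmx x).inter (hmy _)
    conv_lhs => rw [← hflip, map_measureReal_apply (measurable_planeMap _ _ _ _) hm]
    congr 1
    ext p
    simp only [planeMap, correlated, mem_preimage, mem_ofPred_eq, Set.mem_sdiff, not_lt, neg_sq]
    constructor
    · rintro ⟨h1, h2⟩; exact ⟨by linarith, by linarith⟩
    · rintro ⟨h1, h2⟩; exact ⟨by linarith, by linarith⟩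
  have h2 := measureReal_inter_add_sdiff (μ := radialLaw g)
    (s := {p : ℝ × ℝ | correlated r p ≤ y})
    (measurableSet_lt measurable_fst (measurable_const (a := -x)))
  have h3 : (radialLaw g).real {p | correlated r p ≤ y} =
      ProbabilityTheory.cdf (radialMarginal g) y := by
    rw [ProbabilityTheory.cdf_eq_real, ← map_correlated_radialLaw hg hr,
      map_measureReal_apply (measurable_correlated r) measurableSet_Iic]
    rfl
  have h4 : (radialLaw g).real ({p | correlated r p ≤ y} ∩ {p | p.1 < -x}) =
      (radialLaw g).real {p | p.1 ≤ -x ∧ correlated r p ≤ y} := by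
    have hne : ∀ᵐ p ∂radialLaw g, p.1 ≠ -x := by
      have : ∀ᵐ t ∂radialMarginal g, t ≠ -x :=
        (radialMarginal_absolutelyContinuous g).ae_le (Measure.ae_ne volume (-x))
      exact ae_of_ae_map measurable_fst.aemeasurable this
    refine measureReal_congr ?_
    filter_upwards [hne] with p hp
    refine propext ⟨fun h => ⟨le_of_lt h.2, h.1⟩, fun h => ⟨h.2, lt_of_le_of_ne h.1 hp⟩⟩
  rw [h1, ← h3, ← h4]
  linarith

/-- For elliptical copulas `|ρ_s|` increases with `|r|`. -/
theorem abs_spearmanRho_le_of_elliptical (hg : Measurable g) {C₁ C₂ : Copula} {r₁ r₂ : ℝ} (hr₁ : |r₁| < 1)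
    (hr₂ : |r₂| < 1)
    (h₁ : ∀ x y, C₁.cdf (ProbabilityTheory.cdf (radialMarginal g) x)
      (ProbabilityTheory.cdf (radialMarginal g) y) =
      (radialLaw g).real {p | p.1 ≤ x ∧ correlated r₁ p ≤ y})
    (h₂ : ∀ x y, C₂.cdf (ProbabilityTheory.cdf (radialMarginal g) x)
      (ProbabilityTheory.cdf (radialMarginal g) y) =
      (radialLaw g).real {p | p.1 ≤ x ∧ correlated r₂ p ≤ y})
    (h : |r₁| ≤ |r₂|) : |C₁.spearmanRho| ≤ |C₂.spearmanRho| := by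
  have hH := radialMarginal_absolutelyContinuous g
  have hrefl : ∀ x y, (radialLaw g).real {p | p.1 ≤ x ∧ correlated (-r₂) p ≤ y} =
      ProbabilityTheory.cdf (radialMarginal g) y - C₂.cdf
        (1 - ProbabilityTheory.cdf (radialMarginal g) x)
        (ProbabilityTheory.cdf (radialMarginal g) y) := fun x y => by
    rw [real_correlated_neg hg hr₂, ← cdf_radialMarginal_neg hg, h₂]
  have hr₂' : |-r₂| < 1 := by rwa [abs_neg]
  -- Since `r₁` lies between `-|r₂|` and `|r₂|`, the copula `C₁` lies between `C₂` and its
  -- reflection, and these have opposite values of `ρ_s`.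
  rcases le_total 0 r₂ with h0 | h0
  · rw [abs_of_nonneg h0, abs_le] at h
    refine le_trans (abs_le.2 ⟨?_, ?_⟩) (le_abs_self _)
    · refine Copula.neg_spearmanRho_le fun u hu v hv => ?_
      obtain ⟨x, rfl, -⟩ := exists_cdf_eq hH hu
      obtain ⟨y, rfl, -⟩ := exists_cdf_eq hH hv
      rw [← hrefl, h₁]
      exact real_correlated_mono hg hr₂' hr₁ h.1 x y
    · refine Copula.spearmanRho_mono fun u hu v hv => ?_
      obtain ⟨x, rfl, -⟩ := exists_cdf_eq hH hu
      obtain ⟨y, rfl, -⟩ := exists_cdf_eq hH hv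
      rw [h₁, h₂]
      exact real_correlated_mono hg hr₁ hr₂ h.2 x y
  · rw [abs_of_nonpos h0, abs_le, neg_neg] at h
    refine le_trans (abs_le.2 ⟨?_, ?_⟩) (neg_le_abs _)
    · rw [neg_neg]
      refine Copula.spearmanRho_mono fun u hu v hv => ?_
      obtain ⟨x, rfl, -⟩ := exists_cdf_eq hH hu
      obtain ⟨y, rfl, -⟩ := exists_cdf_eq hH hv
      rw [h₁, h₂]
      exact real_correlated_mono hg hr₂ hr₁ h.1 x y
    · refine Copula.le_neg_spearmanRho fun u hu v hv => ?_
      obtain ⟨x, rfl, -⟩ := exists_cdf_eq hH hu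
      obtain ⟨y, rfl, -⟩ := exists_cdf_eq hH hv
      rw [← hrefl, h₁]
      exact real_correlated_mono hg hr₁ hr₂' h.2 x y

end RadialMarginals

/-! ### Log-likelihood ratios -/

section LogLikelihood

variable {α : Type*} [MeasurableSpace α]

lemma llr_withDensity {l : Measure α} [SigmaFinite l] {f k : α → ENNReal} (hf : Measurable f)
    (hk : Measurable k) [IsFiniteMeasure (l.withDensity f)] [IsFiniteMeasure (l.withDensity k)]
    (hk0 : ∀ᵐ x ∂l.withDensity f, k x ≠ 0) :
    l.withDensity f ≪ l.withDensity k ∧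
      llr (l.withDensity f) (l.withDensity k) =ᵐ[l.withDensity f]
        fun x => Real.log (f x).toReal - Real.log (k x).toReal := by
  have hftop : ∀ᵐ x ∂l, f x < ⊤ := ae_lt_top hf (by
    rw [← setLIntegral_univ, ← withDensity_apply _ MeasurableSet.univ]; exact measure_ne_top _ _)
  have hktop : ∀ᵐ x ∂l, k x < ⊤ := ae_lt_top hk (by
    rw [← setLIntegral_univ, ← withDensity_apply _ MeasurableSet.univ]; exact measure_ne_top _ _)
  have heq : l.withDensity f = (l.withDensity k).withDensity (f / k) := by
    rw [← withDensity_mul _ hk (hf.div hk)]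
    refine withDensity_congr_ae ?_
    filter_upwards [(ae_withDensity_iff hf).1 hk0, hktop] with x hx hx'
    rw [Pi.mul_apply, Pi.div_apply]
    rcases eq_or_ne (f x) 0 with h0 | h0
    · simp [h0]
    · rw [ENNReal.mul_div_cancel (hx h0) hx'.ne]
  have hac : l.withDensity f ≪ l.withDensity k := by
    rw [heq]; exact withDensity_absolutelyContinuous _ _
  refine ⟨hac, ?_⟩
  have hrn : (l.withDensity f).rnDeriv (l.withDensity k) =ᵐ[l.withDensity k] f / k := by
    conv_lhs => rw [heq]
    exact Measure.rnDeriv_withDensity _ (hf.div hk)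
  have hle := (withDensity_absolutelyContinuous l f).ae_le
  filter_upwards [hac.ae_le hrn, hk0, hle hftop, hle hktop,
    (ae_withDensity_iff hf).2 (ae_of_all _ fun x hx => hx)] with x h1 h2 h3 h4 h5
  rw [llr, h1, Pi.div_apply, ENNReal.toReal_div,
    Real.log_div (ENNReal.toReal_ne_zero.2 ⟨h5, h3.ne⟩) (ENNReal.toReal_ne_zero.2 ⟨h2, h4.ne⟩)]

lemma ENNReal.mul_ofReal_neg_log_le_one {x : ENNReal} (hx : x ≠ ⊤) :
    x * ENNReal.ofReal (-Real.log x.toReal) ≤ 1 := by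
  have h := InformationTheory.klFun_nonneg (x := x.toReal) ENNReal.toReal_nonneg
  rw [InformationTheory.klFun_apply] at h
  calc x * ENNReal.ofReal (-Real.log x.toReal)
      = ENNReal.ofReal (x.toReal * -Real.log x.toReal) := by
        rw [ENNReal.ofReal_mul ENNReal.toReal_nonneg, ENNReal.ofReal_toReal hx]
    _ ≤ ENNReal.ofReal 1 := by
        refine ENNReal.ofReal_le_ofReal ?_
        have : 0 ≤ x.toReal := ENNReal.toReal_nonneg
        linarith
    _ = 1 := ENNReal.ofReal_one

/-- The negative part of a log-likelihood ratio is always integrable. For elliptical laws this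
supplies the one-sided bound required by the exhaustion argument. -/
lemma lintegral_ofReal_neg_llr_le {μ ν : Measure α} [SigmaFinite μ] [IsProbabilityMeasure ν]
    (h : μ ≪ ν) : ∫⁻ x, ENNReal.ofReal (-llr μ ν x) ∂μ ≤ 1 := by
  rw [← lintegral_rnDeriv_mul h (by fun_prop)]
  calc _ ≤ ∫⁻ _, 1 ∂ν := by
        refine lintegral_mono_ae ?_
        filter_upwards [Measure.rnDeriv_ne_top μ ν] with x hx
        exact ENNReal.mul_ofReal_neg_log_le_one hx
    _ = 1 := by simp

/-- If two functions have equal integrals over an exhausting sequence of sets, then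
integrability and the integral pass from one to the other. -/
lemma integrable_of_setIntegral_eq {μ : Measure α} {f k : α → ℝ} {K : ℕ → Set α}
    (hfm : Measurable f) (hKm : ∀ n, MeasurableSet (K n)) (hK : Monotone K)
    (hKu : ∀ᵐ x ∂μ, x ∈ ⋃ n, K n) (hfK : ∀ n, IntegrableOn f (K n) μ)
    (hfk : ∀ n, ∫ x in K n, f x ∂μ = ∫ x in K n, k x ∂μ) (hk : Integrable k μ)
    (hneg : ∫⁻ x, ENNReal.ofReal (-f x) ∂μ ≠ ⊤) :
    Integrable f μ ∧ ∫ x, f x ∂μ = ∫ x, k x ∂μ := by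
  have hres : μ.restrict (⋃ n, K n) = μ := Measure.restrict_eq_self_of_ae_mem hKu
  have hpos : ∫⁻ x, ENNReal.ofReal (f x) ∂μ ≠ ⊤ := by
    -- The positive part of `f` is bounded on every `K n` by the same finite quantity, and monotone
    -- convergence carries the bound to the union.
    have hbound : ∀ n, ∫⁻ x in K n, ENNReal.ofReal (f x) ∂μ ≤
        ENNReal.ofReal (∫ x, |k x| ∂μ) + ∫⁻ x, ENNReal.ofReal (-f x) ∂μ := by
      intro n
      have h1 := integral_eq_lintegral_pos_part_sub_lintegral_neg_part (hfK n)
      have h2 : ∫ x in K n, k x ∂μ ≤ ∫ x, |k x| ∂μ :=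
        (integral_mono hk.integrableOn hk.abs.integrableOn fun x => le_abs_self _).trans
          (setIntegral_le_integral hk.abs (ae_of_all _ fun x => abs_nonneg _))
      have h3 : ∫⁻ x in K n, ENNReal.ofReal (-f x) ∂μ ≤ ∫⁻ x, ENNReal.ofReal (-f x) ∂μ :=
        setLIntegral_le_lintegral _ _
      have h4 : ∫⁻ x in K n, ENNReal.ofReal (f x) ∂μ ≠ ⊤ := (hfK n).lintegral_lt_top.ne
      have h5 : 0 ≤ ∫ x, |k x| ∂μ := integral_nonneg fun x => abs_nonneg _
      rw [← ENNReal.ofReal_toReal h4, ← ENNReal.ofReal_toReal hneg,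
        ← ENNReal.ofReal_add h5 ENNReal.toReal_nonneg]
      refine ENNReal.ofReal_le_ofReal ?_
      have h6 := ENNReal.toReal_mono hneg h3
      rw [hfk n] at h1
      linarith
    refine ne_top_of_le_ne_top (ENNReal.add_ne_top.2 ⟨ENNReal.ofReal_ne_top, hneg⟩)
      (b := ENNReal.ofReal (∫ x, |k x| ∂μ) + ∫⁻ x, ENNReal.ofReal (-f x) ∂μ) ?_
    conv_lhs => rw [← hres]
    rw [setLIntegral_iUnion_of_directed _ (directed_of_isDirected_le hK)]
    exact iSup_le hbound
  have hf : Integrable f μ := by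
    refine ⟨hfm.aestronglyMeasurable, ?_⟩
    refine lt_of_le_of_lt (lintegral_mono (g := fun x => ENNReal.ofReal (f x) +
      ENNReal.ofReal (-f x)) fun x => ?_) ?_
    · simp only [Real.enorm_eq_ofReal_abs]
      rcases le_total 0 (f x) with h | h
      · rw [abs_of_nonneg h]; exact le_self_add
      · rw [abs_of_nonpos h]; exact le_add_self
    · rw [lintegral_add_left (by fun_prop)]
      exact ENNReal.add_lt_top.2 ⟨hpos.lt_top, hneg.lt_top⟩
  refine ⟨hf, ?_⟩
  have l1 := tendsto_setIntegral_of_monotone hKm hK hf.integrableOn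
  have l2 := tendsto_setIntegral_of_monotone hKm hK hk.integrableOn
  simp only [hfk, hres] at l1 l2
  exact tendsto_nhds_unique l1 l2

end LogLikelihood

/-! ### Entropy of elliptical copulas -/

/-- The density of the common marginal of the standardized elliptical laws. -/
noncomputable def marginalDensity (g : ℝ → ℝ) (x : ℝ) : ℝ :=
  ((radialMarginal g).rnDeriv volume x).toReal

@[fun_prop]
lemma measurable_marginalDensity (g : ℝ → ℝ) : Measurable (marginalDensity g) :=
  (Measure.measurable_rnDeriv _ _).ennreal_toReal

/-- The logarithm of the density of the standardized elliptical law with respect to the product of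
its marginals, up to an additive constant, as a function on the underlying radial plane. -/
noncomputable def logRatio (g : ℝ → ℝ) (r : ℝ) (p : ℝ × ℝ) : ℝ :=
  Real.log (g (p.1 ^ 2 + p.2 ^ 2)) - Real.log (marginalDensity g p.1)
    - Real.log (marginalDensity g (correlated r p))

lemma sqrt_one_sub_sq_pos {r : ℝ} (hr : |r| < 1) : 0 < √(1 - r ^ 2) :=
  Real.sqrt_pos.2 (by have := (sq_lt_one_iff_abs_lt_one r).2 hr; linarith)

section EllipticalEntropy

variable {g : ℝ → ℝ}

lemma measurable_logRatio (hg : Measurable g) (r : ℝ) : Measurable (logRatio g r) := by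
  unfold logRatio
  fun_prop

lemma standardLaw_eq_map (hg : Measurable g) {r : ℝ} (hr : |r| < 1) :
    ellipticalLaw g 0 0 1 1 r = (radialLaw g).map fun p => (p.1, correlated r p) := by
  rw [ellipticalLaw_eq_map hg 0 0 one_pos one_pos hr]
  simp [correlated]

lemma ellipticalDensity_correlated {r : ℝ} (hr : |r| < 1) (p : ℝ × ℝ) :
    ellipticalDensity g 0 0 1 1 r (p.1, correlated r p) =
      (√(1 - r ^ 2))⁻¹ * g (p.1 ^ 2 + p.2 ^ 2) := by
  have h := sq_add_sqrt_sq hr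
  have h0 := sqrt_one_sub_sq_pos hr
  have h1 : 1 - r ^ 2 ≠ 0 := by nlinarith
  simp only [ellipticalDensity, sub_zero, div_one, one_mul, correlated]
  congr 2
  rw [div_eq_iff h1]
  linear_combination p.2 ^ 2 * h

lemma ae_generator_pos (hg : Measurable g) : ∀ᵐ p ∂radialLaw g, 0 < g (p.1 ^ 2 + p.2 ^ 2) := by
  refine (ae_withDensity_iff (measurable_radialDensity hg)).2 (ae_of_all _ fun p hp => ?_)
  simpa using hp

variable [IsProbabilityMeasure (radialLaw g)]

lemma ae_marginalDensity_pos (g : ℝ → ℝ) [IsProbabilityMeasure (radialLaw g)] :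
    ∀ᵐ x ∂radialMarginal g, 0 < marginalDensity g x := by
  have h := radialMarginal_absolutelyContinuous g
  filter_upwards [Measure.rnDeriv_pos h, h.ae_le (Measure.rnDeriv_ne_top (radialMarginal g) volume)] with x h1 h2
  exact ENNReal.toReal_pos h1.ne' h2

/-- The joint density carries the Jacobian factor `1 / √(1 - r²)`. Pulled back to the radial plane,
the generator term no longer involves `r`, which survives only in the Jacobian and in the second
marginal. -/
lemma llr_standardLaw (hg : Measurable g) {r : ℝ} (hr : |r| < 1) :
    ellipticalLaw g 0 0 1 1 r ≪ (radialMarginal g).prod (radialMarginal g) ∧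
      ∀ᵐ p ∂radialLaw g, llr (ellipticalLaw g 0 0 1 1 r)
        ((radialMarginal g).prod (radialMarginal g)) (p.1, correlated r p) =
          logRatio g r p - Real.log √(1 - r ^ 2) := by
  have hTm : Measurable fun p : ℝ × ℝ => (p.1, correlated r p) := by fun_prop
  have hq := sqrt_one_sub_sq_pos hr
  set h := (radialMarginal g).rnDeriv volume with hh
  have hhm : Measurable h := Measure.measurable_rnDeriv _ _
  have hH := radialMarginal_absolutelyContinuous g
  have hprod : (radialMarginal g).prod (radialMarginal g) =
      volume.withDensity fun p : ℝ × ℝ => h p.1 * h p.2 := by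
    conv_lhs => rw [← Measure.withDensity_rnDeriv_eq _ _ hH]
    rw [prod_withDensity hhm hhm, ← Measure.volume_eq_prod]
  have hE : IsProbabilityMeasure (ellipticalLaw g 0 0 1 1 r) := by
    rw [standardLaw_eq_map hg hr]
    exact Measure.isProbabilityMeasure_map hTm.aemeasurable
  have hP : IsProbabilityMeasure ((volume : Measure (ℝ × ℝ)).withDensity
    fun p : ℝ × ℝ => h p.1 * h p.2) := by rw [← hprod]; infer_instance
  have h1 : ∀ᵐ p ∂radialLaw g, 0 < marginalDensity g p.1 :=
    ae_of_ae_map measurable_fst.aemeasurable (ae_marginalDensity_pos g)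
  have h2 : ∀ᵐ p ∂radialLaw g, 0 < marginalDensity g (correlated r p) := by
    have := ae_marginalDensity_pos g
    rw [← map_correlated_radialLaw hg hr] at this
    exact ae_of_ae_map (measurable_correlated r).aemeasurable this
  have hk0 : ∀ᵐ p ∂ellipticalLaw g 0 0 1 1 r, h p.1 * h p.2 ≠ 0 := by
    have hm : MeasurableSet {p : ℝ × ℝ | h p.1 * h p.2 ≠ 0} :=
      (by fun_prop : Measurable fun p : ℝ × ℝ => h p.1 * h p.2) (measurableSet_singleton 0).compl
    rw [standardLaw_eq_map hg hr, ae_map_iff hTm.aemeasurable hm]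
    filter_upwards [h1, h2] with p hp1 hp2
    exact mul_ne_zero (ENNReal.toReal_pos_iff.1 hp1).1.ne' (ENNReal.toReal_pos_iff.1 hp2).1.ne'
  rw [ellipticalLaw] at hE hk0
  obtain ⟨hac, hllr⟩ := llr_withDensity (measurable_ellipticalDensity hg 0 0 1 1 r)
    (by fun_prop : Measurable fun p : ℝ × ℝ => h p.1 * h p.2) hk0
  rw [hprod]
  refine ⟨hac, ?_⟩
  change _ =ᵐ[ellipticalLaw g 0 0 1 1 r] _ at hllr
  rw [standardLaw_eq_map hg hr] at hllr
  filter_upwards [ae_of_ae_map hTm.aemeasurable hllr, h1, h2, ae_generator_pos hg]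
    with p hp hp1 hp2 hp3
  refine hp.trans ?_
  rw [ellipticalDensity_correlated hr, ENNReal.toReal_ofReal (by positivity), ENNReal.toReal_mul,
    Real.log_mul (by positivity) hp3.ne', Real.log_inv, logRatio]
  have := Real.log_mul hp1.ne' hp2.ne'
  change _ - Real.log (marginalDensity g p.1 * marginalDensity g (correlated r p)) = _
  rw [this]
  ring

end EllipticalEntropy

section EllipticalCopula

variable {g : ℝ → ℝ}

lemma map_fst_standardLaw (hg : Measurable g) {r : ℝ} (hr : |r| < 1) :
    (ellipticalLaw g 0 0 1 1 r).map Prod.fst = radialMarginal g := by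
  rw [standardLaw_eq_map hg hr, Measure.map_map measurable_fst (by fun_prop)]
  rfl

lemma map_snd_standardLaw (hg : Measurable g) {r : ℝ} (hr : |r| < 1) :
    (ellipticalLaw g 0 0 1 1 r).map Prod.snd = radialMarginal g := by
  rw [standardLaw_eq_map hg hr, Measure.map_map measurable_snd (by fun_prop)]
  exact map_correlated_radialLaw hg hr

variable [IsProbabilityMeasure (radialLaw g)]

lemma law_eq_map_standardLaw (hg : Measurable g) {r : ℝ} (hr : |r| < 1) {C : Copula}
    (h : ∀ x y, C.cdf (ProbabilityTheory.cdf (radialMarginal g) x)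
      (ProbabilityTheory.cdf (radialMarginal g) y) =
      (radialLaw g).real {p | p.1 ≤ x ∧ correlated r p ≤ y}) :
    C.law = (ellipticalLaw g 0 0 1 1 r).map
      (Prod.map (ProbabilityTheory.cdf (radialMarginal g))
        (ProbabilityTheory.cdf (radialMarginal g))) := by
  have hH := radialMarginal_absolutelyContinuous g
  set F := ProbabilityTheory.cdf (radialMarginal g)
  have hF : Measurable F := F.mono.measurable
  let D : Copula :=
    { law := (ellipticalLaw g 0 0 1 1 r).map (Prod.map F F)
      fst_uniform := by
        rw [Measure.map_map measurable_fst (hF.prodMap hF), Prod.map_fst',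
          ← Measure.map_map hF measurable_fst, map_fst_standardLaw hg hr, map_cdf_eq_uniform hH]
      snd_uniform := by
        rw [Measure.map_map measurable_snd (hF.prodMap hF), Prod.map_snd',
          ← Measure.map_map hF measurable_snd, map_snd_standardLaw hg hr, map_cdf_eq_uniform hH] }
  refine Copula.law_eq_of_cdf_Ioo (D := D) fun u hu v hv => ?_
  obtain ⟨x, rfl, hx⟩ := exists_cdf_eq hH hu
  obtain ⟨y, rfl, hy⟩ := exists_cdf_eq hH hv
  rw [h, Copula.cdf, map_measureReal_apply (hF.prodMap hF)
    (measurableSet_Iic.prod measurableSet_Iic), Set.preimage_prod_map_prod, hx, hy,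
    standardLaw_eq_map hg hr, map_measureReal_apply (by fun_prop)
    (measurableSet_Iic.prod measurableSet_Iic)]
  rfl

/-- The marginal transforms to uniform variables have measurable inverses almost everywhere, so the
data processing inequality applies in both directions. -/
lemma divergence_eq_klDiv_standardLaw (hg : Measurable g) {r : ℝ} (hr : |r| < 1) {C : Copula}
    (h : ∀ x y, C.cdf (ProbabilityTheory.cdf (radialMarginal g) x)
      (ProbabilityTheory.cdf (radialMarginal g) y) =
      (radialLaw g).real {p | p.1 ≤ x ∧ correlated r p ≤ y}) :
    C.divergence = InformationTheory.klDiv (ellipticalLaw g 0 0 1 1 r)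
      ((radialMarginal g).prod (radialMarginal g)) := by
  have hH := radialMarginal_absolutelyContinuous g
  have hlaw := law_eq_map_standardLaw hg hr h
  obtain ⟨Γ, hΓ, hΓF⟩ := exists_leftInverse_cdf hH
  set F := ProbabilityTheory.cdf (radialMarginal g)
  have hF : Measurable F := F.mono.measurable
  have hE : IsProbabilityMeasure (ellipticalLaw g 0 0 1 1 r) := by
    rw [standardLaw_eq_map hg hr]
    exact Measure.isProbabilityMeasure_map (by fun_prop)
  have hunif : uniformSquare = ((radialMarginal g).prod (radialMarginal g)).map (Prod.map F F) := by
    rw [← Measure.map_prod_map _ _ hF hF, map_cdf_eq_uniform hH, Measure.prod_restrict,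
      uniformSquare, unitSquare, Measure.volume_eq_prod]
  have hinv : ∀ m : Measure (ℝ × ℝ), m.map Prod.fst = radialMarginal g →
      m.map Prod.snd = radialMarginal g → (m.map (Prod.map F F)).map (Prod.map Γ Γ) = m := by
    intro m h1 h2
    rw [Measure.map_map (hΓ.prodMap hΓ) (hF.prodMap hF)]
    conv_rhs => rw [← Measure.map_id (μ := m)]
    refine Measure.map_congr ?_
    have e1 := hΓF
    have e2 := hΓF
    rw [← h1] at e1
    rw [← h2] at e2
    filter_upwards [ae_of_ae_map measurable_fst.aemeasurable e1,
      ae_of_ae_map measurable_snd.aemeasurable e2] with p hp1 hp2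
    exact Prod.ext hp1 hp2
  refine le_antisymm ?_ ?_
  · rw [Copula.divergence, hlaw, hunif]
    exact InformationTheory.klDiv_map_le _ _ (hF.prodMap hF)
  · conv_lhs => rw [← hinv _ (map_fst_standardLaw hg hr) (map_snd_standardLaw hg hr),
      ← hinv ((radialMarginal g).prod (radialMarginal g)) (by simp) (by simp), ← hlaw, ← hunif]
    exact InformationTheory.klDiv_map_le _ _ (hΓ.prodMap hΓ)

/-- Finiteness and value of the divergence of an elliptical copula. -/
lemma divergence_elliptical (hg : Measurable g) {r : ℝ} (hr : |r| < 1) {C : Copula}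
    (h : ∀ x y, C.cdf (ProbabilityTheory.cdf (radialMarginal g) x)
      (ProbabilityTheory.cdf (radialMarginal g) y) =
      (radialLaw g).real {p | p.1 ≤ x ∧ correlated r p ≤ y}) :
    (C.divergence ≠ ⊤ ↔ Integrable (logRatio g r) (radialLaw g)) ∧
      (Integrable (logRatio g r) (radialLaw g) →
        C.divergence.toReal = ∫ p, logRatio g r p ∂radialLaw g - Real.log √(1 - r ^ 2)) ∧
      ∫⁻ p, ENNReal.ofReal (-logRatio g r p) ∂radialLaw g ≠ ⊤ := by
  have hTm : Measurable fun p : ℝ × ℝ => (p.1, correlated r p) := by fun_prop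
  have hE : IsProbabilityMeasure (ellipticalLaw g 0 0 1 1 r) := by
    rw [standardLaw_eq_map hg hr]
    exact Measure.isProbabilityMeasure_map hTm.aemeasurable
  obtain ⟨hac, hllr⟩ := llr_standardLaw hg hr
  set π := (radialMarginal g).prod (radialMarginal g)
  have hlm := measurable_llr (ellipticalLaw g 0 0 1 1 r) π
  have hiff : Integrable (llr (ellipticalLaw g 0 0 1 1 r) π) (ellipticalLaw g 0 0 1 1 r) ↔
      Integrable (logRatio g r) (radialLaw g) := by
    have := integrable_map_measure (μ := radialLaw g) hlm.aestronglyMeasurable hTm.aemeasurable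
    rw [← standardLaw_eq_map hg hr] at this
    rw [this]
    change Integrable (fun p : ℝ × ℝ => llr (ellipticalLaw g 0 0 1 1 r) π (p.1, correlated r p)) _ ↔ _
    rw [integrable_congr hllr]
    exact ⟨fun h => 
      (h.add (integrable_const (Real.log √(1 - r ^ 2)))).congr (ae_of_all _ fun p => by simp),
      fun h => h.sub (integrable_const _)⟩
  rw [divergence_eq_klDiv_standardLaw hg hr h, InformationTheory.klDiv_ne_top_iff, hiff]
  refine ⟨⟨fun h => h.2, fun h => ⟨hac, h⟩⟩, fun hint => ?_, ?_⟩
  · rw [InformationTheory.toReal_klDiv_of_measure_eq hac (by simp)]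
    have : ∫ p, llr (ellipticalLaw g 0 0 1 1 r) π p ∂ellipticalLaw g 0 0 1 1 r =
        ∫ p, llr (ellipticalLaw g 0 0 1 1 r) π (p.1, correlated r p) ∂radialLaw g := by
      have := integral_map (μ := radialLaw g) hTm.aemeasurable hlm.aestronglyMeasurable
      rwa [← standardLaw_eq_map hg hr] at this
    rw [this, integral_congr_ae hllr, integral_sub hint (integrable_const _)]
    simp
  -- This part holds without integrability of `logRatio`: its negative part is dominated by that of
  -- the log-likelihood ratio plus a constant.
  · have h1 := lintegral_ofReal_neg_llr_le hac
    have h2 := lintegral_map (μ := radialLaw g) hlm.neg.ennreal_ofReal hTm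
    rw [← standardLaw_eq_map hg hr] at h2
    refine ne_top_of_le_ne_top (b := 1 + ENNReal.ofReal (-Real.log √(1 - r ^ 2)))
      (ENNReal.add_ne_top.2 ⟨ENNReal.one_ne_top, ENNReal.ofReal_ne_top⟩) ?_
    calc ∫⁻ p, ENNReal.ofReal (-logRatio g r p) ∂radialLaw g
        ≤ ∫⁻ p, (ENNReal.ofReal (-llr (ellipticalLaw g 0 0 1 1 r) π (p.1, correlated r p)) +
            ENNReal.ofReal (-Real.log √(1 - r ^ 2))) ∂radialLaw g := by
          refine lintegral_mono_ae ?_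
          filter_upwards [hllr] with p hp
          rw [hp]
          refine le_trans (ENNReal.ofReal_le_ofReal (le_of_eq ?_)) ENNReal.ofReal_add_le
          ring
      _ ≤ _ := by
          rw [lintegral_add_right _ measurable_const]
          refine add_le_add (le_of_eq_of_le h2.symm h1) ?_
          simp

end EllipticalCopula

/-! ### Exhaustion by rotation invariant sets -/

section RadialExhaustion

/-- Rotation invariant sets, exhausting almost all of the plane, on which the radial density and
its inverse are bounded. -/
def radialSet (g : ℝ → ℝ) (n : ℕ) : Set (ℝ × ℝ) :=
  {p | p.1 ^ 2 + p.2 ^ 2 ≤ n ∧ g (p.1 ^ 2 + p.2 ^ 2) ≤ n ∧ 1 ≤ n * g (p.1 ^ 2 + p.2 ^ 2)}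

variable {g : ℝ → ℝ}

lemma measurableSet_radialSet (hg : Measurable g) (n : ℕ) : MeasurableSet (radialSet g n) := by
  have h : Measurable fun p : ℝ × ℝ => g (p.1 ^ 2 + p.2 ^ 2) := hg.comp (by fun_prop)
  have h' : Measurable fun p : ℝ × ℝ => p.1 ^ 2 + p.2 ^ 2 := by fun_prop
  exact (measurableSet_le h' measurable_const).inter
    ((measurableSet_le h measurable_const).inter (measurableSet_le measurable_const
      (h.const_mul _)))

lemma monotone_radialSet (g : ℝ → ℝ) : Monotone (radialSet g) := by
  rintro n m hnm p ⟨h1, h2, h3⟩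
  have hnm' : (n : ℝ) ≤ m := by exact_mod_cast hnm
  have hpos : 0 ≤ g (p.1 ^ 2 + p.2 ^ 2) := by
    by_contra h
    nlinarith [mul_nonneg n.cast_nonneg (neg_nonneg.2 (not_le.1 h).le)]
  exact ⟨h1.trans hnm', h2.trans hnm', h3.trans (mul_le_mul_of_nonneg_right hnm' hpos)⟩

lemma ae_mem_iUnion_radialSet (hg : Measurable g) :
    ∀ᵐ p ∂radialLaw g, p ∈ ⋃ n, radialSet g n := by
  filter_upwards [ae_generator_pos hg] with p hp
  obtain ⟨n, hn⟩ := exists_nat_ge (max (p.1 ^ 2 + p.2 ^ 2)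
    (max (g (p.1 ^ 2 + p.2 ^ 2)) (g (p.1 ^ 2 + p.2 ^ 2))⁻¹))
  simp only [max_le_iff] at hn
  exact mem_iUnion.2 ⟨n, hn.1, hn.2.1, (inv_le_iff_one_le_mul₀ hp).1 hn.2.2⟩

lemma abs_log_le_of_mul_ge {t : ℝ} {n : ℝ} (hn : 0 ≤ n) (h1 : t ≤ n) (h2 : 1 ≤ n * t) :
    |Real.log t| ≤ n := by
  have ht : 0 < t := by
    by_contra h
    nlinarith
  refine abs_le.2 ⟨?_, by linarith [Real.log_le_sub_one_of_pos ht]⟩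
  have h3 := Real.log_le_sub_one_of_pos (inv_pos.2 ht)
  rw [Real.log_inv] at h3
  linarith [(inv_le_iff_one_le_mul₀ ht).2 h2]

/-- The reflection exchanging `p.1` and `correlated r p` preserves the radius, hence the radial
sets. On each of them the two coordinates therefore have the same law, whatever `r` is. -/
lemma map_reflection_restrict_radialSet (hg : Measurable g) {r : ℝ} (hr : |r| < 1) (n : ℕ) :
    ((radialLaw g).restrict (radialSet g n)).map
      (planeMap r √(1 - r ^ 2) √(1 - r ^ 2) (-r)) = (radialLaw g).restrict (radialSet g n) := by
  conv_rhs => rw [← map_reflection_radialLaw hg hr,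
    Measure.restrict_map (measurable_planeMap _ _ _ _) (measurableSet_radialSet hg n)]
  congr 2
  ext p
  have h := sq_add_sqrt_sq hr
  have : (r * p.1 + √(1 - r ^ 2) * p.2) ^ 2 + (√(1 - r ^ 2) * p.1 + -r * p.2) ^ 2 =
      p.1 ^ 2 + p.2 ^ 2 := by linear_combination (p.1 ^ 2 + p.2 ^ 2) * h
  simp only [radialSet, mem_preimage, planeMap, mem_ofPred_eq, this]

lemma integrableOn_correlated_iff (hg : Measurable g) {r : ℝ} (hr : |r| < 1) (n : ℕ)
    {φ : ℝ → ℝ} (hφ : Measurable φ) :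
    IntegrableOn (fun p => φ (correlated r p)) (radialSet g n) (radialLaw g) ↔
      IntegrableOn (fun p => φ p.1) (radialSet g n) (radialLaw g) := by
  have := integrable_map_measure (μ := (radialLaw g).restrict (radialSet g n))
    (hφ.comp measurable_fst).aestronglyMeasurable
    (measurable_planeMap r √(1 - r ^ 2) √(1 - r ^ 2) (-r)).aemeasurable
  rw [map_reflection_restrict_radialSet hg hr] at this
  exact this.symm

lemma setIntegral_correlated (hg : Measurable g) {r : ℝ} (hr : |r| < 1) (n : ℕ)
    {φ : ℝ → ℝ} (hφ : Measurable φ) :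
    ∫ p in radialSet g n, φ (correlated r p) ∂radialLaw g =
      ∫ p in radialSet g n, φ p.1 ∂radialLaw g := by
  have := integral_map (μ := (radialLaw g).restrict (radialSet g n))
    (measurable_planeMap r √(1 - r ^ 2) √(1 - r ^ 2) (-r)).aemeasurable
    (hφ.comp measurable_fst).aestronglyMeasurable
  rw [map_reflection_restrict_radialSet hg hr] at this
  exact this.symm

lemma fst_mem_of_radialSet {n : ℕ} {p : ℝ × ℝ} (hp : p ∈ radialSet g n) :
    p ∈ Icc (-(n + 1 : ℝ)) (n + 1) ×ˢ Icc (-(n + 1 : ℝ)) (n + 1) := by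
  have h := hp.1
  have hn : (0 : ℝ) ≤ n := n.cast_nonneg
  have h1 : |p.1| ≤ n + 1 := abs_le_of_sq_le_sq (by nlinarith [sq_nonneg p.2]) (by positivity)
  have h2 : |p.2| ≤ n + 1 := abs_le_of_sq_le_sq (by nlinarith [sq_nonneg p.1]) (by positivity)
  exact ⟨abs_le.1 h1, abs_le.1 h2⟩

variable [IsProbabilityMeasure (radialLaw g)]

lemma integrableOn_log_generator (hg : Measurable g) (n : ℕ) :
    IntegrableOn (fun p => Real.log (g (p.1 ^ 2 + p.2 ^ 2))) (radialSet g n) (radialLaw g) := by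
  have h : Measurable fun p : ℝ × ℝ => g (p.1 ^ 2 + p.2 ^ 2) := hg.comp (by fun_prop)
  refine Measure.integrableOn_of_bounded (M := n) (measure_ne_top _ _)
    h.log.aestronglyMeasurable ?_
  filter_upwards [ae_restrict_mem (measurableSet_radialSet hg n)] with p hp
  exact abs_log_le_of_mul_ge n.cast_nonneg hp.2.1 hp.2.2

/-- Let `h` be the marginal density. For the negative part, integrating against `h dx` leaves `h *
(-log h)⁺ ≤ 1` on a bounded interval. For the positive part, `log h ≤ h`, and as `g ≤ n` on the
radial set, which lies in a horizontal strip, the integral of `h(p.1)` is at most `n` times the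
width of the strip. -/
lemma integrableOn_log_marginalDensity (hg : Measurable g) (n : ℕ) :
    IntegrableOn (fun p => Real.log (marginalDensity g p.1)) (radialSet g n) (radialLaw g) := by
  have hH := radialMarginal_absolutelyContinuous g
  have hm : Measurable fun x => Real.log (marginalDensity g x) := by fun_prop
  refine ⟨(hm.comp measurable_fst).aestronglyMeasurable, ?_⟩
  set S : Set ℝ := Icc (-(n + 1 : ℝ)) (n + 1) with hS
  have hSv : (volume : Measure ℝ) S ≠ ⊤ := measure_Icc_lt_top.ne
  have hneg : ∫⁻ p in radialSet g n, ENNReal.ofReal (-Real.log (marginalDensity g p.1))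
      ∂radialLaw g ≠ ⊤ := by
    refine ne_top_of_le_ne_top hSv ?_
    calc ∫⁻ p in radialSet g n, ENNReal.ofReal (-Real.log (marginalDensity g p.1)) ∂radialLaw g
        ≤ ∫⁻ p in Prod.fst ⁻¹' S, ENNReal.ofReal (-Real.log (marginalDensity g p.1))
            ∂radialLaw g := lintegral_mono_set fun p hp => (fst_mem_of_radialSet hp).1
      _ = ∫⁻ x in S, ENNReal.ofReal (-Real.log (marginalDensity g x)) ∂radialMarginal g := by
          rw [radialMarginal, setLIntegral_map measurableSet_Icc (by fun_prop) measurable_fst]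
      _ = ∫⁻ x in S, (radialMarginal g).rnDeriv volume x *
            ENNReal.ofReal (-Real.log (marginalDensity g x)) := by
          conv_lhs => rw [← Measure.withDensity_rnDeriv_eq _ _ hH]
          rw [setLIntegral_withDensity_eq_setLIntegral_mul _ (Measure.measurable_rnDeriv _ _)
            (by fun_prop) measurableSet_Icc]
          rfl
      _ ≤ ∫⁻ _ in S, 1 := by
          refine lintegral_mono_ae (ae_restrict_of_ae ?_)
          filter_upwards [Measure.rnDeriv_ne_top (radialMarginal g) volume] with x hx
          exact ENNReal.mul_ofReal_neg_log_le_one hx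
      _ = volume S := by simp
  have hpos : ∫⁻ p in radialSet g n, ENNReal.ofReal (marginalDensity g p.1) ∂radialLaw g ≠ ⊤ := by
    refine ne_top_of_le_ne_top (b := n * volume S) (ENNReal.mul_ne_top (by simp) hSv) ?_
    calc ∫⁻ p in radialSet g n, ENNReal.ofReal (marginalDensity g p.1) ∂radialLaw g
        = ∫⁻ p in radialSet g n, ENNReal.ofReal (g (p.1 ^ 2 + p.2 ^ 2)) *
            ENNReal.ofReal (marginalDensity g p.1) := by
          rw [radialLaw, setLIntegral_withDensity_eq_setLIntegral_mul _
            (measurable_radialDensity hg) (by fun_prop) (measurableSet_radialSet hg n)]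
          rfl
      _ ≤ ∫⁻ p in radialSet g n, n * (radialMarginal g).rnDeriv volume p.1 := by
          refine setLIntegral_mono ((Measure.measurable_rnDeriv _ _).comp measurable_fst
            |>.const_mul _) fun p hp => mul_le_mul' ?_ ENNReal.ofReal_toReal_le
          rw [← ENNReal.ofReal_natCast]
          exact ENNReal.ofReal_le_ofReal hp.2.1
      _ ≤ ∫⁻ p in univ ×ˢ S, n * (radialMarginal g).rnDeriv volume p.1 :=
          lintegral_mono_set fun p hp => ⟨mem_univ _, (fst_mem_of_radialSet hp).2⟩
      _ = n * volume S := by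
          have hrn := Measure.measurable_rnDeriv (radialMarginal g) volume
          have hrn' : Measurable fun p : ℝ × ℝ => (radialMarginal g).rnDeriv volume p.1 :=
            hrn.comp measurable_fst
          rw [lintegral_const_mul _ hrn', Measure.volume_eq_prod,
            ← Measure.prod_restrict, lintegral_prod _ hrn'.aemeasurable]
          simp only [lintegral_const, Measure.restrict_univ, MeasurableSet.univ,
            Measure.restrict_apply, univ_inter]
          rw [lintegral_mul_const _ hrn, Measure.lintegral_rnDeriv hH, measure_univ, one_mul]
  have hae : ∀ᵐ p ∂radialLaw g, 0 < marginalDensity g p.1 :=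
    ae_of_ae_map measurable_fst.aemeasurable (ae_marginalDensity_pos g)
  refine lt_of_le_of_lt (lintegral_mono_ae (g := fun p =>
    ENNReal.ofReal (-Real.log (marginalDensity g p.1)) + ENNReal.ofReal (marginalDensity g p.1))
    (ae_restrict_of_ae ?_)) ?_
  · filter_upwards [hae] with p hp
    rw [Real.enorm_eq_ofReal_abs]
    rcases le_total 0 (Real.log (marginalDensity g p.1)) with h | h
    · rw [abs_of_nonneg h]
      refine le_trans (ENNReal.ofReal_le_ofReal ?_) le_add_self
      linarith [Real.log_le_sub_one_of_pos hp]
    · rw [abs_of_nonpos h]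
      exact le_self_add
  · rw [lintegral_add_left (by fun_prop)]
    exact ENNReal.add_lt_top.2 ⟨hneg.lt_top, hpos.lt_top⟩

lemma integrableOn_logRatio (hg : Measurable g) {r : ℝ} (hr : |r| < 1) (n : ℕ) :
    IntegrableOn (logRatio g r) (radialSet g n) (radialLaw g) :=
  ((integrableOn_log_generator hg n).sub (integrableOn_log_marginalDensity hg n)).sub
    ((integrableOn_correlated_iff hg hr n (φ := fun x => Real.log (marginalDensity g x))
      (by fun_prop)).2 (integrableOn_log_marginalDensity hg n))

/-- On rotation invariant sets the mean of `logRatio` does not depend on the correlation. -/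
lemma setIntegral_logRatio (hg : Measurable g) {r : ℝ} (hr : |r| < 1) (n : ℕ) :
    ∫ p in radialSet g n, logRatio g r p ∂radialLaw g =
      ∫ p in radialSet g n, Real.log (g (p.1 ^ 2 + p.2 ^ 2)) ∂radialLaw g -
        ∫ p in radialSet g n, Real.log (marginalDensity g p.1) ∂radialLaw g -
        ∫ p in radialSet g n, Real.log (marginalDensity g p.1) ∂radialLaw g := by
  have h1 := integrableOn_log_generator hg n
  have h2 := integrableOn_log_marginalDensity hg n
  have hm : Measurable fun x => Real.log (marginalDensity g x) := by fun_prop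
  have h3 := (integrableOn_correlated_iff hg hr n hm).2 h2
  have h4 := setIntegral_correlated hg hr n hm
  conv_rhs => rw [← integral_sub h1 h2, ← h4]
  exact integral_sub (h1.sub h2) h3

end RadialExhaustion

/-- The entropy of elliptical copulas decreases strictly with `|r|`. -/
theorem divergence_lt_of_elliptical {g : ℝ → ℝ} [IsProbabilityMeasure (radialLaw g)]
    (hg : Measurable g) {C₁ C₂ : Copula} {r₁ r₂ : ℝ} (hr₁ : |r₁| < 1) (hr₂ : |r₂| < 1)
    (h₁ : ∀ x y, C₁.cdf (ProbabilityTheory.cdf (radialMarginal g) x)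
      (ProbabilityTheory.cdf (radialMarginal g) y) =
      (radialLaw g).real {p | p.1 ≤ x ∧ correlated r₁ p ≤ y})
    (h₂ : ∀ x y, C₂.cdf (ProbabilityTheory.cdf (radialMarginal g) x)
      (ProbabilityTheory.cdf (radialMarginal g) y) =
      (radialLaw g).real {p | p.1 ≤ x ∧ correlated r₂ p ≤ y})
    (h : |r₁| < |r₂|) (htop : C₂.divergence ≠ ⊤) : C₁.divergence < C₂.divergence := by
  obtain ⟨hiff₁, hval₁, hneg⟩ := divergence_elliptical hg hr₁ h₁
  obtain ⟨hiff₂, hval₂, -⟩ := divergence_elliptical hg hr₂ h₂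
  have hint₂ := hiff₂.1 htop
  -- On every radial set the mean of `logRatio` is the same for `r₁` and `r₂`. Hence integrability
  -- passes from `r₂` to `r₁`, the full integrals agree, and only the Jacobian term `-log √(1 - r²)`
  -- distinguishes the two divergences.
  obtain ⟨hint₁, heq⟩ := integrable_of_setIntegral_eq (measurable_logRatio hg r₁)
    (measurableSet_radialSet hg) (monotone_radialSet g) (ae_mem_iUnion_radialSet hg)
    (integrableOn_logRatio hg hr₁)
    (fun n => by rw [setIntegral_logRatio hg hr₁, setIntegral_logRatio hg hr₂]) hint₂ hneg
  rw [← ENNReal.toReal_lt_toReal (hiff₁.2 hint₁) htop, hval₁ hint₁, hval₂ hint₂, heq]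
  refine sub_lt_sub_left (Real.log_lt_log (sqrt_one_sub_sq_pos hr₂) ?_) _
  exact Real.sqrt_lt_sqrt (Real.sqrt_pos.1 (sqrt_one_sub_sq_pos hr₂)).le
    (sub_lt_sub_left (sq_lt_sq.2 h) 1)

/-- If `|r₁| < |r₂|`, the strict inequality of divergences would contradict the entropy hypothesis.
So `|r₂| ≤ |r₁|`, and `|ρ_s|` follows the same order. -/
theorem spearmanMonotone_of_conditionD {C : ℝ → Copula} {Θ : Set ℝ}
    (hC : ∀ θ ∈ Θ, (C θ).IsAbsCont) (h : ConditionD C Θ) : SpearmanMonotoneInEntropy C Θ := by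
  obtain ⟨g, hg, -, h⟩ := h
  intro θ₁ hθ₁ θ₂ hθ₂ hbot hle
  obtain ⟨htop, hdiv⟩ := Copula.divergence_of_entropy (hC θ₁ hθ₁) (hC θ₂ hθ₂) hbot hle
  obtain ⟨m₁, m₂, s₁, s₂, r₁, hs₁, hs₂, hr₁, hp, hc₁⟩ := h θ₁ hθ₁
  obtain ⟨n₁, n₂, t₁, t₂, r₂, ht₁, ht₂, hr₂, -, hc₂⟩ := h θ₂ hθ₂
  have := isProbabilityMeasure_radialLaw hg hs₁ hs₂ hr₁ hp
  have k₁ := IsCopulaOf.cdf_eq hg hs₁ hs₂ hr₁ hc₁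
  have k₂ := IsCopulaOf.cdf_eq hg ht₁ ht₂ hr₂ hc₂
  refine abs_spearmanRho_le_of_elliptical hg hr₂ hr₁ k₂ k₁ (not_lt.1 fun hlt => ?_)
  exact absurd (divergence_lt_of_elliptical hg hr₁ hr₂ k₁ k₂ hlt htop) (not_lt.2 hdiv)

theorem mainTheorem3 :
    (∀ (C : ℝ → Copula) (Θ : Set ℝ), (∀ θ ∈ Θ, (C θ).IsAbsCont) →
      ConditionA C Θ ∨ ConditionB C Θ ∨ ConditionD C Θ →
        SpearmanMonotoneInEntropy C Θ) ∧
    (∀ (C : ℝ → ℝ → Copula) (Θ Δ : Set ℝ), (∀ θ ∈ Θ, ∀ δ ∈ Δ, (C θ δ).IsAbsCont) →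
      ConditionC C Θ Δ →
        ∀ δ ∈ Δ, SpearmanMonotoneInEntropy (fun θ => C θ δ) Θ) := by
  refine ⟨fun C Θ hC h => ?_, fun C Θ Δ hC h δ hδ => spearmanMonotone_of_conditionC hC h hδ⟩
  rcases h with h | h | h
  · exact spearmanMonotone_of_conditionA hC h
  · exact spearmanMonotone_of_conditionB hC h
  · exact spearmanMonotone_of_conditionD hC h
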